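/- Let $p$ be a prime, let $k$ be an algebraically closed field of characteristic $p$, let $\mathcal O=W(k)$ be its ring of ($p$-typical) Witt vectors and let $K$ be the field of fractions of $\mathcal O$, with algebraic closure $\overline K$. Let $A$ be an $N$-dimensional Hopf algebra over $k$ that is semisimple (as an algebra) and cosemisimple (as a coalgebra). Then: (i) There exists a Hopf algebra $\overline A$ over $\mathcal O$, unique up to isomorphism of Hopf algebras over $\mathcal O$, such that $\overline A$ is free of rank $N$ as an $\mathcal O$-module and $\overline A/p\overline A=k\otimes_{\mathcal O}\overline A$ is isomorphic to $A$ as a Hopf algebra over $k$. (ii) Let $\overline A$ be as in (i). The Hopf algebra $A_0=\overline A\otimes_{\mathcal O}K$ over $K$ is semisimple and cosemisimple. Every irreducible module (respectively comodule) over $\overline K\otimes_K A_0$ is defined over $K$, that is, it is isomorphic to $\overline K\otimes_K V_0$ for some $A_0$-module (respectively $A_0$-comodule) $V_0$. There are a dimension-preserving bijection between the isomorphism classes of irreducible $A$-modules and those of irreducible $A_0$-modules, and an isomorphism of rings between the Grothendieck rings of the categories of finite-dimensional $A$-modules and of finite-dimensional $A_0$-modules that maps the class of each irreducible $A$-module to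 the class of the corresponding irreducible $A_0$-module. The same holds for comodules in place of modules. -/

import Mathlib

open scoped TensorProduct

universe u

namespace HopfLift

/-! ### Finite-dimensional modules over a bialgebra and their Grothendieck ring -/

section Modules

/-- A finite-dimensional (left) module over a `k`-algebra `A`. -/
structure FDModule (k A : Type u) [Field k] [Ring A] [Algebra k A] : Type (u + 1) where
  carrier : Type u
  [addCommGroup : AddCommGroup carrier]
  [moduleBase : Module k carrier]
  [module : Module A carrier]
  [isScalarTower : IsScalarTower k A carrier]
  [finite : Module.Finite k carrier]

namespace FDModule

attribute [instance] addCommGroup moduleBase module isScalarTower finite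

variable {k A : Type u} [Field k] [Ring A]

section Algebra

variable [Algebra k A]

/-- The action of `A` on a module as an algebra homomorphism `A → End_k(V)`. -/
def action (V : FDModule k A) : A →ₐ[k] Module.End k V.carrier :=
  Algebra.lsmul k k V.carrier

@[simp] lemma action_apply (V : FDModule k A) (a : A) (v : V.carrier) :
    V.action a v = a • v := rfl

/-- The `A`-module given by an algebra homomorphism `A → End_k(V)`. -/
def ofAction (V : Type u) [AddCommGroup V] [Module k V] [Module.Finite k V]
    (ρ : A →ₐ[k] Module.End k V) : FDModule k A :=
  letI : Module A V := Module.compHom V ρ.toRingHom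
  { carrier := V
    isScalarTower := ⟨fun c a v => by
      change ρ (c • a) v = c • ρ a v
      rw [map_smul, LinearMap.smul_apply]⟩ }

lemma ofAction_smul {V : Type u} [AddCommGroup V] [Module k V] [Module.Finite k V]
    (ρ : A →ₐ[k] Module.End k V) (a : A) (v : V) :
    (a • (show (ofAction V ρ).carrier from v) : (ofAction V ρ).carrier) = ρ a v := rfl

/-- Isomorphism of `A`-modules. -/
def Iso (V W : FDModule k A) : Prop := Nonempty (V.carrier ≃ₗ[A] W.carrier)

/-- There is a short exact sequence `0 → U → V → W → 0` of `A`-modules. -/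
def ShortExact (U V W : FDModule k A) : Prop :=
  ∃ (f : U.carrier →ₗ[A] V.carrier) (g : V.carrier →ₗ[A] W.carrier),
    Function.Injective f ∧ Function.Exact f g ∧ Function.Surjective g

/-- Irreducible modules. -/
def IsSimple (V : FDModule k A) : Prop := IsSimpleModule A V.carrier

instance setoid : Setoid (FDModule k A) where
  r := Iso
  iseqv := ⟨fun _ => ⟨LinearEquiv.refl _ _⟩, fun ⟨e⟩ => ⟨e.symm⟩, fun ⟨e⟩ ⟨f⟩ => ⟨e.trans f⟩⟩

/-- A `k`-linear equivalence that commutes with the actions is an isomorphism of modules. -/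
lemma iso_of_equiv {V W : FDModule k A} (e : V.carrier ≃ₗ[k] W.carrier)
    (h : ∀ (a : A) (v : V.carrier), e (a • v) = a • e v) : Iso V W :=
  ⟨{ e with map_smul' := h }⟩

variable (L : Type u) [Field L] [Algebra k L]

/-- The `L ⊗ A`-module `L ⊗ V` obtained from an `A`-module `V` by extension of scalars:
`(l ⊗ a) • (l' ⊗ v) = l l' ⊗ a v`. -/
noncomputable def baseChange (V : FDModule k A) : FDModule L (L ⊗[k] A) :=
  ofAction (L ⊗[k] V.carrier)
    (Algebra.TensorProduct.lift (Algebra.ofId L (Module.End L (L ⊗[k] V.carrier)))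
      ((Module.End.baseChangeHom k L V.carrier).comp V.action)
      (fun l _ => Algebra.commutes l _))

end Algebra

section Bialgebra

variable [Bialgebra k A]

/-- The action of `A ⊗ A` on `V ⊗ W`. -/
noncomputable def tensorAction₂ (V W : FDModule k A) :
    A ⊗[k] A →ₐ[k] Module.End k (V.carrier ⊗[k] W.carrier) :=
  (Module.endTensorEndAlgHom (R := k) (S := k) (A := k)).comp
    (Algebra.TensorProduct.map V.action W.action)

@[simp] lemma tensorAction₂_tmul (V W : FDModule k A) (a b : A) (v : V.carrier)
    (w : W.carrier) :
    tensorAction₂ V W (a ⊗ₜ b) (v ⊗ₜ w) = (a • v) ⊗ₜ (b • w) := rfl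

/-- The tensor product of two `A`-modules, `a • (v ⊗ w) = ∑ a₁ v ⊗ a₂ w`. -/
noncomputable def tensor (V W : FDModule k A) : FDModule k A :=
  ofAction (V.carrier ⊗[k] W.carrier)
    ((tensorAction₂ V W).comp (Bialgebra.comulAlgHom k A))

/-- The trivial `A`-module `k`, with action through the counit. -/
noncomputable def unit (k A : Type u) [Field k] [Ring A] [Bialgebra k A] : FDModule k A :=
  ofAction k ((Algebra.lsmul k k k).comp (Bialgebra.counitAlgHom k A))

lemma tensor_smul (V W : FDModule k A) (a : A) (t : (tensor V W).carrier) :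
    a • t = tensorAction₂ V W (Coalgebra.comul (R := k) a) t := rfl

lemma unit_smul (a : A) (c : (unit k A).carrier) :
    a • c = (show k from Coalgebra.counit (R := k) a * (show k from c)) := rfl

lemma iso_tensor {V V' W W' : FDModule k A} (h : Iso V V') (h' : Iso W W') :
    Iso (tensor V W) (tensor V' W') := by
  obtain ⟨e⟩ := h
  obtain ⟨f⟩ := h'
  have key : ∀ (x : A ⊗[k] A) (t : V.carrier ⊗[k] W.carrier),
      TensorProduct.congr (e.restrictScalars k) (f.restrictScalars k) (tensorAction₂ V W x t) =
        tensorAction₂ V' W' x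
          (TensorProduct.congr (e.restrictScalars k) (f.restrictScalars k) t) := by
    intro x t
    induction x with
    | zero => simp
    | add x y hx hy => simp only [map_add, LinearMap.add_apply, hx, hy]
    | tmul a b =>
      induction t with
      | zero => simp
      | add x y hx hy => simp only [map_add, hx, hy]
      | tmul v w => simp
  exact iso_of_equiv (V := tensor V W) (W := tensor V' W')
    (TensorProduct.congr (e.restrictScalars k) (f.restrictScalars k)) (fun a t => key _ t)

/-- The action of `A ⊗ (A ⊗ A)` on `U ⊗ (V ⊗ W)`. -/
noncomputable def tensorAction₃ (U V W : FDModule k A) :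
    A ⊗[k] (A ⊗[k] A) →ₐ[k] Module.End k (U.carrier ⊗[k] (V.carrier ⊗[k] W.carrier)) :=
  (Module.endTensorEndAlgHom (R := k) (S := k) (A := k)).comp
    (Algebra.TensorProduct.map U.action (tensorAction₂ V W))

lemma tensorAction₃_tmul (U V W : FDModule k A) (a : A) (y : A ⊗[k] A) (u : U.carrier)
    (t : V.carrier ⊗[k] W.carrier) :
    tensorAction₃ U V W (a ⊗ₜ y) (u ⊗ₜ t) = (a • u) ⊗ₜ tensorAction₂ V W y t := rfl

lemma iso_tensor_assoc (U V W : FDModule k A) :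
    Iso (tensor (tensor U V) W) (tensor U (tensor V W)) := by
  have aux : ∀ (y : A ⊗[k] A) (b : A) (u : U.carrier) (v : V.carrier) (w : W.carrier),
      TensorProduct.assoc k U.carrier V.carrier W.carrier
        (tensorAction₂ U V y (u ⊗ₜ[k] v) ⊗ₜ[k] (b • w)) =
      tensorAction₃ U V W (TensorProduct.assoc k A A A (y ⊗ₜ b)) (u ⊗ₜ (v ⊗ₜ w)) := by
    intro y b u v w
    induction y with
    | zero => simp
    | add y z hy hz =>
      simp only [map_add, LinearMap.add_apply, TensorProduct.add_tmul, hy, hz]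
    | tmul c d => rfl
  have left : ∀ (x : A ⊗[k] A) (u : U.carrier) (v : V.carrier) (w : W.carrier),
      TensorProduct.assoc k U.carrier V.carrier W.carrier
        (tensorAction₂ (tensor U V) W x
          (TensorProduct.tmul k (M := (tensor U V).carrier) (u ⊗ₜ[k] v) w)) =
      tensorAction₃ U V W (TensorProduct.assoc k A A A
        ((Coalgebra.comul (R := k) (A := A)).rTensor A x)) (u ⊗ₜ (v ⊗ₜ w)) := by
    intro x u v w
    induction x with
    | zero => simp; exact map_zero (TensorProduct.assoc k U.carrier V.carrier W.carrier)
    | add y z hy hz =>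
      simp only [map_add, LinearMap.add_apply] at hy hz ⊢
      rw [← hy, ← hz]
      exact map_add (TensorProduct.assoc k U.carrier V.carrier W.carrier) _ _
    | tmul a b => exact aux _ b u v w
  have right : ∀ (x : A ⊗[k] A) (u : U.carrier) (v : V.carrier) (w : W.carrier),
      tensorAction₂ U (tensor V W) x
          (TensorProduct.tmul k (N := (tensor V W).carrier) u (v ⊗ₜ[k] w)) =
      tensorAction₃ U V W
        ((Coalgebra.comul (R := k) (A := A)).lTensor A x) (u ⊗ₜ (v ⊗ₜ w)) := by
    intro x u v w
    induction x with
    | zero => simp; rfl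
    | add y z hy hz =>
      simp only [map_add, LinearMap.add_apply] at hy hz ⊢
      rw [← hy, ← hz]
      rfl
    | tmul a b => rfl
  have main : ∀ a : A,
      (TensorProduct.assoc k U.carrier V.carrier W.carrier).toLinearMap ∘ₗ
        (show Module.End k ((U.carrier ⊗[k] V.carrier) ⊗[k] W.carrier) from
          (tensor (tensor U V) W).action a) =
      (show Module.End k (U.carrier ⊗[k] (V.carrier ⊗[k] W.carrier)) from
          (tensor U (tensor V W)).action a) ∘ₗ
        (TensorProduct.assoc k U.carrier V.carrier W.carrier).toLinearMap := by
    intro a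
    refine TensorProduct.ext_threefold fun u v w => ?_
    refine (left (Coalgebra.comul (R := k) a) u v w).trans ?_
    refine Eq.trans ?_ (right (Coalgebra.comul (R := k) a) u v w).symm
    rw [Coalgebra.coassoc_apply]
  exact iso_of_equiv (V := tensor (tensor U V) W) (W := tensor U (tensor V W))
    (TensorProduct.assoc k U.carrier V.carrier W.carrier)
    (fun a t => LinearMap.congr_fun (main a) t)

lemma iso_unit_tensor (V : FDModule k A) : Iso (tensor (unit k A) V) V := by
  have key : ∀ (x : A ⊗[k] A) (c : k) (v : V.carrier),
      TensorProduct.lid k V.carrier (tensorAction₂ (unit k A) V x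
        (TensorProduct.tmul k (M := (unit k A).carrier) c v)) =
      c • (TensorProduct.lid k A ((Coalgebra.counit (R := k) (A := A)).rTensor A x) • v) := by
    intro x c v
    induction x with
    | zero => simp; exact map_zero (TensorProduct.lid k V.carrier)
    | add y z hy hz =>
      simp only [map_add, LinearMap.add_apply, add_smul, smul_add] at hy hz ⊢
      rw [← hy, ← hz]
      exact map_add (TensorProduct.lid k V.carrier) _ _
    | tmul a b =>
      refine (TensorProduct.lid_tmul (R := k) (M := V.carrier) (b • v)
        (Coalgebra.counit (R := k) a * c)).trans ?_
      simp [mul_comm, mul_smul]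
  have main : ∀ a : A,
      (TensorProduct.lid k V.carrier).toLinearMap ∘ₗ
        (show Module.End k (k ⊗[k] V.carrier) from (tensor (unit k A) V).action a) =
      V.action a ∘ₗ (TensorProduct.lid k V.carrier).toLinearMap := by
    intro a
    refine TensorProduct.ext' fun c v => ?_
    refine (key (Coalgebra.comul (R := k) a) c v).trans ?_
    simp
  exact iso_of_equiv (V := tensor (unit k A) V) (W := V) (TensorProduct.lid k V.carrier)
    (fun a t => LinearMap.congr_fun (main a) t)

lemma iso_tensor_unit (V : FDModule k A) : Iso (tensor V (unit k A)) V := by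
  have key : ∀ (x : A ⊗[k] A) (c : k) (v : V.carrier),
      TensorProduct.rid k V.carrier (tensorAction₂ V (unit k A) x
        (TensorProduct.tmul k (N := (unit k A).carrier) v c)) =
      c • (TensorProduct.rid k A ((Coalgebra.counit (R := k) (A := A)).lTensor A x) • v) := by
    intro x c v
    induction x with
    | zero => simp; exact map_zero (TensorProduct.rid k V.carrier)
    | add y z hy hz =>
      simp only [map_add, LinearMap.add_apply, add_smul, smul_add] at hy hz ⊢
      rw [← hy, ← hz]
      exact map_add (TensorProduct.rid k V.carrier) _ _
    | tmul a b =>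
      refine (TensorProduct.rid_tmul (R := k) (M := V.carrier)
        (a • v) (Coalgebra.counit (R := k) b * c)).trans ?_
      simp [mul_comm, mul_smul]
  have main : ∀ a : A,
      (TensorProduct.rid k V.carrier).toLinearMap ∘ₗ
        (show Module.End k (V.carrier ⊗[k] k) from (tensor V (unit k A)).action a) =
      V.action a ∘ₗ (TensorProduct.rid k V.carrier).toLinearMap := by
    intro a
    refine TensorProduct.ext' fun v c => ?_
    refine (key (Coalgebra.comul (R := k) a) c v).trans ?_
    simp
  exact iso_of_equiv (V := tensor V (unit k A)) (W := V) (TensorProduct.rid k V.carrier)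
    (fun a t => LinearMap.congr_fun (main a) t)

end Bialgebra

end FDModule

section Grothendieck

variable (k A : Type u) [Field k] [Ring A]

/-- Isomorphism classes of finite-dimensional `A`-modules. -/
def ModClass [Algebra k A] : Type (u + 1) := Quotient (FDModule.setoid (k := k) (A := A))

variable {k A} in
/-- The isomorphism class of a module. -/
def FDModule.isoClass [Algebra k A] (V : FDModule k A) : ModClass k A := Quotient.mk _ V

variable {k A} in
/-- The dimension of an isomorphism class of modules. -/
noncomputable def ModClass.dim [Algebra k A] : ModClass k A → ℕ :=
  Quotient.lift (fun V : FDModule k A => Module.finrank k V.carrier)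
    (fun _ _ ⟨e⟩ => (e.restrictScalars k).finrank_eq)

/-- Isomorphism classes of irreducible `A`-modules (over a finite-dimensional algebra every
irreducible module is finite-dimensional). -/
def IrrMod [Algebra k A] : Type (u + 1) :=
  {c : ModClass k A // ∃ V : FDModule k A, V.IsSimple ∧ V.isoClass = c}

/-- Isomorphism classes of modules over a bialgebra form a monoid under tensor product. -/
noncomputable instance ModClass.monoid [Bialgebra k A] : Monoid (ModClass k A) where
  mul := Quotient.map₂ FDModule.tensor (fun _ _ h _ _ h' => FDModule.iso_tensor h h')
  one := (FDModule.unit k A).isoClass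
  mul_assoc := by
    rintro ⟨U⟩ ⟨V⟩ ⟨W⟩
    exact Quotient.sound (FDModule.iso_tensor_assoc U V W)
  one_mul := by
    rintro ⟨V⟩
    exact Quotient.sound (FDModule.iso_unit_tensor V)
  mul_one := by
    rintro ⟨V⟩
    exact Quotient.sound (FDModule.iso_tensor_unit V)

/-- The relations `[V] = [U] + [W]` for short exact sequences `0 → U → V → W → 0`. -/
inductive ModRel [Bialgebra k A] :
    FreeAbelianGroup (ModClass k A) → FreeAbelianGroup (ModClass k A) → Prop
  | mk (U V W : FDModule k A) (h : FDModule.ShortExact U V W) :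
      ModRel (FreeAbelianGroup.of V.isoClass)
        (FreeAbelianGroup.of U.isoClass + FreeAbelianGroup.of W.isoClass)

/-- The Grothendieck ring of the category of finite-dimensional modules over a bialgebra: the
free abelian group on isomorphism classes of modules, with the product induced by the tensor
product, modulo `[V] = [U] + [W]` for all short exact sequences `0 → U → V → W → 0`.
(Since the tensor product over a field is exact, the ideal that these relations generate is the
subgroup that they generate.) -/
def ModGrothendieckRing [Bialgebra k A] : Type (u + 1) := RingQuot (ModRel k A)

noncomputable instance [Bialgebra k A] : Ring (ModGrothendieckRing k A) :=
  inferInstanceAs (Ring (RingQuot (ModRel k A)))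

variable {k A} in
/-- The element `[V]` of the Grothendieck ring. -/
noncomputable def ModClass.toGrothendieckRing [Bialgebra k A] (c : ModClass k A) :
    ModGrothendieckRing k A :=
  RingQuot.mkRingHom (ModRel k A) (FreeAbelianGroup.of c)

end Grothendieck

end Modules

/-! ### Finite-dimensional comodules over a bialgebra and their Grothendieck ring -/

section Comodules

/-- A subspace `W` of a (right) comodule with coaction `δ : V → V ⊗ C` is a subcomodule if
`δ(W) ⊆ W ⊗ C`. -/
def IsSubcomodule {k C V : Type u} [Field k] [AddCommGroup C] [Module k C] [AddCommGroup V]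
    [Module k V] (δ : V →ₗ[k] V ⊗[k] C) (W : Submodule k V) : Prop :=
  ∀ w ∈ W, δ w ∈ LinearMap.range (W.subtype.rTensor C)

/-- A coalgebra is cosemisimple if it is completely reducible as a (right) comodule over
itself: every subcomodule has a complementary subcomodule. -/
def IsCosemisimple (k C : Type u) [Field k] [AddCommGroup C] [Module k C] [Coalgebra k C] :
    Prop :=
  ∀ W : Submodule k C, IsSubcomodule (Coalgebra.comul (R := k) (A := C)) W →
    ∃ W' : Submodule k C, IsSubcomodule (Coalgebra.comul (R := k) (A := C)) W' ∧ IsCompl W W'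

/-- A finite-dimensional (right) comodule over a `k`-coalgebra `C`. -/
structure FDComodule (k C : Type u) [Field k] [AddCommGroup C] [Module k C] [Coalgebra k C] :
    Type (u + 1) where
  carrier : Type u
  [addCommGroup : AddCommGroup carrier]
  [module : Module k carrier]
  [finite : Module.Finite k carrier]
  coact : carrier →ₗ[k] carrier ⊗[k] C
  coassoc : (TensorProduct.assoc k carrier C C).toLinearMap ∘ₗ coact.rTensor C ∘ₗ coact =
    Coalgebra.comul.lTensor carrier ∘ₗ coact
  counit : (TensorProduct.rid k carrier).toLinearMap ∘ₗ
    Coalgebra.counit.lTensor carrier ∘ₗ coact = LinearMap.id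

namespace FDComodule

attribute [instance] addCommGroup module finite

variable {k C : Type u} [Field k]

section Coalgebra

variable [AddCommGroup C] [Module k C] [Coalgebra k C]

lemma coassoc_apply (V : FDComodule k C) (v : V.carrier) :
    TensorProduct.assoc k V.carrier C C (V.coact.rTensor C (V.coact v)) =
      Coalgebra.comul.lTensor V.carrier (V.coact v) := LinearMap.congr_fun V.coassoc v

lemma counit_apply (V : FDComodule k C) (v : V.carrier) :
    TensorProduct.rid k V.carrier (Coalgebra.counit.lTensor V.carrier (V.coact v)) = v :=
  LinearMap.congr_fun V.counit v

/-- Homomorphisms of comodules. -/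
def IsHom {V W : FDComodule k C} (f : V.carrier →ₗ[k] W.carrier) : Prop :=
  W.coact ∘ₗ f = f.rTensor C ∘ₗ V.coact

/-- Isomorphism of comodules. -/
def Iso (V W : FDComodule k C) : Prop :=
  ∃ e : V.carrier ≃ₗ[k] W.carrier, IsHom (V := V) (W := W) e.toLinearMap

/-- There is a short exact sequence `0 → U → V → W → 0` of comodules. -/
def ShortExact (U V W : FDComodule k C) : Prop :=
  ∃ (f : U.carrier →ₗ[k] V.carrier) (g : V.carrier →ₗ[k] W.carrier),
    IsHom f ∧ IsHom g ∧ Function.Injective f ∧ Function.Exact f g ∧ Function.Surjective g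

/-- Irreducible comodules. -/
def IsSimple (V : FDComodule k C) : Prop :=
  Nontrivial V.carrier ∧
    ∀ W : Submodule k V.carrier, IsSubcomodule V.coact W → W = ⊥ ∨ W = ⊤

lemma Iso.refl (V : FDComodule k C) : Iso V V := ⟨LinearEquiv.refl _ _, by simp [IsHom]⟩

lemma Iso.symm {V W : FDComodule k C} : Iso V W → Iso W V := by
  rintro ⟨e, he⟩
  refine ⟨e.symm, LinearMap.ext fun w => ?_⟩
  obtain ⟨v, rfl⟩ := e.surjective w
  have h := LinearMap.congr_fun he v
  simp only [LinearMap.comp_apply, LinearEquiv.coe_coe] at h ⊢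
  rw [h, ← LinearMap.rTensor_comp_apply]
  simp

lemma Iso.trans {U V W : FDComodule k C} : Iso U V → Iso V W → Iso U W := by
  rintro ⟨e, he⟩ ⟨f, hf⟩
  refine ⟨e.trans f, LinearMap.ext fun v => ?_⟩
  have h := LinearMap.congr_fun he v
  have h' := LinearMap.congr_fun hf (e v)
  simp only [LinearMap.comp_apply, LinearEquiv.coe_coe, LinearEquiv.coe_trans,
    LinearMap.rTensor_comp] at h h' ⊢
  rw [h', h]

instance setoid : Setoid (FDComodule k C) where
  r := Iso
  iseqv := ⟨Iso.refl, Iso.symm, Iso.trans⟩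

end Coalgebra

section Bialgebra

variable [Ring C]

/-- The map `(V ⊗ B) ⊗ (W ⊗ B) → (V ⊗ W) ⊗ B`, `(v ⊗ b) ⊗ (w ⊗ b') ↦ (v ⊗ w) ⊗ b b'`. -/
noncomputable def mulMap (k B V W : Type u) [Field k] [Ring B] [Algebra k B]
    [AddCommGroup V] [Module k V] [AddCommGroup W] [Module k W] :
    (V ⊗[k] B) ⊗[k] (W ⊗[k] B) →ₗ[k] (V ⊗[k] W) ⊗[k] B :=
  (LinearMap.mul' k B).lTensor (V ⊗[k] W) ∘ₗ
    (TensorProduct.tensorTensorTensorComm k V B W B).toLinearMap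

@[simp] lemma mulMap_tmul {k B V W : Type u} [Field k] [Ring B] [Algebra k B]
    [AddCommGroup V] [Module k V] [AddCommGroup W] [Module k W] (v : V) (b : B) (w : W)
    (b' : B) : mulMap k B V W ((v ⊗ₜ b) ⊗ₜ (w ⊗ₜ b')) = (v ⊗ₜ w) ⊗ₜ (b * b') := rfl

variable [Bialgebra k C]

/-- The coaction on the tensor product of two comodules,
`v ⊗ w ↦ ∑ (v₀ ⊗ w₀) ⊗ v₁ w₁`. -/
noncomputable def tensorCoact (V W : FDComodule k C) :
    V.carrier ⊗[k] W.carrier →ₗ[k] (V.carrier ⊗[k] W.carrier) ⊗[k] C :=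
  mulMap k C V.carrier W.carrier ∘ₗ TensorProduct.map V.coact W.coact

@[simp] lemma tensorCoact_tmul (V W : FDComodule k C) (v : V.carrier) (w : W.carrier) :
    tensorCoact V W (v ⊗ₜ w) = mulMap k C V.carrier W.carrier (V.coact v ⊗ₜ W.coact w) := rfl

lemma mulMap_comul (V W : FDComodule k C) (x : V.carrier ⊗[k] C) (y : W.carrier ⊗[k] C) :
    Coalgebra.comul.lTensor _ (mulMap k C V.carrier W.carrier (x ⊗ₜ y)) =
      mulMap k (C ⊗[k] C) V.carrier W.carrier
        (Coalgebra.comul.lTensor _ x ⊗ₜ Coalgebra.comul.lTensor _ y) := by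
  induction x with
  | zero => simp
  | add x x' hx hx' => simp only [TensorProduct.add_tmul, map_add, hx, hx']
  | tmul v c =>
    induction y with
    | zero => simp
    | add y y' hy hy' => simp only [TensorProduct.tmul_add, map_add, hy, hy']
    | tmul w d => simp

lemma mulMap_counit (V W : FDComodule k C) (x : V.carrier ⊗[k] C) (y : W.carrier ⊗[k] C) :
    TensorProduct.rid k _ (Coalgebra.counit.lTensor _
      (mulMap k C V.carrier W.carrier (x ⊗ₜ y))) =
      TensorProduct.rid k _ (Coalgebra.counit.lTensor _ x) ⊗ₜ
        TensorProduct.rid k _ (Coalgebra.counit.lTensor _ y) := by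
  induction x with
  | zero => simp
  | add x x' hx hx' => simp only [TensorProduct.add_tmul, map_add, hx, hx']
  | tmul v c =>
    induction y with
    | zero => simp
    | add y y' hy hy' => simp only [TensorProduct.tmul_add, map_add, hy, hy']
    | tmul w d =>
      simp only [mulMap_tmul, LinearMap.lTensor_tmul, TensorProduct.rid_tmul,
        Bialgebra.counit_mul, TensorProduct.smul_tmul_smul]

lemma mulMap_assoc_aux (V W : FDComodule k C) (x : V.carrier ⊗[k] C) (y : W.carrier ⊗[k] C)
    (c d : C) :
    TensorProduct.assoc k _ C C (mulMap k C V.carrier W.carrier (x ⊗ₜ y) ⊗ₜ (c * d)) =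
      mulMap k (C ⊗[k] C) V.carrier W.carrier
        (TensorProduct.assoc k _ C C (x ⊗ₜ c) ⊗ₜ TensorProduct.assoc k _ C C (y ⊗ₜ d)) := by
  induction x with
  | zero => simp
  | add x x' hx hx' => simp only [TensorProduct.add_tmul, map_add, hx, hx']
  | tmul v c =>
    induction y with
    | zero => simp
    | add y y' hy hy' =>
      simp only [TensorProduct.tmul_add, TensorProduct.add_tmul, map_add, hy, hy']
    | tmul w d => simp

lemma mulMap_coact (V W : FDComodule k C) (x : V.carrier ⊗[k] C) (y : W.carrier ⊗[k] C) :
    TensorProduct.assoc k _ C C ((tensorCoact V W).rTensor C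
      (mulMap k C V.carrier W.carrier (x ⊗ₜ y))) =
      mulMap k (C ⊗[k] C) V.carrier W.carrier
        (TensorProduct.assoc k _ C C (V.coact.rTensor C x) ⊗ₜ
          TensorProduct.assoc k _ C C (W.coact.rTensor C y)) := by
  induction x with
  | zero => simp
  | add x x' hx hx' => simp only [TensorProduct.add_tmul, map_add, hx, hx']
  | tmul v c =>
    induction y with
    | zero => simp
    | add y y' hy hy' => simp only [TensorProduct.tmul_add, map_add, hy, hy']
    | tmul w d => simp [mulMap_assoc_aux]

/-- The tensor product of two comodules. -/
noncomputable def tensor (V W : FDComodule k C) : FDComodule k C where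
  carrier := V.carrier ⊗[k] W.carrier
  coact := tensorCoact V W
  coassoc := TensorProduct.ext' fun v w => by
    simp [mulMap_coact, mulMap_comul, coassoc_apply]
  counit := TensorProduct.ext' fun v w => by
    simp [mulMap_counit, counit_apply]

/-- The trivial comodule `k`, with coaction `1 ↦ 1 ⊗ 1`. -/
noncomputable def unit (k C : Type u) [Field k] [Ring C] [Bialgebra k C] : FDComodule k C where
  carrier := k
  coact := (TensorProduct.mk k k C).flip 1
  coassoc := by ext; simp [Algebra.TensorProduct.one_def]
  counit := by ext; simp

lemma iso_tensor {V V' W W' : FDComodule k C} (h : Iso V V') (h' : Iso W W') :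
    Iso (tensor V W) (tensor V' W') := by
  obtain ⟨e, he⟩ := h
  obtain ⟨f, hf⟩ := h'
  have key : ∀ (x : V.carrier ⊗[k] C) (y : W.carrier ⊗[k] C),
      mulMap k C V'.carrier W'.carrier
        (e.toLinearMap.rTensor C x ⊗ₜ f.toLinearMap.rTensor C y) =
      (TensorProduct.congr e f).toLinearMap.rTensor C
        (mulMap k C V.carrier W.carrier (x ⊗ₜ y)) := by
    intro x y
    induction x with
    | zero => simp
    | add x x' hx hx' => simp only [TensorProduct.add_tmul, map_add, hx, hx']
    | tmul v c =>
      induction y with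
      | zero => simp
      | add y y' hy hy' => simp only [TensorProduct.tmul_add, map_add, hy, hy']
      | tmul w d => simp
  refine ⟨TensorProduct.congr e f, TensorProduct.ext' fun v w => ?_⟩
  have h₁ : V'.coact (e v) = e.toLinearMap.rTensor C (V.coact v) := LinearMap.congr_fun he v
  have h₂ : W'.coact (f w) = f.toLinearMap.rTensor C (W.coact w) := LinearMap.congr_fun hf w
  refine Eq.trans ?_ (key (V.coact v) (W.coact w))
  rw [← h₁, ← h₂]
  rfl

lemma iso_tensor_assoc (U V W : FDComodule k C) :
    Iso (tensor (tensor U V) W) (tensor U (tensor V W)) := by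
  have key : ∀ (x : U.carrier ⊗[k] C) (y : V.carrier ⊗[k] C) (z : W.carrier ⊗[k] C),
      mulMap k C U.carrier (V.carrier ⊗[k] W.carrier)
        (x ⊗ₜ mulMap k C V.carrier W.carrier (y ⊗ₜ z)) =
      (TensorProduct.assoc k U.carrier V.carrier W.carrier).toLinearMap.rTensor C
        (mulMap k C (U.carrier ⊗[k] V.carrier) W.carrier
          (mulMap k C U.carrier V.carrier (x ⊗ₜ y) ⊗ₜ z)) := by
    intro x y z
    induction x with
    | zero => simp
    | add x x' hx hx' => simp only [TensorProduct.add_tmul, map_add, hx, hx']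
    | tmul u b =>
      induction y with
      | zero => simp
      | add y y' hy hy' =>
        simp only [TensorProduct.tmul_add, TensorProduct.add_tmul, map_add, hy, hy']
      | tmul v c =>
        induction z with
        | zero => simp
        | add z z' hz hz' => simp only [TensorProduct.tmul_add, map_add, hz, hz']
        | tmul w d => simp [mul_assoc]
  refine ⟨TensorProduct.assoc k U.carrier V.carrier W.carrier,
    TensorProduct.ext_threefold fun u v w => ?_⟩
  exact key (U.coact u) (V.coact v) (W.coact w)

lemma iso_unit_tensor (V : FDComodule k C) : Iso (tensor (unit k C) V) V := by
  have key : ∀ (c : k) (y : V.carrier ⊗[k] C),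
      c • y = (TensorProduct.lid k V.carrier).toLinearMap.rTensor C
        (mulMap k C k V.carrier ((c ⊗ₜ 1) ⊗ₜ y)) := by
    intro c y
    induction y with
    | zero => simp
    | add y y' hy hy' => simp only [TensorProduct.tmul_add, map_add, smul_add, ← hy, ← hy']
    | tmul v d => simp [TensorProduct.smul_tmul']
  refine ⟨TensorProduct.lid k V.carrier, TensorProduct.ext' fun c v => ?_⟩
  refine Eq.trans ?_ (key c (V.coact v))
  exact (congrArg V.coact (TensorProduct.lid_tmul (R := k) v c)).trans
    (map_smul V.coact (show k from c) v)

lemma iso_tensor_unit (V : FDComodule k C) : Iso (tensor V (unit k C)) V := by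
  have key : ∀ (c : k) (y : V.carrier ⊗[k] C),
      c • y = (TensorProduct.rid k V.carrier).toLinearMap.rTensor C
        (mulMap k C V.carrier k (y ⊗ₜ (c ⊗ₜ 1))) := by
    intro c y
    induction y with
    | zero => simp
    | add y y' hy hy' => simp only [TensorProduct.add_tmul, map_add, smul_add, ← hy, ← hy']
    | tmul v d => simp [TensorProduct.smul_tmul']
  refine ⟨TensorProduct.rid k V.carrier, TensorProduct.ext' fun v c => ?_⟩
  refine Eq.trans ?_ (key c (V.coact v))
  exact (congrArg V.coact (TensorProduct.rid_tmul (R := k) v c)).trans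
    (map_smul V.coact (show k from c) v)

variable (L : Type u) [Field L] [Algebra k L]

open TensorProduct.AlgebraTensorModule

lemma comul_baseChange_tmul (l : L) (c : C) :
    Coalgebra.comul (R := L) (A := L ⊗[k] C) (l ⊗ₜ c) =
      distribBaseChange k L C C (l ⊗ₜ Coalgebra.comul (R := k) c) := by
  rw [TensorProduct.comul_def]
  simp only [LinearMap.comp_apply, LinearEquiv.coe_coe, map_tmul, CommSemiring.comul_apply]
  induction Coalgebra.comul (R := k) c with
  | zero => simp
  | add x y hx hy => simp only [TensorProduct.tmul_add, map_add, hx, hy]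
  | tmul a b =>
    have h : (l ⊗ₜ[k] b : L ⊗[k] C) = l • ((1 : L) ⊗ₜ[k] b) := by
      simp [TensorProduct.smul_tmul']
    simp only [tensorTensorTensorComm_tmul, distribBaseChange_tmul]
    rw [h, TensorProduct.tmul_smul, TensorProduct.smul_tmul', TensorProduct.smul_tmul']
    simp

/-- The coaction `l ⊗ v ↦ ∑ (l ⊗ v₀) ⊗ (1 ⊗ v₁)` on `L ⊗ V`. -/
noncomputable def baseChangeCoact (V : FDComodule k C) :
    L ⊗[k] V.carrier →ₗ[L] (L ⊗[k] V.carrier) ⊗[L] (L ⊗[k] C) :=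
  (distribBaseChange k L V.carrier C).toLinearMap ∘ₗ V.coact.baseChange L

lemma baseChangeCoact_tmul (V : FDComodule k C) (l : L) (v : V.carrier) :
    baseChangeCoact L V (l ⊗ₜ v) = distribBaseChange k L V.carrier C (l ⊗ₜ V.coact v) := by
  simp [baseChangeCoact]

lemma baseChange_aux₁ (V : FDComodule k C) (l : L) (y : V.carrier ⊗[k] C) (c : C) :
    TensorProduct.assoc L _ _ _
      (distribBaseChange k L V.carrier C (l ⊗ₜ y) ⊗ₜ[L] ((1 : L) ⊗ₜ[k] c)) =
    (distribBaseChange k L C C).toLinearMap.lTensor _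
      (distribBaseChange k L V.carrier (C ⊗[k] C)
        (l ⊗ₜ TensorProduct.assoc k _ _ _ (y ⊗ₜ c))) := by
  induction y with
  | zero => simp
  | add x y hx hy =>
    simp only [TensorProduct.tmul_add, TensorProduct.add_tmul, map_add, hx, hy]
  | tmul v d => simp [distribBaseChange_tmul]

lemma baseChange_aux₂ (V : FDComodule k C) (l : L) (x : V.carrier ⊗[k] C) :
    TensorProduct.assoc L _ _ _ ((baseChangeCoact L V).rTensor (L ⊗[k] C)
      (distribBaseChange k L V.carrier C (l ⊗ₜ x))) =
    (distribBaseChange k L C C).toLinearMap.lTensor _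
      (distribBaseChange k L V.carrier (C ⊗[k] C)
        (l ⊗ₜ TensorProduct.assoc k _ _ _ (V.coact.rTensor C x))) := by
  induction x with
  | zero => simp
  | add x y hx hy => simp only [TensorProduct.tmul_add, map_add, hx, hy]
  | tmul v d =>
    simp only [distribBaseChange_tmul, LinearMap.rTensor_tmul, baseChangeCoact_tmul,
      baseChange_aux₁]

lemma baseChange_aux₃ (V : FDComodule k C) (l : L) (x : V.carrier ⊗[k] C) :
    (Coalgebra.comul (R := L) (A := L ⊗[k] C)).lTensor _
      (distribBaseChange k L V.carrier C (l ⊗ₜ x)) =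
    (distribBaseChange k L C C).toLinearMap.lTensor _
      (distribBaseChange k L V.carrier (C ⊗[k] C)
        (l ⊗ₜ (Coalgebra.comul (R := k) (A := C)).lTensor _ x)) := by
  induction x with
  | zero => simp
  | add x y hx hy => simp only [TensorProduct.tmul_add, map_add, hx, hy]
  | tmul v d => simp only [distribBaseChange_tmul, LinearMap.lTensor_tmul,
      comul_baseChange_tmul, LinearEquiv.coe_coe]

lemma baseChange_aux₄ (V : FDComodule k C) (l : L) (x : V.carrier ⊗[k] C) :
    TensorProduct.rid L _ ((Coalgebra.counit (R := L) (A := L ⊗[k] C)).lTensor _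
      (distribBaseChange k L V.carrier C (l ⊗ₜ x))) =
    l ⊗ₜ TensorProduct.rid k _ ((Coalgebra.counit (R := k) (A := C)).lTensor _ x) := by
  induction x with
  | zero => simp
  | add x y hx hy => simp only [TensorProduct.tmul_add, map_add, hx, hy]
  | tmul v d =>
    simp only [distribBaseChange_tmul, LinearMap.lTensor_tmul, TensorProduct.rid_tmul,
      TensorProduct.counit_tmul, CommSemiring.counit_apply, TensorProduct.tmul_smul]
    rw [← algebraMap_smul L, map_smul, TensorProduct.rid_tmul, one_smul, algebraMap_smul]

/-- The `L ⊗ C`-comodule `L ⊗ V` obtained from a `C`-comodule `V` by extension of scalars. -/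
noncomputable def baseChange (V : FDComodule k C) : FDComodule L (L ⊗[k] C) where
  carrier := L ⊗[k] V.carrier
  coact := baseChangeCoact L V
  coassoc := by
    ext v
    simp [baseChangeCoact_tmul, baseChange_aux₂, baseChange_aux₃, coassoc_apply]
  counit := by
    ext v
    simp [baseChangeCoact_tmul, baseChange_aux₄, counit_apply]

end Bialgebra

end FDComodule

section Grothendieck

variable (k C : Type u) [Field k]

/-- Isomorphism classes of finite-dimensional `C`-comodules. -/
def ComodClass [AddCommGroup C] [Module k C] [Coalgebra k C] : Type (u + 1) :=
  Quotient (FDComodule.setoid (k := k) (C := C))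

variable {k C} in
/-- The isomorphism class of a comodule. -/
def FDComodule.isoClass [AddCommGroup C] [Module k C] [Coalgebra k C] (V : FDComodule k C) :
    ComodClass k C := Quotient.mk _ V

variable {k C} in
/-- The dimension of an isomorphism class of comodules. -/
noncomputable def ComodClass.dim [AddCommGroup C] [Module k C] [Coalgebra k C] :
    ComodClass k C → ℕ :=
  Quotient.lift (fun V : FDComodule k C => Module.finrank k V.carrier)
    (fun _ _ ⟨e, _⟩ => e.finrank_eq)

/-- Isomorphism classes of irreducible `C`-comodules (every irreducible comodule is
finite-dimensional). -/
def IrrComod [AddCommGroup C] [Module k C] [Coalgebra k C] : Type (u + 1) :=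
  {c : ComodClass k C // ∃ V : FDComodule k C, V.IsSimple ∧ V.isoClass = c}

variable [Ring C] [Bialgebra k C]

/-- Isomorphism classes of comodules over a bialgebra form a monoid under tensor product. -/
noncomputable instance ComodClass.monoid : Monoid (ComodClass k C) where
  mul := Quotient.map₂ FDComodule.tensor (fun _ _ h _ _ h' => FDComodule.iso_tensor h h')
  one := (FDComodule.unit k C).isoClass
  mul_assoc := by
    rintro ⟨U⟩ ⟨V⟩ ⟨W⟩
    exact Quotient.sound (FDComodule.iso_tensor_assoc U V W)
  one_mul := by
    rintro ⟨V⟩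
    exact Quotient.sound (FDComodule.iso_unit_tensor V)
  mul_one := by
    rintro ⟨V⟩
    exact Quotient.sound (FDComodule.iso_tensor_unit V)

/-- The relations `[V] = [U] + [W]` for short exact sequences `0 → U → V → W → 0`. -/
inductive ComodRel :
    FreeAbelianGroup (ComodClass k C) → FreeAbelianGroup (ComodClass k C) → Prop
  | mk (U V W : FDComodule k C) (h : FDComodule.ShortExact U V W) :
      ComodRel (FreeAbelianGroup.of V.isoClass)
        (FreeAbelianGroup.of U.isoClass + FreeAbelianGroup.of W.isoClass)

/-- The Grothendieck ring of the category of finite-dimensional comodules over a bialgebra. -/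
def ComodGrothendieckRing : Type (u + 1) := RingQuot (ComodRel k C)

noncomputable instance : Ring (ComodGrothendieckRing k C) :=
  inferInstanceAs (Ring (RingQuot (ComodRel k C)))

variable {k C} in
/-- The element `[V]` of the Grothendieck ring. -/
noncomputable def ComodClass.toGrothendieckRing (c : ComodClass k C) :
    ComodGrothendieckRing k C :=
  RingQuot.mkRingHom (ComodRel k C) (FreeAbelianGroup.of c)

end Grothendieck

end Comodules

/-! ### Lifts to the Witt vectors -/

section Lift

variable (p : ℕ) [Fact p.Prime] (k : Type u) [Field k] [CharP k p]

/-- The residue field `k` as an algebra over the ring of Witt vectors `W(k)`. For perfect `k` the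
structure map `W(k) → k` is surjective with kernel `p W(k)`. -/
noncomputable instance wittVectorAlgebra : Algebra (WittVector p k) k :=
  (WittVector.constantCoeff (p := p) (R := k)).toAlgebra

/-- `B` is a lift to `W(k)` of the `N`-dimensional `k`-Hopf algebra `A`: it is free of rank `N`
over `W(k)`, and `B / pB = k ⊗ B` (tensor product over `W(k)`) is isomorphic to `A` as a Hopf
algebra. (An isomorphism of bialgebras between Hopf algebras commutes with the antipodes.) -/
structure IsLift (N : ℕ) (A B : Type u) [Ring A] [HopfAlgebra k A] [Ring B]
    [HopfAlgebra (WittVector p k) B] : Prop where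
  free : Module.Free (WittVector p k) B
  finite : Module.Finite (WittVector p k) B
  finrank_eq : Module.finrank (WittVector p k) B = N
  reduction : Nonempty ((k ⊗[WittVector p k] B) ≃ₐc[k] A)

end Lift

end HopfLift

/-!
Why the theorem is true. Let `A` be semisimple and cosemisimple over the algebraically closed
residue field `k` of the complete discrete valuation ring `O`, with uniformizer `ϖ`. (The arguments
only use the properties collected in `IsResidueMap`, which hold for `O = W(k)` and `ϖ = p`.)

*Lifting.* As an algebra, `A` is a product of matrix algebras, so it is the reduction of the
product of the matrix algebras of the same sizes over `O`. It is separable, and so derivations out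
of it are inner and Hochschild `2`-cocycles are coboundaries (`exists_innerDer_eq`,
`exists_eq_coboundary`). Hence algebra homomorphisms lift from `A` to lifts of `A`
(`exists_algHom_lift`), and the comultiplication of `A` lifts, though at first not coassociatively.
If a lift is coassociative modulo `ϖ ^ (m + 1)`, then the leading term of the failure of
coassociativity is a derivation `θ` of `A` into `A ⊗ A ⊗ A`, and a cocycle of the cobar complex. If
`θ` is the cobar differential of an inner derivation `[j, Δ]`, then conjugating the lift by
`1 - ϖ ^ (m + 1) j` improves it by one order. In the limit one gets a coassociative lift
(`exists_coassoc_lift`). A counit and an antipode then exist because the equations defining them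
are solvable modulo `ϖ` (`exists_counit`, `exists_antipode`). In the same way, an algebra
isomorphism between two lifts is corrected by conjugations to an isomorphism of bialgebras
(`nonempty_bialgEquiv`).

*Vanishing of the obstructions.* It remains to see that derivations that are cobar cocycles are
coboundaries of inner derivations (`exists_eq_cobar₁`, `exists_eq_cobar₂`). Such a derivation is
itself inner, given by an element `φ` of a tensor power of `A` whose cobar differential is
invariant, that is, commutes with the image of `A` under the iterated comultiplication. As `A` and
its dual are semisimple, there are normalized two-sided integrals `Λ` in `A` and `λ` in `A*`
(`exists_isIntegralPair`). Contraction with `λ` is a contracting homotopy of the cobar complex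
(`IsIntegralPair.homotopy`). By the identity `λ(S(a₁) x a₂) = ε(a) λ(x)`, a consequence of the
existence of `Λ` (`IsIntegralPair.sum_form_antipode_mul_mul`), the homotopy takes invariants to
invariants (`IsIntegralPair.commute_formContract`). So `φ` is a coboundary up to an invariant, and
invariants define the zero derivation (`IsIntegralPair.exists_innerDer_eq_innerDer`).

*Comparison of the fibres.* A lift `B` and its dual are products of matrix algebras over `O`, since
their reductions are products of matrix algebras and isomorphisms of separable algebras lift. So
over every field over `O` the modules over the fibre of `B` are classified by their multiplicities,
which are the dimensions of the images of primitive idempotents `e` (`FDModule.iso_std_mult`), with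
the same dimensions, the same irreducible modules and the same short exact sequences for every
fibre. The idempotents `e` and all modules come from `O`, and the multiplicities in a tensor product
are the ranks of the idempotents `Δ(e)` acting on a lattice over `O`. Ranks of idempotents do not
change under base change (`finrank_range_of_isBaseChange`), so that the Grothendieck rings of all
fibres agree (`FDModule.mult_tensor`, `exists_irrMod_equiv`). Likewise multiplicities do not change
under extension of the ground field, whence modules over `K̄ ⊗ A₀` are defined over `K`
(`FDModule.exists_baseChange_iso`). Comodules are modules over the dual algebra
(`FDComodule.iso_iff`, `FDComodule.exists_coact_of_module`), which acts on tensor products through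
its own comultiplication (`FDComodule.tensor_dualAction`), so that the same arguments apply.
-/

set_option linter.unusedSectionVars false

namespace HopfLift

/-! ### Base change of free modules -/

section BaseChange

variable {O F X Y Z X' Y' Z' : Type*} [CommRing O] [CommRing F] [Algebra O F]
  [AddCommGroup X] [Module O X] [AddCommGroup Y] [Module O Y]
  [AddCommGroup Z] [Module O Z]
  [AddCommGroup X'] [Module O X'] [Module F X'] [IsScalarTower O F X']
  [AddCommGroup Y'] [Module O Y'] [Module F Y'] [IsScalarTower O F Y']
  [AddCommGroup Z'] [Module O Z'] [Module F Z'] [IsScalarTower O F Z']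

lemma isBaseChange_of_basis {ι : Type*} {q : X →ₗ[O] X'} (b : Module.Basis ι O X)
    (b' : Module.Basis ι F X') (h : ∀ i, q (b i) = b' i) : IsBaseChange F q := by
  refine IsBaseChange.of_equiv ((b.baseChange F).equiv b' (Equiv.refl ι)) fun x => ?_
  have : (((b.baseChange F).equiv b' (Equiv.refl ι)).toLinearMap.restrictScalars O) ∘ₗ
      TensorProduct.mk O F X 1 = q := b.ext fun i => by
    have : (1 : F) ⊗ₜ[O] b i = b.baseChange F i := by simp
    rw [LinearMap.comp_apply, TensorProduct.mk_apply, this]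
    exact (Module.Basis.equiv_apply _ _ _ _).trans (h i).symm
  exact LinearMap.congr_fun this x

variable (F) in
/-- The map `X ⊗ Y → X' ⊗ Y'`, `x ⊗ y ↦ f x ⊗ g y`, over a change of base ring `O → F`. -/
noncomputable def tmap (f : X →ₗ[O] X') (g : Y →ₗ[O] Y') : X ⊗[O] Y →ₗ[O] X' ⊗[F] Y' :=
  TensorProduct.mapOfCompatibleSMul F O O X' Y' ∘ₗ TensorProduct.map f g

@[simp] lemma tmap_tmul (f : X →ₗ[O] X') (g : Y →ₗ[O] Y') (x : X) (y : Y) :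
    tmap F f g (x ⊗ₜ y) = f x ⊗ₜ g y := rfl

lemma isBaseChange_tmap [Module.Free O X] [Module.Free O Y] {f : X →ₗ[O] X'} {g : Y →ₗ[O] Y'}
    (hf : IsBaseChange F f) (hg : IsBaseChange F g) : IsBaseChange F (tmap F f g) :=
  let b := Module.Free.chooseBasis O X
  let c := Module.Free.chooseBasis O Y
  isBaseChange_of_basis (b.tensorProduct c) ((hf.basis b).tensorProduct (hg.basis c)) fun i => by
    rw [Module.Basis.tensorProduct_apply, Module.Basis.tensorProduct_apply, tmap_tmul,
      IsBaseChange.basis_apply, IsBaseChange.basis_apply]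

end BaseChange

/-! ### Free modules over a complete ring -/

/-- The residue map `O → k = O / ϖ` of a domain that is complete for the topology defined by a
nonzero element `ϖ`. -/
structure IsResidueMap {O : Type*} (k : Type*) [CommRing O] [Field k] [Algebra O k] (ϖ : O) :
    Prop where
  ne_zero : ϖ ≠ 0
  surjective : Function.Surjective (algebraMap O k)
  ker : ∀ x : O, algebraMap O k x = 0 ↔ ϖ ∣ x
  complete : IsAdicComplete (Ideal.span {ϖ}) O

section Residue

variable {O k X Y X' Y' : Type*} [CommRing O] [IsDomain O] [Field k] [Algebra O k] {ϖ : O}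
  [AddCommGroup X] [Module O X] [AddCommGroup Y] [Module O Y]
  [AddCommGroup X'] [Module O X'] [Module k X'] [IsScalarTower O k X']
  [AddCommGroup Y'] [Module O Y'] [Module k Y'] [IsScalarTower O k Y']

namespace IsResidueMap

lemma smul_eq_zero (h : IsResidueMap k ϖ) (x : X') : ϖ • x = 0 := by
  rw [← algebraMap_smul k, (h.ker ϖ).2 dvd_rfl, zero_smul]

lemma pow_smul_injective (h : IsResidueMap k ϖ) [Module.Free O X] (m : ℕ) {x y : X}
    (e : ϖ ^ m • x = ϖ ^ m • y) : x = y :=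
  smul_right_injective X (pow_ne_zero m h.ne_zero) e

lemma base_surjective (h : IsResidueMap k ϖ) {q : X →ₗ[O] X'} (hq : IsBaseChange k q) :
    Function.Surjective q := fun x => by
  induction x using hq.inductionOn with
  | zero => exact ⟨0, map_zero q⟩
  | tmul x => exact ⟨x, rfl⟩
  | smul s x hx =>
    obtain ⟨y, rfl⟩ := hx
    obtain ⟨t, rfl⟩ := h.surjective s
    exact ⟨t • y, by rw [map_smul, algebraMap_smul]⟩
  | add x y hx hy =>
    obtain ⟨x, rfl⟩ := hx
    obtain ⟨y, rfl⟩ := hy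
    exact ⟨x + y, map_add q x y⟩

/-- The kernel of the reduction of a free module consists of the multiples of `ϖ`. -/
lemma base_eq_zero_iff (h : IsResidueMap k ϖ) [Module.Free O X] {q : X →ₗ[O] X'}
    (hq : IsBaseChange k q) {x : X} : q x = 0 ↔ ∃ y, x = ϖ • y := by
  constructor
  · intro hx
    let b := Module.Free.chooseBasis O X
    have hc : ∀ i, ∃ c, b.repr x i = ϖ * c := fun i => by
      have := hq.basis_repr_comp_apply b x i
      rw [hx] at this
      exact (h.ker _).1 (by simpa using this.symm)
    choose c hc using hc
    refine ⟨b.repr.symm (Finsupp.onFinset (b.repr x).support c fun i hi => ?_), ?_⟩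
    · rw [Finsupp.mem_support_iff, hc]
      exact mul_ne_zero h.ne_zero hi
    · apply b.repr.injective
      ext i
      simp [hc]
  · rintro ⟨y, rfl⟩
    rw [map_smul, h.smul_eq_zero]

/-- Linear maps out of a free module lift along a reduction. -/
lemma exists_lift (h : IsResidueMap k ϖ) [Module.Free O X] {q : Y →ₗ[O] Y'}
    (hq : IsBaseChange k q) (g : X →ₗ[O] Y') : ∃ f : X →ₗ[O] Y, ∀ x, q (f x) = g x := by
  obtain ⟨f, hf⟩ := Module.projective_lifting_property q g (h.base_surjective hq)
  exact ⟨f, fun x => LinearMap.congr_fun hf x⟩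

/-- Divisibility of a linear map by `ϖ ^ m` can be tested pointwise. -/
lemma exists_eq_pow_smul (h : IsResidueMap k ϖ) [Module.Free O Y] (m : ℕ) (g : X →ₗ[O] Y)
    (hg : ∀ x, ∃ y, g x = ϖ ^ m • y) : ∃ f : X →ₗ[O] Y, g = ϖ ^ m • f := by
  choose f hf using hg
  refine ⟨{ toFun := f, map_add' := fun x y => ?_, map_smul' := fun c x => ?_ },
    LinearMap.ext hf⟩
  · refine h.pow_smul_injective m ?_
    rw [smul_add, ← hf, ← hf, ← hf, map_add]
  · refine h.pow_smul_injective m ?_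
    rw [← hf, RingHom.id_apply, smul_comm, ← hf, map_smul]

/-- An element `ϖ ^ m • y` is divisible by `ϖ ^ (m + 1)` as soon as `y` reduces to zero. -/
lemma exists_pow_succ (h : IsResidueMap k ϖ) [Module.Free O X] {q : X →ₗ[O] X'}
    (hq : IsBaseChange k q) (m : ℕ) {x y : X} (hx : x = ϖ ^ m • y) (hy : q y = 0) :
    ∃ z, x = ϖ ^ (m + 1) • z := by
  obtain ⟨z, rfl⟩ := (h.base_eq_zero_iff hq).1 hy
  exact ⟨z, by rw [hx, pow_succ, mul_smul]⟩

lemma ideal_le_jacobson (h : IsResidueMap k ϖ) :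
    Ideal.span {ϖ} ≤ (⊥ : Ideal O).jacobson :=
  have := h.complete
  IsAdicComplete.le_jacobson_bot _

/-- Finite free modules are separated for the `ϖ`-adic topology. -/
lemma eq_zero_of_forall_pow (h : IsResidueMap k ϖ) [Module.Free O X] {x : X}
    (hx : ∀ m : ℕ, ∃ y, x = ϖ ^ m • y) : x = 0 := by
  have := h.complete
  let b := Module.Free.chooseBasis O X
  apply b.repr.injective
  ext i
  rw [map_zero, Finsupp.zero_apply]
  refine IsHausdorff.haus (I := Ideal.span {ϖ}) inferInstance _ fun n => ?_
  obtain ⟨y, hy⟩ := hx n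
  rw [SModEq.zero, Ideal.span_singleton_pow, smul_eq_mul, Ideal.mul_top,
    Ideal.mem_span_singleton, hy]
  simp

/-- Successive approximation in a finite free module: if every approximate solution of order `m`
can be improved to one of order `m + 1` by a change divisible by `ϖ ^ (m + 1)`, the improved
solutions converge, and the limit differs from an approximate solution of order `m` by a multiple
of `ϖ ^ (m + 1)`. -/
lemma exists_limit (h : IsResidueMap k ϖ) [Module.Free O X] [Module.Finite O X]
    (P : ℕ → X → Prop) {x₀ : X} (h₀ : P 0 x₀)
    (step : ∀ m x, P m x → ∃ y, P (m + 1) (x + ϖ ^ (m + 1) • y)) :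
    ∃ L : X, ∀ m, ∃ y, P m (L + ϖ ^ (m + 1) • y) := by
  have := h.complete
  choose! δ hδ using step
  let s : ℕ → X := fun m => Nat.rec x₀ (fun m x => x + ϖ ^ (m + 1) • δ m x) m
  have hs : ∀ m, P m (s m) := fun m => by
    induction m with
    | zero => exact h₀
    | succ m ih => exact hδ m _ ih
  have hstep : ∀ m, s (m + 1) = s m + ϖ ^ (m + 1) • δ m (s m) := fun m => rfl
  have hd : ∀ m n, m ≤ n → ∃ y, s n = s m + ϖ ^ (m + 1) • y := fun m n hmn => by
    induction n, hmn using Nat.le_induction with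
    | base => exact ⟨0, by simp⟩
    | succ n hmn ih =>
      obtain ⟨y, hy⟩ := ih
      refine ⟨y + ϖ ^ (n - m) • δ n (s n), ?_⟩
      rw [hstep, smul_add, smul_smul, ← pow_add, ← add_assoc, ← hy]
      congr 3
      omega
  let b := Module.Free.chooseBasis O X
  have hc : ∀ i, ∃ c : O, ∀ n, b.repr (s n) i ≡ c [SMOD (Ideal.span {ϖ} ^ n • ⊤ : Ideal O)] :=
    fun i => IsPrecomplete.prec (I := Ideal.span {ϖ}) inferInstance fun {m n} hmn => by
      obtain ⟨y, hy⟩ := hd m n hmn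
      rw [SModEq.comm, SModEq.sub_mem, Ideal.span_singleton_pow, smul_eq_mul, Ideal.mul_top,
        Ideal.mem_span_singleton, hy]
      simp [pow_succ, mul_assoc]
  choose c hc using hc
  refine ⟨∑ i, c i • b i, fun m => ?_⟩
  have hdiv : ∀ i, ∃ d, b.repr (s m) i - c i = ϖ ^ (m + 1) * d := fun i => by
    -- The `m`-th approximation agrees with the `(m + 1)`-st modulo `ϖ ^ (m + 1)`, and the latter
    -- with the limit.
    have h1 := hc i (m + 1)
    rw [SModEq.sub_mem, Ideal.span_singleton_pow, smul_eq_mul, Ideal.mul_top,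
      Ideal.mem_span_singleton, hstep] at h1
    have h2 := h1.sub (Dvd.intro (b.repr (δ m (s m)) i) rfl : ϖ ^ (m + 1) ∣ _)
    obtain ⟨d, hd⟩ := h2
    refine ⟨d, ?_⟩
    rw [← hd]
    simp only [map_add, map_smul, Finsupp.add_apply, Finsupp.smul_apply, smul_eq_mul]
    ring
  choose d hd using hdiv
  refine ⟨∑ i, d i • b i, ?_⟩
  convert hs m using 1
  conv_rhs => rw [← b.sum_repr (s m)]
  rw [Finset.smul_sum, ← Finset.sum_add_distrib]
  refine Finset.sum_congr rfl fun i _ => ?_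
  rw [smul_smul, ← hd, sub_smul]
  abel

/-- A linear map between finite free modules that is bijective modulo `ϖ` is bijective. -/
lemma bijective_of_base (h : IsResidueMap k ϖ) [Module.Free O X] [Module.Free O Y]
    [Module.Finite O Y] {q : X →ₗ[O] X'} {r : Y →ₗ[O] Y'} (hq : IsBaseChange k q)
    (hr : IsBaseChange k r) (f : X →ₗ[O] Y) (f' : X' → Y') (hf' : Function.Bijective f')
    (hf : ∀ x, r (f x) = f' (q x)) : Function.Bijective f := by
  have hzero : f' 0 = 0 := by simpa using (hf 0).symm
  constructor
  · rw [← LinearMap.ker_eq_bot, LinearMap.ker_eq_bot']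
    intro x hx
    refine h.eq_zero_of_forall_pow fun m => ?_
    suffices ∃ y, x = ϖ ^ m • y ∧ f y = 0 from this.imp fun _ h => h.1
    induction m with
    | zero => exact ⟨x, by simp, hx⟩
    | succ m ih =>
      obtain ⟨y, rfl, hy⟩ := ih
      have : q y = 0 := hf'.1 (by rw [← hf, hy, map_zero, hzero])
      obtain ⟨z, rfl⟩ := (h.base_eq_zero_iff hq).1 this
      refine ⟨z, by rw [pow_succ, mul_smul], ?_⟩
      rw [map_smul] at hy
      exact (_root_.smul_eq_zero.1 hy).resolve_left h.ne_zero
  -- Surjectivity is Nakayama's lemma.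
  · rw [← LinearMap.range_eq_top, eq_top_iff]
    refine Submodule.le_of_le_smul_of_le_jacobson_bot Module.Finite.fg_top h.ideal_le_jacobson
      fun y _ => ?_
    obtain ⟨x', hx'⟩ := hf'.2 (r y)
    obtain ⟨x, rfl⟩ := h.base_surjective hq x'
    have : r (y - f x) = 0 := by rw [map_sub, hf, hx', sub_self]
    obtain ⟨z, hz⟩ := (h.base_eq_zero_iff hr).1 this
    rw [sub_eq_iff_eq_add'] at hz
    rw [hz]
    exact Submodule.add_mem_sup (LinearMap.mem_range_self f x)
      (Submodule.smul_mem_smul (Ideal.mem_span_singleton_self ϖ) trivial)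

section Ring

variable {R : Type*} [Ring R] [Algebra O R] [Module.Finite O R]

/-- In a finite algebra over `O`, elements congruent to `1` modulo `ϖ` are units. -/
lemma isUnit_one_add (h : IsResidueMap k ϖ) (y : R) : IsUnit (1 + ϖ • y) := by
  -- By Nakayama's lemma `1 + ϖ y` has a right inverse, which is again of the form `1 + ϖ z`.
  have key : ∀ y : R, ∃ z : R, (1 + ϖ • y) * (1 + ϖ • z) = 1 := fun y => by
    have hs : LinearMap.range (LinearMap.mulLeft O (1 + ϖ • y)) = ⊤ := by
      rw [eq_top_iff]
      refine Submodule.le_of_le_smul_of_le_jacobson_bot Module.Finite.fg_top h.ideal_le_jacobson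
        fun x _ => ?_
      have : x = LinearMap.mulLeft O (1 + ϖ • y) x + ϖ • (-(y * x)) := by
        simp [add_mul]
      rw [this]
      exact Submodule.add_mem_sup (LinearMap.mem_range_self _ x)
        (Submodule.smul_mem_smul (Ideal.mem_span_singleton_self ϖ) trivial)
    obtain ⟨w, hw⟩ := LinearMap.range_eq_top.1 hs 1
    refine ⟨-(y * w), ?_⟩
    rw [LinearMap.mulLeft_apply] at hw
    have hw' : w = 1 + ϖ • -(y * w) := by
      have : w + ϖ • (y * w) = 1 := by simpa [add_mul] using hw
      rw [smul_neg, ← this]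
      abel
    rw [← hw', hw]
  obtain ⟨z, hz⟩ := key y
  obtain ⟨w, hw⟩ := key z
  have : 1 + ϖ • y = 1 + ϖ • w := left_inv_eq_right_inv hz hw
  exact ⟨⟨1 + ϖ • y, 1 + ϖ • z, hz, by rw [this, hw]⟩, rfl⟩

lemma isUnit_of_base_eq_one (h : IsResidueMap k ϖ) [Module.Free O R]
    {R' : Type*} [Ring R'] [Algebra O R'] [Algebra k R'] [IsScalarTower O k R'] {q : R →ₐ[O] R'}
    (hq : IsBaseChange k q.toLinearMap) {x : R} (hx : q x = 1) : IsUnit x := by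
  obtain ⟨y, hy⟩ := (h.base_eq_zero_iff (x := x - 1) hq).1 (by simp [hx])
  rw [sub_eq_iff_eq_add'] at hy
  rw [hy]
  exact h.isUnit_one_add y

lemma eq_one_of_idempotent (h : IsResidueMap k ϖ) [Module.Free O R]
    {R' : Type*} [Ring R'] [Algebra O R'] [Algebra k R'] [IsScalarTower O k R'] {q : R →ₐ[O] R'}
    (hq : IsBaseChange k q.toLinearMap) {x : R} (hx : q x = 1) (hxx : x * x = x) : x = 1 :=
  (h.isUnit_of_base_eq_one hq hx).mul_left_cancel (by rw [hxx, mul_one])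

end Ring

end IsResidueMap

end Residue

/-! ### Comodules as modules over the dual algebra -/

section DualAlgebra

/-- The dual algebra of a coalgebra `C`: the linear forms on `C` with the convolution product
`(f * g)(c) = ∑ f(c₁) g(c₂)`. -/
abbrev DualAlg (R C : Type*) [CommRing R] [AddCommGroup C] [Module R C] [Coalgebra R C] : Type _ :=
  WithConv (C →ₗ[R] R)

section Contract

variable {R V W C D : Type*} [CommRing R] [AddCommGroup V] [Module R V] [AddCommGroup W]
  [Module R W] [AddCommGroup C] [Module R C] [AddCommGroup D] [Module R D]

/-- The contraction `V ⊗ C → V`, `v ⊗ c ↦ f(c) v`, with a linear form `f`. -/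
noncomputable def contract (V : Type*) [AddCommGroup V] [Module R V] (f : C →ₗ[R] R) :
    V ⊗[R] C →ₗ[R] V :=
  (TensorProduct.rid R V).toLinearMap ∘ₗ f.lTensor V

@[simp] lemma contract_tmul (f : C →ₗ[R] R) (v : V) (c : C) :
    contract V f (v ⊗ₜ c) = f c • v := by simp [contract]

lemma contract_rTensor (f : C →ₗ[R] R) (g : V →ₗ[R] W) (x : V ⊗[R] C) :
    contract W f (g.rTensor C x) = g (contract V f x) := by
  induction x with
  | zero => simp
  | add x y hx hy => simp only [map_add, hx, hy]
  | tmul v c => simp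

lemma contract_add (f g : C →ₗ[R] R) : contract V (f + g) = contract V f + contract V g :=
  TensorProduct.ext' fun v c => by simp [add_smul]

lemma contract_smul (r : R) (f : C →ₗ[R] R) : contract V (r • f) = r • contract V f :=
  TensorProduct.ext' fun v c => by simp [mul_smul]

lemma sum_contract_tmul {ι : Type*} [Fintype ι] (b : Module.Basis ι R C) (x : V ⊗[R] C) :
    ∑ i, contract V (b.coord i) x ⊗ₜ b i = x := by
  induction x with
  | zero => simp
  | add x y hx hy =>
    simp only [map_add, TensorProduct.add_tmul, Finset.sum_add_distrib, hx, hy]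
  | tmul v c =>
    conv_rhs => rw [← b.sum_repr c, TensorProduct.tmul_sum]
    refine Finset.sum_congr rfl fun i _ => ?_
    rw [contract_tmul, TensorProduct.smul_tmul, Module.Basis.coord_apply]

/-- Elements of `V ⊗ C` are separated by contractions when `C` is finite free. -/
lemma eq_of_contract [Module.Free R C] [Module.Finite R C] {x y : V ⊗[R] C}
    (h : ∀ f : C →ₗ[R] R, contract V f x = contract V f y) : x = y := by
  let b := Module.Free.chooseBasis R C
  rw [← sum_contract_tmul b x, ← sum_contract_tmul b y]
  simp only [h]

end Contract

lemma isCompl_iff_exists_add {R M : Type*} [Ring R] [AddCommGroup M] [Module R M]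
    {W W' : Submodule R M} :
    IsCompl W W' ↔ (∀ x ∈ W, x ∈ W' → x = 0) ∧ ∀ x, ∃ y ∈ W, ∃ z ∈ W', y + z = x := by
  rw [isCompl_iff, Submodule.disjoint_def, codisjoint_iff, Submodule.eq_top_iff']
  simp only [Submodule.mem_sup]

namespace FDComodule

variable {k C : Type u} [Field k] [AddCommGroup C] [Module k C] [Coalgebra k C]

/-- A right `C`-comodule is a left module over the dual algebra: `f • v = ∑ f(v₁) v₀`. -/
noncomputable def dualAction (V : FDComodule k C) : DualAlg k C →ₐ[k] Module.End k V.carrier :=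
  AlgHom.ofLinearMap
    { toFun := fun f => contract V.carrier f.ofConv ∘ₗ V.coact
      map_add' := fun f g => by
        rw [WithConv.ofConv_add, contract_add, LinearMap.add_comp]
      map_smul' := fun c f => by
        rw [WithConv.ofConv_smul, contract_smul, LinearMap.smul_comp, RingHom.id_apply] }
    (by
      ext v
      conv_rhs => rw [Module.End.one_apply, ← V.counit_apply v]
      rfl)
    (fun f g => by
      ext v
      have h₁ : ∀ (c : C) (y : V.carrier ⊗[k] C), contract V.carrier
          (LinearMap.mul' k k ∘ₗ TensorProduct.map f.ofConv g.ofConv)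
          (TensorProduct.assoc k _ _ _ (y ⊗ₜ c)) = g.ofConv c • contract V.carrier f.ofConv y := by
        intro c y
        induction y with
        | zero => simp
        | add x y hx hy => simp only [TensorProduct.add_tmul, map_add, smul_add, hx, hy]
        | tmul v d =>
          simp only [TensorProduct.assoc_tmul, contract_tmul, LinearMap.comp_apply,
            TensorProduct.map_tmul, LinearMap.mul'_apply]
          rw [mul_comm, mul_smul]
      have h₂ : ∀ x : V.carrier ⊗[k] C, contract V.carrier
          (LinearMap.mul' k k ∘ₗ TensorProduct.map f.ofConv g.ofConv)
          (TensorProduct.assoc k _ _ _ (V.coact.rTensor C x)) =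
          contract V.carrier f.ofConv (V.coact (contract V.carrier g.ofConv x)) := by
        intro x
        induction x with
        | zero => simp
        | add x y hx hy => simp only [map_add, hx, hy]
        | tmul v c => simp [h₁]
      have h₃ : ∀ x : V.carrier ⊗[k] C, contract V.carrier
          (LinearMap.mul' k k ∘ₗ TensorProduct.map f.ofConv g.ofConv)
          (Coalgebra.comul.lTensor _ x) = contract V.carrier (f * g).ofConv x := by
        intro x
        induction x with
        | zero => simp
        | add x y hx hy => simp only [map_add, hx, hy]
        | tmul v c => simp [LinearMap.convMul_def]
      exact ((h₃ _).symm.trans (by rw [← coassoc_apply])).trans (h₂ _))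

lemma dualAction_apply (V : FDComodule k C) (f : DualAlg k C) (v : V.carrier) :
    V.dualAction f v = contract V.carrier f.ofConv (V.coact v) := rfl

/-- The module over the dual algebra defined by a comodule. -/
noncomputable def toModule (V : FDComodule k C) : FDModule k (DualAlg k C) :=
  FDModule.ofAction V.carrier V.dualAction

/-- A finite-dimensional coalgebra as a right comodule over itself. -/
noncomputable def regular (k C : Type u) [Field k] [AddCommGroup C] [Module k C] [Coalgebra k C]
    [Module.Finite k C] : FDComodule k C where
  carrier := C
  coact := Coalgebra.comul
  coassoc := Coalgebra.coassoc
  counit := by ext c; simp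

variable [Module.Finite k C]

lemma isSubcomodule_iff (V : FDComodule k C) (W : Submodule k V.carrier) :
    IsSubcomodule V.coact W ↔ ∀ f : DualAlg k C, ∀ w ∈ W, V.dualAction f w ∈ W := by
  constructor
  · intro h f w hw
    obtain ⟨x, hx⟩ := h w hw
    rw [dualAction_apply, ← hx, contract_rTensor]
    exact Submodule.coe_mem _
  · intro h w hw
    let b := Module.Free.chooseBasis k C
    refine ⟨∑ i, (⟨_, h (WithConv.toConv (b.coord i)) w hw⟩ : W) ⊗ₜ b i, ?_⟩
    rw [map_sum]
    exact sum_contract_tmul b (V.coact w)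

/-- Homomorphisms of comodules are the homomorphisms of modules over the dual algebra. -/
lemma isHom_iff {V W : FDComodule k C} (f : V.carrier →ₗ[k] W.carrier) :
    IsHom f ↔ ∀ (g : DualAlg k C) (v : V.carrier), f (V.dualAction g v) = W.dualAction g (f v) := by
  constructor
  · intro h g v
    have := LinearMap.congr_fun h v
    simp only [LinearMap.comp_apply] at this
    rw [dualAction_apply, dualAction_apply, this, contract_rTensor]
  · intro h
    refine LinearMap.ext fun v => eq_of_contract fun g => ?_
    refine (h (WithConv.toConv g) v).symm.trans ?_
    exact (contract_rTensor _ _ _).symm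

lemma iso_iff {V W : FDComodule k C} : Iso V W ↔ FDModule.Iso V.toModule W.toModule := by
  constructor
  · rintro ⟨e, he⟩
    exact FDModule.iso_of_equiv (V := V.toModule) (W := W.toModule) e
      fun a v => (isHom_iff _).1 he a v
  · rintro ⟨e⟩
    exact ⟨e.restrictScalars k, (isHom_iff _).2 fun g v => e.map_smul g v⟩

lemma shortExact_iff {U V W : FDComodule k C} :
    ShortExact U V W ↔ FDModule.ShortExact U.toModule V.toModule W.toModule := by
  constructor
  · rintro ⟨f, g, hf, hg, h⟩
    exact ⟨{ f with map_smul' := fun a v => (isHom_iff _).1 hf a v },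
      { g with map_smul' := fun a v => (isHom_iff _).1 hg a v }, h⟩
  · rintro ⟨f, g, h⟩
    exact ⟨f.restrictScalars k, g.restrictScalars k, (isHom_iff _).2 fun a v => f.map_smul a v,
      (isHom_iff _).2 fun a v => g.map_smul a v, h⟩

/-- A subspace that is stable under the dual algebra, as a submodule. -/
def dualSubmodule (V : FDComodule k C) (W : Submodule k V.carrier)
    (h : IsSubcomodule V.coact W) : Submodule (DualAlg k C) V.toModule.carrier where
  carrier := {x | (show V.carrier from x) ∈ W}
  zero_mem' := W.zero_mem
  add_mem' := W.add_mem
  smul_mem' f w hw := (isSubcomodule_iff V W).1 h f w hw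

lemma isCompl_iff_dualSubmodule (V : FDComodule k C) (W : Submodule k V.carrier)
    (h : IsSubcomodule V.coact W) (W' : Submodule (DualAlg k C) V.toModule.carrier) :
    IsCompl W (W'.restrictScalars k) ↔ IsCompl (V.dualSubmodule W h) W' :=
  isCompl_iff_exists_add.trans
    (isCompl_iff_exists_add (W := V.dualSubmodule W h) (W' := W')).symm

lemma isSubcomodule_restrictScalars (V : FDComodule k C)
    (W : Submodule (DualAlg k C) V.toModule.carrier) :
    IsSubcomodule V.coact (W.restrictScalars k) :=
  (isSubcomodule_iff V _).2 fun f _ hw => W.smul_mem f hw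

lemma isSimple_iff (V : FDComodule k C) : V.IsSimple ↔ V.toModule.IsSimple := by
  constructor
  · rintro ⟨h₁, h₂⟩
    have : Nontrivial V.toModule.carrier := h₁
    refine (isSimpleModule_iff _ _).2 ⟨fun W => ?_⟩
    refine (h₂ _ (V.isSubcomodule_restrictScalars W)).imp (fun h => ?_) (fun h => ?_)
    · exact (Submodule.restrictScalars_eq_bot_iff ..).1 h
    · exact (Submodule.restrictScalars_eq_top_iff ..).1 h
  · intro h
    have h' : IsSimpleModule (DualAlg k C) V.toModule.carrier := h
    refine ⟨IsSimpleModule.nontrivial (DualAlg k C) V.toModule.carrier, fun W hW => ?_⟩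
    refine (eq_bot_or_eq_top (V.dualSubmodule W hW)).imp (fun h => ?_) (fun h => ?_)
    · exact Submodule.ext fun x => (SetLike.ext_iff.1 h (show V.toModule.carrier from x) :)
    · exact Submodule.ext fun x => (SetLike.ext_iff.1 h (show V.toModule.carrier from x) :)

/-- Every module over the dual algebra comes from a comodule, with coaction
`v ↦ ∑ (bᵢ* • v) ⊗ bᵢ` for a basis `bᵢ` of `C`. -/
lemma exists_coact_of_module (V : FDModule k (DualAlg k C)) :
    ∃ W : FDComodule k C, FDModule.Iso W.toModule V := by
  let b := Module.Free.chooseBasis k C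
  let δ : V.carrier →ₗ[k] V.carrier ⊗[k] C :=
    ∑ i, (TensorProduct.mk k V.carrier C).flip (b i) ∘ₗ V.action (WithConv.toConv (b.coord i))
  have hδ : ∀ (f : C →ₗ[k] k) (v : V.carrier), contract V.carrier f (δ v) =
      WithConv.toConv f • v := by
    intro f v
    have hf : f = ∑ i, f (b i) • b.coord i := b.ext fun j => by
      simp
    conv_rhs => rw [hf, WithConv.toConv_sum, Finset.sum_smul]
    simp only [δ, LinearMap.sum_apply, map_sum]
    refine Finset.sum_congr rfl fun i _ => ?_
    rw [WithConv.toConv_smul, smul_assoc]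
    exact contract_tmul f _ _
  have h₁ : ∀ (f g : C →ₗ[k] k) (x : V.carrier ⊗[k] C),
      contract V.carrier f (contract (V.carrier ⊗[k] C) g
        ((TensorProduct.assoc k _ _ _).symm (Coalgebra.comul.lTensor _ x))) =
      contract V.carrier (WithConv.toConv f * WithConv.toConv g).ofConv x := by
    intro f g x
    induction x with
    | zero => simp
    | add x y hx hy => simp only [map_add, hx, hy]
    | tmul v c =>
      simp only [LinearMap.lTensor_tmul, contract_tmul, LinearMap.convMul_def,
        LinearMap.comp_apply]
      induction Coalgebra.comul (R := k) c with
      | zero => simp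
      | add x y hx hy => simp only [TensorProduct.tmul_add, map_add, add_smul, hx, hy]
      | tmul c d => simp [smul_smul, mul_comm]
  let W : FDComodule k C :=
    { carrier := V.carrier
      coact := δ
      coassoc := by
        refine LinearMap.ext fun v => ?_
        apply (TensorProduct.assoc k V.carrier C C).symm.injective
        simp only [LinearMap.comp_apply, LinearEquiv.coe_coe, LinearEquiv.symm_apply_apply]
        refine eq_of_contract fun g => eq_of_contract fun f => ?_
        rw [contract_rTensor, hδ, hδ, h₁, hδ, smul_smul]
      counit := LinearMap.ext fun v => (hδ _ v).trans (one_smul (DualAlg k C) v) }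
  exact ⟨W, FDModule.iso_of_equiv (V := W.toModule) (W := V) (LinearEquiv.refl k V.carrier)
    fun f v => hδ f.ofConv v⟩

end FDComodule

variable {k C : Type u} [Field k] [AddCommGroup C] [Module k C] [Coalgebra k C]
  [Module.Finite k C]

/-- The dual algebra of a cosemisimple coalgebra is semisimple: evaluation at a basis of `C` embeds
it into a power of the regular comodule. -/
theorem IsCosemisimple.isSemisimpleRing_dual (h : IsCosemisimple k C) :
    IsSemisimpleRing (DualAlg k C) := by
  let M := (FDComodule.regular k C).toModule.carrier
  have hM : IsSemisimpleModule (DualAlg k C) M := by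
    refine (isSemisimpleModule_iff _ _).2 ⟨fun W => ?_⟩
    obtain ⟨W', hW', hc⟩ := h (W.restrictScalars k)
      ((FDComodule.regular k C).isSubcomodule_restrictScalars W)
    exact ⟨(FDComodule.regular k C).dualSubmodule W' hW',
      (((FDComodule.regular k C).isCompl_iff_dualSubmodule W' hW' W).1 hc.symm).symm⟩
  let b := Module.Free.chooseBasis k C
  let φ : DualAlg k C →ₗ[DualAlg k C] (Module.Free.ChooseBasisIndex k C → M) :=
    LinearMap.pi fun i => LinearMap.toSpanSingleton _ M (b i)
  refine IsSemisimpleModule.of_injective φ ?_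
  rw [← LinearMap.ker_eq_bot, LinearMap.ker_eq_bot']
  intro f hf
  have h1 : ∀ c : C, (FDComodule.regular k C).dualAction f c = 0 := fun c => by
    have : (FDComodule.regular k C).dualAction f = 0 := b.ext fun i => congrFun hf i
    rw [this]; rfl
  -- Applying the counit to `f • c = ∑ f(c₂) c₁ = 0` gives `f(c) = 0`.
  ext c
  have h2 := congrArg (Coalgebra.counit (R := k) (A := C)) (h1 c)
  have h3 : ∀ x : C ⊗[k] C, Coalgebra.counit (R := k) (contract C f.ofConv x) =
      f.ofConv (TensorProduct.lid k C (Coalgebra.counit.rTensor C x)) := by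
    intro x
    induction x with
    | zero => simp
    | add x y hx hy => simp only [map_add, hx, hy]
    | tmul c d => simp [mul_comm]
  refine Eq.trans ?_ ((h3 (Coalgebra.comul c)).symm.trans (h2.trans (map_zero _)))
  simp

/-- A coalgebra with semisimple dual algebra is cosemisimple. -/
theorem isCosemisimple_of_dual (h : IsSemisimpleRing (DualAlg k C)) : IsCosemisimple k C := by
  intro W hW
  obtain ⟨W', hc⟩ := exists_isCompl ((FDComodule.regular k C).dualSubmodule W hW)
  exact ⟨W'.restrictScalars k, (FDComodule.regular k C).isSubcomodule_restrictScalars W',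
    ((FDComodule.regular k C).isCompl_iff_dualSubmodule W hW W').2 hc⟩

end DualAlgebra

/-! ### Integrals -/

section Integrals

open Coalgebra HopfAlgebra

/-- An augmentation `ε` of a semisimple algebra has a two-sided integral `Λ` with `ε Λ = 1`. -/
theorem exists_integral_of_isSemisimpleRing {k R : Type*} [Field k] [Ring R] [Algebra k R]
    [IsSemisimpleRing R] (ε : R →ₐ[k] k) :
    ∃ Λ : R, ε Λ = 1 ∧ (∀ x, x * Λ = ε x • Λ) ∧ ∀ x, Λ * x = ε x • Λ := by
  -- The component of `1` in a complement of the left ideal `ker ε` is a left integral. A left and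
  -- a right integral with the same normalization coincide.
  have left : ∀ (T : Type _) [Ring T] [Algebra k T] [IsSemisimpleRing T] (ε : T →ₐ[k] k),
      ∃ Λ : T, ε Λ = 1 ∧ ∀ x, x * Λ = ε x • Λ := by
    intro T _ _ _ ε
    obtain ⟨I, hI⟩ := exists_isCompl (RingHom.ker ε : Submodule T T)
    obtain ⟨hd, hs⟩ := isCompl_iff_exists_add.1 hI
    obtain ⟨y, hy, Λ, hΛ, h1⟩ := hs 1
    have hε : ε Λ = 1 := by
      have := congrArg ε h1
      rwa [map_add, (RingHom.mem_ker).1 hy, zero_add, map_one] at this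
    refine ⟨Λ, hε, fun x => sub_eq_zero.1 (hd _ ?_ ?_)⟩
    · rw [RingHom.mem_ker, map_sub, map_mul, map_smul, hε, mul_one, smul_eq_mul, mul_one, sub_self]
    · refine I.sub_mem (I.smul_mem x hΛ) ?_
      rw [← algebraMap_smul T]
      exact I.smul_mem _ hΛ
  obtain ⟨Λ, h1, h2⟩ := left R ε
  obtain ⟨Λ', h1', h2'⟩ := left Rᵐᵒᵖ (AlgHom.fromOpposite ε fun _ _ => mul_comm _ _)
  have h3 : ∀ x, Λ'.unop * x = ε x • Λ'.unop := fun x => congrArg MulOpposite.unop (h2' (.op x))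
  have h4 : Λ'.unop = Λ := by
    have := h2 Λ'.unop
    rw [h3, h1, one_smul, show ε Λ'.unop = 1 from h1', one_smul] at this
    exact this
  exact ⟨Λ, h1, h2, fun x => by rw [← h4, h3]⟩

variable {k A : Type*} [Field k] [Ring A] [HopfAlgebra k A]

/-- A pair of two-sided integrals `Λ ∈ A` and `λ ∈ A*`, normalized by `ε(Λ) = 1` and
`λ(1) = 1`. -/
structure IsIntegralPair (Λ : A) (l : A →ₗ[k] k) : Prop where
  counit_eq : counit (R := k) Λ = 1
  mul_eq : ∀ x, x * Λ = counit (R := k) x • Λ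
  eq_mul : ∀ x, Λ * x = counit (R := k) x • Λ
  form_one : l 1 = 1
  form_left : ∀ x, TensorProduct.lid k A (l.rTensor A (comul x)) = l x • 1
  form_right : ∀ x, contract A l (comul x) = l x • 1

/-- A semisimple and cosemisimple Hopf algebra has normalized two-sided integrals in `A` and in
`A*`: the two augmentations are the counit of `A` and evaluation at `1` on the dual algebra. -/
theorem exists_isIntegralPair {k A : Type u} [Field k] [Ring A] [HopfAlgebra k A]
    [Module.Finite k A] (hss : IsSemisimpleRing A)
    (hcs : IsCosemisimple k A) : ∃ (Λ : A) (l : A →ₗ[k] k), IsIntegralPair Λ l := by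
  obtain ⟨Λ, h1, h2, h3⟩ := exists_integral_of_isSemisimpleRing (Bialgebra.counitAlgHom k A)
  have := hcs.isSemisimpleRing_dual
  let ev : DualAlg k A →ₐ[k] k := AlgHom.ofLinearMap
    { toFun := fun f => f.ofConv 1
      map_add' := fun _ _ => rfl
      map_smul' := fun _ _ => rfl }
    (show Algebra.linearMap k k (counit (1 : A)) = 1 by simp)
    (fun f g => show LinearMap.mul' k k (TensorProduct.map f.ofConv g.ofConv (comul (1 : A))) = _ by
      rw [Bialgebra.comul_one]; rfl)
  obtain ⟨l, g1, g2, g3⟩ := exists_integral_of_isSemisimpleRing ev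
  refine ⟨Λ, l.ofConv, h1, h2, h3, g1, fun x => ?_, fun x => ?_⟩
  · refine sub_eq_zero.1 ((Module.forall_dual_apply_eq_zero_iff k _).1 fun f => ?_)
    have h := congrArg (fun t => t.ofConv x) (g3 (WithConv.toConv f))
    have h' : ∀ y : A ⊗[k] A, f (TensorProduct.lid k A (l.ofConv.rTensor A y)) =
        LinearMap.mul' k k (TensorProduct.map l.ofConv f y) := fun y => by
      induction y with
      | zero => simp
      | add x y hx hy => simp only [map_add, hx, hy]
      | tmul a b => simp
    rw [map_sub, h', sub_eq_zero]
    rw [map_smul]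
    exact h.trans (mul_comm _ _)
  · refine sub_eq_zero.1 ((Module.forall_dual_apply_eq_zero_iff k _).1 fun f => ?_)
    have h := congrArg (fun t => t.ofConv x) (g2 (WithConv.toConv f))
    have h' : ∀ y : A ⊗[k] A, f (contract A l.ofConv y) =
        LinearMap.mul' k k (TensorProduct.map f l.ofConv y) := fun y => by
      induction y with
      | zero => simp
      | add x y hx hy => simp only [map_add, hx, hy]
      | tmul a b => simp [mul_comm]
    rw [map_sub, h', sub_eq_zero]
    rw [map_smul]
    exact h.trans (mul_comm _ _)

lemma sum_counit_right_smul {ι : Type*} {x : A} (r : Repr k x ι) :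
    ∑ i ∈ r.index, counit (R := k) (r.right i) • r.left i = x := by
  have := congrArg (TensorProduct.rid k A) (sum_tmul_counit_eq r)
  rw [map_sum, TensorProduct.rid_tmul, one_smul] at this
  simpa only [TensorProduct.rid_tmul] using this

/-- `∑ S(x₁) x₂ ⊗ x₃ = 1 ⊗ x`. -/
lemma sum_antipode_tmul_mul_comul {ι : Type*} {x : A} (r : Repr k x ι) :
    ∑ i ∈ r.index, (antipode k (r.left i) ⊗ₜ[k] (1 : A)) * comul (R := k) (r.right i) =
      1 ⊗ₜ x := by
  let G : A ⊗[k] (A ⊗[k] A) →ₗ[k] A ⊗[k] A :=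
    TensorProduct.lift (LinearMap.mul k (A ⊗[k] A) ∘ₗ
      (TensorProduct.mk k A A).flip 1 ∘ₗ antipode k)
  have hG : ∀ (y : A ⊗[k] A) (c : A), G (TensorProduct.assoc k A A A (y ⊗ₜ c)) =
      (LinearMap.mul' k A ((antipode k).rTensor A y)) ⊗ₜ c := fun y c => by
    induction y with
    | zero => simp
    | add x y hx hy => simp only [TensorProduct.add_tmul, map_add, hx, hy]
    | tmul a b => simp [G]
  have h := congrArg G (coassoc_apply (R := k) x)
  rw [← r.eq, map_sum, map_sum, map_sum, map_sum] at h
  simp only [LinearMap.rTensor_tmul, hG, mul_antipode_rTensor_comul_apply] at h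
  rw [map_sum] at h
  simp only [LinearMap.lTensor_tmul] at h
  refine h.symm.trans ?_
  simp only [Algebra.algebraMap_eq_smul_one, TensorProduct.smul_tmul]
  rw [← TensorProduct.tmul_sum, sum_counit_smul]

/-- `∑ x₁ ⊗ x₂ S(x₃) = x ⊗ 1`. -/
lemma sum_comul_mul_tmul_antipode {ι : Type*} {x : A} (r : Repr k x ι) :
    ∑ i ∈ r.index, comul (R := k) (r.left i) * ((1 : A) ⊗ₜ[k] antipode k (r.right i)) =
      x ⊗ₜ 1 := by
  let G : (A ⊗[k] A) ⊗[k] A →ₗ[k] A ⊗[k] A :=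
    TensorProduct.lift ((LinearMap.mul k (A ⊗[k] A)).compl₂
      (TensorProduct.mk k A A 1 ∘ₗ antipode k))
  have hG : ∀ (y : A ⊗[k] A) (c : A), G ((TensorProduct.assoc k A A A).symm (c ⊗ₜ y)) =
      c ⊗ₜ (LinearMap.mul' k A ((antipode k).lTensor A y)) := fun y c => by
    induction y with
    | zero => simp
    | add x y hx hy => simp only [TensorProduct.tmul_add, map_add, hx, hy]
    | tmul a b => simp [G]
  have h := congrArg G (coassoc_symm_apply (R := k) x)
  rw [← r.eq, map_sum, map_sum, map_sum, map_sum] at h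
  simp only [LinearMap.lTensor_tmul, hG, mul_antipode_lTensor_comul_apply] at h
  rw [map_sum] at h
  simp only [LinearMap.rTensor_tmul] at h
  refine h.symm.trans ?_
  simp only [Algebra.algebraMap_eq_smul_one, ← TensorProduct.smul_tmul]
  rw [← TensorProduct.sum_tmul, sum_counit_right_smul]

namespace IsIntegralPair

variable {Λ : A} {l : A →ₗ[k] k}

/-- `Λ₁ ⊗ x Λ₂ = S(x) Λ₁ ⊗ Λ₂`. -/
lemma tmul_mul_comul (h : IsIntegralPair Λ l) (x : A) :
    ((1 : A) ⊗ₜ[k] x) * comul Λ = (antipode k x ⊗ₜ 1) * comul Λ := by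
  have r := ℛ k x
  rw [← sum_antipode_tmul_mul_comul r, Finset.sum_mul]
  conv_rhs => rw [← sum_counit_right_smul r, map_sum, TensorProduct.sum_tmul, Finset.sum_mul]
  refine Finset.sum_congr rfl fun i _ => ?_
  rw [mul_assoc, ← Bialgebra.comul_mul, h.mul_eq, map_smul, map_smul, ← TensorProduct.smul_tmul',
    smul_mul_assoc, mul_smul_comm]

/-- `Λ₁ x ⊗ Λ₂ = Λ₁ ⊗ Λ₂ S(x)`. -/
lemma comul_mul_tmul (h : IsIntegralPair Λ l) (x : A) :
    comul Λ * (x ⊗ₜ[k] (1 : A)) = comul Λ * (1 ⊗ₜ antipode k x) := by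
  have r := ℛ k x
  rw [← sum_comul_mul_tmul_antipode r, Finset.mul_sum]
  conv_rhs => rw [← sum_counit_smul r, map_sum, TensorProduct.tmul_sum, Finset.mul_sum]
  refine Finset.sum_congr rfl fun i _ => ?_
  rw [← mul_assoc, ← Bialgebra.comul_mul, h.eq_mul, map_smul, map_smul, TensorProduct.tmul_smul,
    smul_mul_assoc, mul_smul_comm]

lemma form_mul_contract_mul (f l : A →ₗ[k] k) (y : A ⊗[k] A) (p q : A) :
    l (p * contract A f y * q) =
      f (TensorProduct.lid k A (l.rTensor A ((p ⊗ₜ 1) * y * (q ⊗ₜ 1)))) := by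
  induction y with
  | zero => simp
  | add x y hx hy => simp only [map_add, mul_add, add_mul, hx, hy]
  | tmul a b => simp [mul_comm]

lemma lid_rTensor_mul (l : A →ₗ[k] k) (y : A ⊗[k] A) (p q : A) :
    TensorProduct.lid k A (l.rTensor A ((1 ⊗ₜ p) * y * (1 ⊗ₜ q))) =
      p * TensorProduct.lid k A (l.rTensor A y) * q := by
  induction y with
  | zero => simp
  | add x y hx hy => simp only [map_add, mul_add, add_mul, hx, hy]
  | tmul a b => simp

/-- The value `λ(Λ)` does not vanish: otherwise `Λ₁ λ(y Λ₂) = S(y) λ(Λ) = 0` for all `y`, hence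
`0 = λ(S(Λ₁) Λ₂) = ε(Λ) λ(1)`. -/
lemma form_ne_zero (h : IsIntegralPair Λ l) [Module.Finite k A] : l Λ ≠ 0 := by
  intro h0
  -- `Λ₁ λ(y Λ₂) = S(y) Λ₁ λ(Λ₂) = S(y) λ(Λ) = 0`.
  have h1 : ∀ y : A, contract A (l ∘ₗ LinearMap.mulLeft k y) (comul Λ) = 0 := fun y => by
    have e1 : ∀ z : A ⊗[k] A, contract A (l ∘ₗ LinearMap.mulLeft k y) z =
        contract A l ((1 ⊗ₜ y) * z) := fun z => by
      induction z with
      | zero => simp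
      | add x y hx hy => simp only [map_add, mul_add, hx, hy]
      | tmul a b => simp
    have e2 : ∀ (p : A) (z : A ⊗[k] A), contract A l ((p ⊗ₜ 1) * z) = p * contract A l z :=
      fun p z => by
      induction z with
      | zero => simp
      | add x y hx hy => simp only [map_add, mul_add, hx, hy]
      | tmul a b => simp
    rw [e1, h.tmul_mul_comul, e2, h.form_right, h0, zero_smul, mul_zero]
  let b := Module.Free.chooseBasis k A
  -- Expanding in a basis writes `λ(S(Λ₁) Λ₂)` through the vanishing elements `Λ₁ λ(S(bᵢ) Λ₂)`.
  have h2 : ∀ z : A ⊗[k] A, l (LinearMap.mul' k A ((antipode k).rTensor A z)) =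
      ∑ i, b.coord i (contract A (l ∘ₗ LinearMap.mulLeft k (antipode k (b i))) z) := fun z => by
    induction z with
    | zero => simp
    | add x y hx hy => simp only [map_add, hx, hy, Finset.sum_add_distrib]
    | tmul u v =>
      conv_lhs => rw [← b.sum_repr u, TensorProduct.sum_tmul]
      simp [mul_comm]
  have h3 := h2 (comul Λ)
  rw [mul_antipode_rTensor_comul_apply, h.counit_eq, map_one, h.form_one] at h3
  simp [h1] at h3

/-- Every element of `A` is of the form `Λ₁ f(Λ₂)`: the map `f ↦ Λ₁ f(Λ₂)` is injective, as
`λ(S(z) Λ₁) f(Λ₂) = λ(Λ₁) f(z Λ₂) = λ(Λ) f(z)`, and `A*` and `A` have the same dimension. -/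
lemma contract_comul_surjective (h : IsIntegralPair Λ l) [Module.Finite k A] :
    Function.Surjective fun f : A →ₗ[k] k => contract A f (comul Λ) := by
  let T : (A →ₗ[k] k) →ₗ[k] A :=
    { toFun := fun f => contract A f (comul Λ)
      map_add' := fun f g => by rw [contract_add, LinearMap.add_apply]
      map_smul' := fun c f => by rw [contract_smul, LinearMap.smul_apply, RingHom.id_apply] }
  have hT : Function.Injective T := by
    rw [← LinearMap.ker_eq_bot, LinearMap.ker_eq_bot']
    intro f hf
    ext z
    have h1 := form_mul_contract_mul f l (comul Λ) (antipode k z) 1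
    have h2 := lid_rTensor_mul l (comul Λ) z 1
    rw [show contract A f (comul Λ) = 0 from hf, ← Algebra.TensorProduct.one_def, mul_one, mul_one,
      ← h.tmul_mul_comul] at h1
    rw [← Algebra.TensorProduct.one_def, mul_one, h.form_left] at h2
    rw [h2] at h1
    simp only [mul_zero, mul_one, map_zero, mul_smul_comm, map_smul, smul_eq_mul] at h1
    exact (mul_eq_zero.1 h1.symm).resolve_left h.form_ne_zero
  exact (LinearMap.injective_iff_surjective_of_finrank_eq_finrank
    (Subspace.dual_finrank_eq (K := k) (V := A))).1 hT

/-- The integral `λ` is invariant: `λ(S(a₁) x a₂) = ε(a) λ(x)`. Writing `x = Λ₁ f(Λ₂)`, the factors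
`S(a₁)` and `a₂` move to the second tensor factor, where they become `a₁` and `S(a₂)`. -/
lemma sum_form_antipode_mul_mul (h : IsIntegralPair Λ l) [Module.Finite k A] {ι : Type*} {a : A}
    (r : Repr k a ι) (x : A) :
    ∑ i ∈ r.index, l (antipode k (r.left i) * x * r.right i) = counit (R := k) a * l x := by
  obtain ⟨f, rfl⟩ := h.contract_comul_surjective x
  have h1 : ∀ i, l (antipode k (r.left i) * contract A f (comul Λ) * r.right i) =
      f (l Λ • (r.left i * antipode k (r.right i))) := fun i => by
    rw [form_mul_contract_mul, mul_assoc, h.comul_mul_tmul, ← mul_assoc, ← h.tmul_mul_comul,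
      lid_rTensor_mul, h.form_left, mul_smul_comm, smul_mul_assoc, mul_one]
  have h2 := form_mul_contract_mul f l (comul Λ) 1 1
  rw [← Algebra.TensorProduct.one_def, mul_one, one_mul, mul_one, one_mul, h.form_left] at h2
  simp only [h1, h2]
  rw [← map_sum, ← Finset.smul_sum, sum_mul_antipode_eq_smul]
  simp only [map_smul, smul_eq_mul]
  ring

end IsIntegralPair

end Integrals

/-! ### Separable algebras -/

section Separable

/-- A separability idempotent of an algebra. -/
def IsSepIdempotent {k A : Type*} [CommRing k] [Ring A] [Algebra k A] (e : A ⊗[k] A) : Prop :=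
  LinearMap.mul' k A e = 1 ∧ ∀ a, (a ⊗ₜ[k] (1 : A)) * e = e * (1 ⊗ₜ a)

variable {k A X : Type*} [CommRing k] [Ring A] [Algebra k A] [Ring X] [Algebra k X]

/-- The inner derivation `a ↦ φ f(a) - f(a) φ` along an algebra homomorphism `f`. -/
noncomputable def innerDer (f : A →ₐ[k] X) (φ : X) : A →ₗ[k] X :=
  (LinearMap.mulLeft k φ - LinearMap.mulRight k φ) ∘ₗ f.toLinearMap

@[simp] lemma innerDer_apply (f : A →ₐ[k] X) (φ : X) (a : A) :
    innerDer f φ a = φ * f a - f a * φ := rfl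

/-- Derivations of a separable algebra are inner: for a separability idempotent `∑ uᵢ ⊗ vᵢ`, the
derivation `θ` is given by `∑ θ(uᵢ) f(vᵢ)`. -/
theorem exists_innerDer_eq {e : A ⊗[k] A} (he : IsSepIdempotent e) (f : A →ₐ[k] X)
    (θ : A →ₗ[k] X) (hθ : ∀ a b, θ (a * b) = f a * θ b + θ a * f b) :
    ∃ φ, θ = innerDer f φ := by
  let Φ : A ⊗[k] A →ₗ[k] X := LinearMap.mul' k X ∘ₗ TensorProduct.map θ f.toLinearMap
  have h₁ : ∀ a (y : A ⊗[k] A),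
      f a * Φ y = Φ ((a ⊗ₜ 1) * y) - θ a * f (LinearMap.mul' k A y) := fun a y => by
    induction y with
    | zero => simp
    | add x y hx hy => rw [map_add, mul_add, hx, hy, mul_add]; simp only [map_add, mul_add]; abel
    | tmul u v => simp [Φ, hθ, add_mul, mul_assoc]
  have h₂ : ∀ a (y : A ⊗[k] A), Φ (y * (1 ⊗ₜ a)) = Φ y * f a := fun a y => by
    induction y with
    | zero => simp
    | add x y hx hy => rw [map_add, add_mul, map_add, hx, hy, add_mul]
    | tmul u v => simp [Φ, mul_assoc]
  refine ⟨Φ e, LinearMap.ext fun a => ?_⟩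
  rw [innerDer_apply, h₁, he.1, map_one, mul_one, he.2, h₂, sub_sub_cancel]

/-- Hochschild `2`-cocycles of a separable algebra are coboundaries: for a separability idempotent
`∑ uᵢ ⊗ vᵢ`, the cocycle `θ` is the coboundary of `x ↦ ∑ f(uᵢ) θ(vᵢ ⊗ x)`. -/
theorem exists_eq_coboundary {e : A ⊗[k] A} (he : IsSepIdempotent e) (f : A →ₐ[k] X)
    (θ : A ⊗[k] A →ₗ[k] X)
    (hθ : ∀ x y z, f x * θ (y ⊗ₜ z) - θ ((x * y) ⊗ₜ z) + θ (x ⊗ₜ (y * z)) - θ (x ⊗ₜ y) * f z = 0) :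
    ∃ D : A →ₗ[k] X, ∀ x y, θ (x ⊗ₜ y) = f x * D y - D (x * y) + D x * f y := by
  let Φ : A → A ⊗[k] A →ₗ[k] X := fun x =>
    LinearMap.mul' k X ∘ₗ TensorProduct.map f.toLinearMap
      (θ ∘ₗ (TensorProduct.mk k A A).flip x)
  let D : A →ₗ[k] X :=
    { toFun := fun x => Φ x e
      map_add' := fun x y => by
        simp only [Φ, map_add, LinearMap.comp_add, TensorProduct.map_add_right, LinearMap.add_apply]
      map_smul' := fun c x => by
        simp only [Φ, map_smul, LinearMap.comp_smul, TensorProduct.map_smul_right,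
          LinearMap.smul_apply, RingHom.id_apply] }
  have h₁ : ∀ x y (t : A ⊗[k] A), f (LinearMap.mul' k A t) * θ (x ⊗ₜ y) =
      Φ y (t * (1 ⊗ₜ x)) - Φ (x * y) t + Φ x t * f y := fun x y t => by
    induction t with
    | zero => simp
    | add s t hs ht =>
      simp only [map_add, add_mul, hs, ht]
      abel
    | tmul u v =>
      have := congrArg (f u * ·) (hθ v x y)
      simp only [mul_sub, mul_add, mul_zero] at this
      simp only [LinearMap.mul'_apply, map_mul, Algebra.TensorProduct.tmul_mul_tmul, mul_one, Φ,
        LinearMap.comp_apply, TensorProduct.map_tmul, AlgHom.toLinearMap_apply,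
        LinearMap.flip_apply, TensorProduct.mk_apply, mul_assoc]
      rw [← sub_eq_zero, ← this]
      abel
  have h₂ : ∀ x y (t : A ⊗[k] A), Φ y ((x ⊗ₜ 1) * t) = f x * Φ y t := fun x y t => by
    induction t with
    | zero => simp
    | add s t hs ht => simp only [map_add, mul_add, hs, ht]
    | tmul u v => simp [Φ, mul_assoc]
  refine ⟨D, fun x y => ?_⟩
  have := h₁ x y e
  rwa [he.1, map_one, one_mul, ← he.2, h₂] at this

end Separable

/-! ### The cobar complex -/

section Cobar

variable {R B : Type*} [CommRing R] [AddCommGroup B] [Module R B]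

/-- The map `Δ ⊗ id : B ⊗ M → B ⊗ (B ⊗ M)`. -/
noncomputable def leftComul (Δ : B →ₗ[R] B ⊗[R] B) (M : Type*) [AddCommGroup M] [Module R M] :
    B ⊗[R] M →ₗ[R] B ⊗[R] (B ⊗[R] M) :=
  (TensorProduct.assoc R B B M).toLinearMap ∘ₗ Δ.rTensor M

/-- The cobar differential of `ξ : B → B`, that is
`(id ⊗ ξ) Δ - Δ ξ + (ξ ⊗ id) Δ`. -/
noncomputable def cobar₁ (Δ : B →ₗ[R] B ⊗[R] B) (ξ : B →ₗ[R] B) : B →ₗ[R] B ⊗[R] B :=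
  ξ.lTensor B ∘ₗ Δ - Δ ∘ₗ ξ + ξ.rTensor B ∘ₗ Δ

/-- The cobar differential of `η : B → B ⊗ B`. -/
noncomputable def cobar₂ (Δ η : B →ₗ[R] B ⊗[R] B) : B →ₗ[R] B ⊗[R] (B ⊗[R] B) :=
  η.lTensor B ∘ₗ Δ - leftComul Δ B ∘ₗ η + Δ.lTensor B ∘ₗ η -
    (TensorProduct.assoc R B B B).toLinearMap ∘ₗ η.rTensor B ∘ₗ Δ

variable (R B) in
/-- The associator `(B ⊗ (B ⊗ B)) ⊗ B ≃ B ⊗ (B ⊗ (B ⊗ B))`. -/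
noncomputable def assoc₃ : (B ⊗[R] (B ⊗[R] B)) ⊗[R] B →ₗ[R] B ⊗[R] (B ⊗[R] (B ⊗[R] B)) :=
  (TensorProduct.assoc R B B B).toLinearMap.lTensor B ∘ₗ
    (TensorProduct.assoc R B (B ⊗[R] B) B).toLinearMap

/-- The cobar differential of `θ : B → B ⊗ (B ⊗ B)`. -/
noncomputable def cobar₃ (Δ : B →ₗ[R] B ⊗[R] B) (θ : B →ₗ[R] B ⊗[R] (B ⊗[R] B)) :
    B →ₗ[R] B ⊗[R] (B ⊗[R] (B ⊗[R] B)) :=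
  θ.lTensor B ∘ₗ Δ - leftComul Δ (B ⊗[R] B) ∘ₗ θ + (leftComul Δ B).lTensor B ∘ₗ θ -
    (Δ.lTensor B).lTensor B ∘ₗ θ + assoc₃ R B ∘ₗ θ.rTensor B ∘ₗ Δ

/-- The failure of coassociativity of `Δ`. -/
noncomputable def coassocDefect (Δ : B →ₗ[R] B ⊗[R] B) : B →ₗ[R] B ⊗[R] (B ⊗[R] B) :=
  Δ.lTensor B ∘ₗ Δ - leftComul Δ B ∘ₗ Δ

/-- The failure of coassociativity is a cocycle (the pentagon). -/
lemma cobar₃_coassocDefect (Δ : B →ₗ[R] B ⊗[R] B) : cobar₃ Δ (coassocDefect Δ) = 0 := by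
  have e₁ : ∀ x : B ⊗[R] B, leftComul Δ (B ⊗[R] B) (Δ.lTensor B x) =
      (Δ.lTensor B).lTensor B (leftComul Δ B x) := fun x => by
    induction x with
    | zero => simp
    | add x y hx hy => simp only [map_add, hx, hy]
    | tmul a b =>
      simp only [leftComul, LinearMap.comp_apply, LinearMap.lTensor_tmul, LinearMap.rTensor_tmul,
        LinearEquiv.coe_coe]
      induction Δ a with
      | zero => simp
      | add x y hx hy => simp only [TensorProduct.add_tmul, map_add, hx, hy]
      | tmul c d => simp
  have e₂ : ∀ x : B ⊗[R] B, leftComul Δ (B ⊗[R] B) (leftComul Δ B x) =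
      assoc₃ R B ((leftComul Δ B ∘ₗ Δ).rTensor B x) := fun x => by
    induction x with
    | zero => simp
    | add x y hx hy => simp only [map_add, hx, hy]
    | tmul a b =>
      simp only [leftComul, LinearMap.comp_apply, LinearMap.rTensor_tmul, LinearEquiv.coe_coe]
      induction Δ a with
      | zero => simp
      | add x y hx hy => simp only [TensorProduct.add_tmul, map_add, hx, hy]
      | tmul c d =>
        simp only [TensorProduct.assoc_tmul, LinearMap.rTensor_tmul]
        induction Δ c with
        | zero => simp
        | add x y hx hy => simp only [TensorProduct.add_tmul, map_add, hx, hy]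
        | tmul e f => simp [assoc₃]
  have e₃ : ∀ x : B ⊗[R] B, (leftComul Δ B).lTensor B (leftComul Δ B x) =
      assoc₃ R B ((Δ.lTensor B ∘ₗ Δ).rTensor B x) := fun x => by
    induction x with
    | zero => simp
    | add x y hx hy => simp only [map_add, hx, hy]
    | tmul a b =>
      simp only [leftComul, LinearMap.comp_apply, LinearMap.rTensor_tmul, LinearEquiv.coe_coe]
      induction Δ a with
      | zero => simp
      | add x y hx hy => simp only [TensorProduct.add_tmul, map_add, hx, hy]
      | tmul c d => simp [assoc₃]
  ext b
  simp only [cobar₃, coassocDefect, LinearMap.add_apply, LinearMap.sub_apply,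
    LinearMap.comp_apply, LinearMap.lTensor_sub, LinearMap.rTensor_sub, map_sub, e₁, e₂, e₃,
    LinearMap.lTensor_comp, LinearMap.zero_apply]
  abel

lemma leftComul_add (α β : B →ₗ[R] B ⊗[R] B) (M : Type*) [AddCommGroup M] [Module R M] :
    leftComul (α + β) M = leftComul α M + leftComul β M := by
  simp [leftComul, LinearMap.rTensor_add, LinearMap.comp_add]

lemma leftComul_smul (r : R) (α : B →ₗ[R] B ⊗[R] B) (M : Type*) [AddCommGroup M] [Module R M] :
    leftComul (r • α) M = r • leftComul α M := by
  simp [leftComul, LinearMap.rTensor_smul, LinearMap.comp_smul]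

/-- Expansion of the failure of coassociativity of `Δ + c η + c² ζ` in powers of `c`: the linear
term is the cobar differential of `η`. -/
lemma exists_coassocDefect_add (Δ η ζ : B →ₗ[R] B ⊗[R] B) (c : R) :
    ∃ ρ, coassocDefect (Δ + c • η + (c * c) • ζ) =
      coassocDefect Δ + c • cobar₂ Δ η + (c * c) • ρ := by
  let b : (B →ₗ[R] B ⊗[R] B) → (B →ₗ[R] B ⊗[R] B) → (B →ₗ[R] B ⊗[R] (B ⊗[R] B)) :=
    fun α β => α.lTensor B ∘ₗ β - leftComul α B ∘ₗ β
  have hadd₁ : ∀ α α' β, b (α + α') β = b α β + b α' β := fun α α' β => by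
    simp only [b, LinearMap.lTensor_add, leftComul_add, LinearMap.add_comp]
    abel
  have hadd₂ : ∀ α β β', b α (β + β') = b α β + b α β' := fun α β β' => by
    simp only [b, LinearMap.comp_add]
    abel
  have hsmul₁ : ∀ (r : R) α β, b (r • α) β = r • b α β := fun r α β => by
    simp only [b, LinearMap.lTensor_smul, leftComul_smul, LinearMap.smul_comp, smul_sub]
  have hsmul₂ : ∀ (r : R) α β, b α (r • β) = r • b α β := fun r α β => by
    simp only [b, LinearMap.comp_smul, smul_sub]
  have hcob : cobar₂ Δ η = b Δ η + b η Δ := by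
    simp only [cobar₂, b, leftComul, LinearMap.comp_assoc]
    abel
  refine ⟨b Δ ζ + b ζ Δ + b η η + c • (b η ζ + b ζ η) + (c * c) • b ζ ζ, ?_⟩
  change b _ _ = b Δ Δ + _ + _
  rw [hcob]
  simp only [hadd₁, hadd₂, hsmul₁, hsmul₂, smul_add, smul_smul]
  module

end Cobar

/-! ### Vanishing of the invariant cobar cohomology -/

section Vanishing

open Coalgebra HopfAlgebra

variable {k A M : Type*} [Field k] [Ring A] [HopfAlgebra k A] [Ring M] [Algebra k M]

/-- The homomorphism `a ↦ ∑ a₁ ⊗ f(a₂)`. Starting from the identity of `A` it produces the iterated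
comultiplications, along which `A` acts on its tensor powers. -/
noncomputable def extendHom (f : A →ₐ[k] M) : A →ₐ[k] A ⊗[k] M :=
  (Algebra.TensorProduct.map (AlgHom.id k A) f).comp (Bialgebra.comulAlgHom k A)

/-- The contraction `A ⊗ M → M`, `a ⊗ m ↦ λ(a) m`. -/
noncomputable def formContract (l : A →ₗ[k] k) (M : Type*) [AddCommGroup M] [Module k M] :
    A ⊗[k] M →ₗ[k] M :=
  (TensorProduct.lid k M).toLinearMap ∘ₗ l.rTensor M

@[simp] lemma formContract_tmul (l : A →ₗ[k] k) (a : A) (m : M) :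
    formContract l M (a ⊗ₜ m) = l a • m := by simp [formContract]

variable {Λ : A} {l : A →ₗ[k] k}

/-- Contraction with `λ` is compatible with the adjoint action, through
`λ(S(a₁) x a₂) = ε(a) λ(x)`. -/
lemma IsIntegralPair.sum_formContract (h : IsIntegralPair Λ l) [Module.Finite k A]
    (f : A →ₐ[k] M) {ι : Type*} {a : A} (r : Repr k a ι) (x : A ⊗[k] M) :
    ∑ i ∈ r.index, formContract l M ((antipode k (r.left i) ⊗ₜ 1) * x * extendHom f (r.right i)) =
      formContract l M x * f a := by
  induction x with
  | zero => simp
  | add x y hx hy => simp only [mul_add, add_mul, map_add, Finset.sum_add_distrib, hx, hy]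
  | tmul u m =>
    let Ψ : A ⊗[k] (A ⊗[k] A) →ₗ[k] M := formContract l M ∘ₗ
      LinearMap.mul' k (A ⊗[k] M) ∘ₗ TensorProduct.map
        (LinearMap.mulRight k (u ⊗ₜ m) ∘ₗ (TensorProduct.mk k A M).flip 1 ∘ₗ antipode k)
        (Algebra.TensorProduct.map (AlgHom.id k A) f).toLinearMap
    have hΨ : ∀ p z, Ψ (p ⊗ₜ z) = formContract l M ((antipode k p ⊗ₜ 1) * (u ⊗ₜ m) *
        Algebra.TensorProduct.map (AlgHom.id k A) f z) := fun p z => rfl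
    let adj : A ⊗[k] A →ₗ[k] A :=
      LinearMap.mul' k A ∘ₗ TensorProduct.map (LinearMap.mulRight k u ∘ₗ antipode k) LinearMap.id
    have hadj : ∀ a : A, l (adj (comul a)) = counit (R := k) a * l u := fun a => by
      have r := ℛ k a
      rw [← h.sum_form_antipode_mul_mul r u]
      conv_lhs => rw [← r.eq]
      simp [adj]
    have hΨ' : ∀ (y : A ⊗[k] A) (c : A), Ψ (TensorProduct.assoc k A A A (y ⊗ₜ c)) =
        l (adj y) • (m * f c) := fun y c => by
      induction y with
      | zero => simp
      | add x y hx hy => simp only [TensorProduct.add_tmul, map_add, add_smul, hx, hy]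
      | tmul p q => simp [hΨ, adj]
    have key := congrArg Ψ (coassoc_apply (R := k) a)
    rw [← r.eq, map_sum, map_sum, map_sum, map_sum, map_sum] at key
    simp only [LinearMap.rTensor_tmul, hΨ', LinearMap.lTensor_tmul, hΨ, hadj] at key
    refine key.symm.trans ?_
    conv_rhs => rw [← sum_counit_smul r, map_sum, Finset.mul_sum]
    refine Finset.sum_congr rfl fun i _ => ?_
    simp [mul_smul]

/-- Contraction with the integral `λ` preserves invariants, that is, elements commuting with the
image of `A`. -/
lemma IsIntegralPair.commute_formContract (h : IsIntegralPair Λ l) [Module.Finite k A]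
    (f : A →ₐ[k] M) {x : A ⊗[k] M} (hx : ∀ a, Commute x (extendHom f a)) (a : A) :
    Commute (formContract l M x) (f a) := by
  have r := ℛ k a
  have h₁ : ∀ y : A ⊗[k] M, formContract l M ((1 ⊗ₜ f a) * y) = f a * formContract l M y :=
    fun y => by
    induction y with
    | zero => simp
    | add x y hx hy => simp only [map_add, mul_add, hx, hy]
    | tmul u m => simp
  -- Expanding `1 ⊗ f(a) = ∑ (S(a₁) ⊗ 1) (a₂ ⊗ f(a₃))` makes room for moving `x` past `a`.
  have h₂ : (1 : A) ⊗ₜ[k] f a =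
      ∑ i ∈ r.index, (antipode k (r.left i) ⊗ₜ[k] (1 : M)) * extendHom f (r.right i) := by
    have := congrArg (Algebra.TensorProduct.map (AlgHom.id k A) f) (sum_antipode_tmul_mul_comul r)
    rw [map_sum] at this
    simpa [extendHom] using this.symm
  refine Eq.symm ?_
  rw [← h₁, h₂, Finset.sum_mul, map_sum, ← h.sum_formContract f r x]
  refine Finset.sum_congr rfl fun i _ => ?_
  rw [mul_assoc, mul_assoc, (hx _).eq]

/-- The cobar differential `A ⊗ M → A ⊗ (A ⊗ M)` determined by the differential `d : M → A ⊗ M`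
of the preceding degree, `a ⊗ m ↦ 1 ⊗ a ⊗ m - Δ(a) ⊗ m + a ⊗ 1 ⊗ m - a ⊗ d(m)`. -/
noncomputable def cobarSucc (d : M →ₗ[k] A ⊗[k] M) : A ⊗[k] M →ₗ[k] A ⊗[k] (A ⊗[k] M) :=
  TensorProduct.mk k A (A ⊗[k] M) 1 - leftComul comul M +
    (TensorProduct.mk k A M 1 - d).lTensor A

/-- Contraction with the integral is a contracting homotopy of the cobar complex, as `λ(1) = 1` and
`λ(a₁) a₂ = λ(a)`. -/
lemma IsIntegralPair.homotopy (h : IsIntegralPair Λ l) (d : M →ₗ[k] A ⊗[k] M) (x : A ⊗[k] M) :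
    formContract l _ (cobarSucc d x) + d (formContract l M x) = x := by
  have h₁ : ∀ (y : A ⊗[k] A) (m : M), formContract l (A ⊗[k] M)
      (TensorProduct.assoc k A A M (y ⊗ₜ m)) =
        (TensorProduct.lid k A (l.rTensor A y)) ⊗ₜ m := fun y m => by
    induction y with
    | zero => simp
    | add x y hx hy => simp only [TensorProduct.add_tmul, map_add, hx, hy]
    | tmul p q => simp [TensorProduct.smul_tmul']
  induction x with
  | zero => simp
  | add x y hx hy =>
    simp only [map_add]
    nth_rw 3 [← hx, ← hy]
    abel
  | tmul a m =>
    simp only [cobarSucc, leftComul, LinearMap.add_apply, LinearMap.sub_apply,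
      LinearMap.comp_apply, TensorProduct.mk_apply, LinearMap.lTensor_tmul, map_add, map_sub,
      formContract_tmul, LinearMap.rTensor_tmul, LinearEquiv.coe_coe, h₁, h.form_left, h.form_one,
      map_smul, one_smul, TensorProduct.tmul_sub, TensorProduct.smul_tmul']
    simp only [← TensorProduct.smul_tmul']
    abel

/-- An element whose cobar differential is invariant is a coboundary up to an invariant: in the
homotopy formula for `φ`, the contraction of its cobar differential is invariant. -/
theorem IsIntegralPair.exists_innerDer_eq_innerDer (h : IsIntegralPair Λ l) [Module.Finite k A]
    (f : A →ₐ[k] M) (d : M →ₗ[k] A ⊗[k] M) (φ : A ⊗[k] M)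
    (hφ : ∀ a, Commute (cobarSucc d φ) (extendHom (extendHom f) a)) :
    ∃ j : M, innerDer (extendHom f) φ = innerDer (extendHom f) (d j) := by
  refine ⟨formContract l M φ, LinearMap.ext fun a => ?_⟩
  have h₁ := (h.commute_formContract (extendHom f) hφ a).eq
  have h₂ := h.homotopy d φ
  generalize formContract l _ (cobarSucc d φ) = ψ at h₁ h₂
  generalize formContract l M φ = j at h₂ ⊢
  rw [← h₂]
  simp only [innerDer_apply, add_mul, mul_add, h₁]
  abel

section Faces

variable {X : Type*} [Ring X] [Algebra k X]

lemma lTensor_innerDer (f : A →ₐ[k] M) (φ : M) (y : X ⊗[k] A) :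
    (innerDer f φ).lTensor X y =
      (1 ⊗ₜ φ) * f.toLinearMap.lTensor X y - f.toLinearMap.lTensor X y * (1 ⊗ₜ φ) := by
  induction y with
  | zero => simp
  | add x y hx hy => simp only [map_add, mul_add, add_mul, hx, hy]; abel
  | tmul u v => simp [TensorProduct.tmul_sub]

lemma rTensor_innerDer (f : A →ₐ[k] M) (φ : M) (y : A ⊗[k] X) :
    (innerDer f φ).rTensor X y =
      (φ ⊗ₜ 1) * f.toLinearMap.rTensor X y - f.toLinearMap.rTensor X y * (φ ⊗ₜ 1) := by
  induction y with
  | zero => simp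
  | add x y hx hy => simp only [map_add, mul_add, add_mul, hx, hy]; abel
  | tmul u v => simp [TensorProduct.sub_tmul]

lemma assoc_mul {X Y Z : Type*} [Ring X] [Algebra k X] [Ring Y] [Algebra k Y] [Ring Z]
    [Algebra k Z] (x y : (X ⊗[k] Y) ⊗[k] Z) :
    TensorProduct.assoc k X Y Z (x * y) =
      TensorProduct.assoc k X Y Z x * TensorProduct.assoc k X Y Z y :=
  map_mul (Algebra.TensorProduct.assoc k k k X Y Z) x y

lemma lTensor_mul {X Y Z : Type*} [Ring X] [Algebra k X] [Ring Y] [Algebra k Y] [Ring Z]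
    [Algebra k Z] {g : Y →ₗ[k] Z} (hg : ∀ a b, g (a * b) = g a * g b) (x y : X ⊗[k] Y) :
    g.lTensor X (x * y) = g.lTensor X x * g.lTensor X y := by
  induction x with
  | zero => simp
  | add x x' hx hx' => simp only [map_add, add_mul, hx, hx']
  | tmul a b =>
    induction y with
    | zero => simp
    | add y y' hy hy' => simp only [map_add, mul_add, hy, hy']
    | tmul c d => simp [hg]

lemma rTensor_mul {X Y Z : Type*} [Ring X] [Algebra k X] [Ring Y] [Algebra k Y] [Ring Z]
    [Algebra k Z] {g : Y →ₗ[k] Z} (hg : ∀ a b, g (a * b) = g a * g b) (x y : Y ⊗[k] X) :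
    g.rTensor X (x * y) = g.rTensor X x * g.rTensor X y := by
  induction x with
  | zero => simp
  | add x x' hx hx' => simp only [map_add, add_mul, hx, hx']
  | tmul a b =>
    induction y with
    | zero => simp
    | add y y' hy hy' => simp only [map_add, mul_add, hy, hy']
    | tmul c d => simp [hg]

lemma leftComul_mul (x y : A ⊗[k] X) :
    leftComul (comul (R := k) (A := A)) X (x * y) =
      leftComul (comul (R := k) (A := A)) X x * leftComul (comul (R := k) (A := A)) X y := by
  simp only [leftComul, LinearMap.comp_apply, LinearEquiv.coe_coe]
  rw [rTensor_mul (fun a b => Bialgebra.comul_mul a b), assoc_mul]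

end Faces

lemma extendHom_apply (f : A →ₐ[k] M) (a : A) :
    extendHom f a = f.toLinearMap.lTensor A (comul a) := rfl

lemma extendHom_id_apply (a : A) : extendHom (AlgHom.id k A) a = comul a := by
  rw [extendHom_apply]; exact LinearMap.lTensor_id_apply _ _ _

lemma leftComul_lTensor (f : A →ₗ[k] M) (x : A ⊗[k] A) :
    leftComul comul M (f.lTensor A x) = (f.lTensor A).lTensor A (leftComul comul A x) := by
  induction x with
  | zero => simp
  | add x y hx hy => simp only [map_add, hx, hy]
  | tmul a b =>
    simp only [leftComul, LinearMap.comp_apply, LinearMap.lTensor_tmul, LinearMap.rTensor_tmul,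
      LinearEquiv.coe_coe]
    induction comul (R := k) a with
    | zero => simp
    | add x y hx hy => simp only [TensorProduct.add_tmul, map_add, hx, hy]
    | tmul c d => simp

lemma leftComul_comul (a : A) : leftComul comul A (comul a) = comul.lTensor A (comul (R := k) a) :=
  coassoc_apply a

/-- Both ways of extending `Δ` to one more factor agree on `A`. -/
lemma leftComul_extendHom (f : A →ₐ[k] M) (a : A) :
    leftComul comul M (extendHom f a) = extendHom (extendHom f) a := by
  rw [extendHom_apply, leftComul_lTensor, leftComul_comul, ← LinearMap.lTensor_comp_apply]
  rfl

lemma lTensor_extendHom (f : A →ₐ[k] M) {M' : Type*} [Ring M'] [Algebra k M'] (g : M →ₗ[k] M')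
    (f' : A →ₐ[k] M') (h : ∀ a, g (f a) = f' a) (a : A) :
    g.lTensor A (extendHom f a) = extendHom f' a := by
  have e : g ∘ₗ f.toLinearMap = f'.toLinearMap := LinearMap.ext h
  rw [extendHom_apply, ← LinearMap.lTensor_comp_apply, e]
  rfl

lemma lTensor_tmul_one (x : A ⊗[k] A) : ((TensorProduct.mk k A A).flip 1).lTensor A x =
    TensorProduct.assoc k A A A (x ⊗ₜ 1) := by
  induction x with
  | zero => simp
  | add x y hx hy => simp only [TensorProduct.add_tmul, map_add, hx, hy]
  | tmul a b => simp

lemma lTensor_lTensor_tmul_one (x : A ⊗[k] (A ⊗[k] A)) :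
    (((TensorProduct.mk k A A).flip 1).lTensor A).lTensor A x = assoc₃ k A (x ⊗ₜ 1) := by
  induction x with
  | zero => simp
  | add x y hx hy => simp only [TensorProduct.add_tmul, map_add, hx, hy]
  | tmul a b => simp [assoc₃, lTensor_tmul_one]

lemma assoc₃_mul (x y : (A ⊗[k] (A ⊗[k] A)) ⊗[k] A) :
    assoc₃ k A (x * y) = assoc₃ k A x * assoc₃ k A y := by
  simp only [assoc₃, LinearMap.comp_apply, LinearEquiv.coe_coe, assoc_mul]
  exact lTensor_mul (fun a b => assoc_mul a b) _ _

variable (k A) in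
/-- The iterated comultiplication `A → A ⊗ (A ⊗ A)`. -/
noncomputable def comulHom₂ : A →ₐ[k] A ⊗[k] (A ⊗[k] A) := extendHom (Bialgebra.comulAlgHom k A)

lemma comulHom₂_apply (a : A) : comulHom₂ k A a = comul.lTensor A (comul (R := k) a) := rfl

lemma assoc₃_comulHom₂ (a : A) :
    assoc₃ k A ((comulHom₂ k A).toLinearMap.rTensor A (comul a)) =
      extendHom (comulHom₂ k A) a := by
  have e : ∀ x : A ⊗[k] A, assoc₃ k A ((comulHom₂ k A).toLinearMap.rTensor A x) =
      (leftComul comul A).lTensor A (leftComul comul A x) := fun x => by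
    induction x with
    | zero => simp
    | add x y hx hy => simp only [map_add, hx, hy]
    | tmul a b =>
      simp only [leftComul, LinearMap.comp_apply, LinearMap.rTensor_tmul, LinearEquiv.coe_coe,
        AlgHom.toLinearMap_apply, comulHom₂_apply]
      induction comul (R := k) a with
      | zero => simp
      | add x y hx hy => simp only [TensorProduct.add_tmul, map_add, hx, hy]
      | tmul c d => simp [assoc₃]
  have e' : leftComul comul A ∘ₗ comul = (comulHom₂ k A).toLinearMap :=
    LinearMap.ext fun a => leftComul_comul a
  rw [e, leftComul_comul, ← LinearMap.lTensor_comp_apply, extendHom_apply, e']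

/-- The cobar differential `j ↦ 1 ⊗ j - (Δ ⊗ id) j + (id ⊗ Δ) j - j ⊗ 1` on `A ⊗ A`. -/
noncomputable def cobarDiff₂ (k A : Type*) [Field k] [Ring A] [HopfAlgebra k A] :
    A ⊗[k] A →ₗ[k] A ⊗[k] (A ⊗[k] A) :=
  TensorProduct.mk k A _ 1 - leftComul comul A + comul.lTensor A -
    ((TensorProduct.mk k A A).flip 1).lTensor A

lemma cobarSucc_cobarDiff₂ (φ : A ⊗[k] (A ⊗[k] A)) : cobarSucc (cobarDiff₂ k A) φ =
    1 ⊗ₜ φ - leftComul comul (A ⊗[k] A) φ + (leftComul comul A).lTensor A φ -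
      (comul.lTensor A).lTensor A φ +
      (((TensorProduct.mk k A A).flip 1).lTensor A).lTensor A φ := by
  have : TensorProduct.mk k A _ 1 - cobarDiff₂ k A = leftComul comul A - comul.lTensor A +
      ((TensorProduct.mk k A A).flip 1).lTensor A := by
    simp only [cobarDiff₂]; abel
  simp only [cobarSucc, this, LinearMap.lTensor_sub, LinearMap.lTensor_add,
    LinearMap.add_apply, LinearMap.sub_apply, TensorProduct.mk_apply]
  abel

lemma innerDer_cobarDiff₂ (j : A ⊗[k] A) : innerDer (comulHom₂ k A) (cobarDiff₂ k A j) =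
    cobar₂ comul (innerDer (Bialgebra.comulAlgHom k A) j) := by
  refine LinearMap.ext fun a => ?_
  have e₁ : (Bialgebra.comulAlgHom k A).toLinearMap = comul := rfl
  have e₂ : TensorProduct.assoc k A A A (comul.rTensor A (comul (R := k) a)) = comulHom₂ k A a :=
    coassoc_apply a
  have e₃ : leftComul comul A (comul (R := k) a) = comulHom₂ k A a := coassoc_apply a
  have e₄ : comul.lTensor A (comul (R := k) a) = comulHom₂ k A a := rfl
  simp only [cobar₂, LinearMap.add_apply, LinearMap.sub_apply, LinearMap.comp_apply,
    lTensor_innerDer, rTensor_innerDer, innerDer_apply, cobarDiff₂, TensorProduct.mk_apply,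
    LinearEquiv.coe_coe, map_sub, assoc_mul, leftComul_mul, e₁, e₂,
    Bialgebra.comulAlgHom_apply]
  rw [lTensor_mul (fun a b => Bialgebra.comul_mul a b),
    lTensor_mul (fun a b => Bialgebra.comul_mul a b), e₃, e₄, lTensor_tmul_one]
  simp only [add_mul, sub_mul, mul_add, mul_sub]
  abel

lemma lTensor_leftComul_mul (x y : A ⊗[k] (A ⊗[k] A)) :
    (leftComul comul A).lTensor A (x * y) =
      (leftComul (R := k) comul A).lTensor A x * (leftComul comul A).lTensor A y :=
  lTensor_mul leftComul_mul x y

lemma lTensor_comul_mul (x y : A ⊗[k] A) :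
    comul.lTensor A (x * y) = comul.lTensor A x * (comul (R := k)).lTensor A y :=
  lTensor_mul Bialgebra.comul_mul x y

lemma lTensor_lTensor_comul_mul (x y : A ⊗[k] (A ⊗[k] A)) :
    (comul.lTensor A).lTensor A (x * y) =
      (comul.lTensor A).lTensor A x * ((comul (R := k)).lTensor A).lTensor A y :=
  lTensor_mul lTensor_comul_mul x y

/-- The cobar differential of the inner derivation defined by `φ` is the inner derivation defined by
the cobar differential of `φ`. -/
lemma cobar₃_innerDer (φ : A ⊗[k] (A ⊗[k] A)) (a : A) :
    cobar₃ comul (innerDer (comulHom₂ k A) φ) a =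
      cobarSucc (cobarDiff₂ k A) φ * extendHom (comulHom₂ k A) a -
        extendHom (comulHom₂ k A) a * cobarSucc (cobarDiff₂ k A) φ := by
  have e₁ : leftComul comul (A ⊗[k] A) (comulHom₂ k A a) = extendHom (comulHom₂ k A) a :=
    leftComul_extendHom _ a
  have e₂ : (leftComul comul A).lTensor A (comulHom₂ k A a) = extendHom (comulHom₂ k A) a :=
    lTensor_extendHom _ _ (comulHom₂ k A) (fun a => leftComul_comul a) a
  have e₃ : (comul.lTensor A).lTensor A (comulHom₂ k A a) = extendHom (comulHom₂ k A) a :=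
    lTensor_extendHom _ _ (comulHom₂ k A) (fun a => rfl) a
  have e₄ : (comulHom₂ k A).toLinearMap.lTensor A (comul a) = extendHom (comulHom₂ k A) a := rfl
  have e₅ := assoc₃_comulHom₂ (k := k) a
  rw [cobarSucc_cobarDiff₂, lTensor_lTensor_tmul_one]
  simp only [cobar₃, LinearMap.add_apply, LinearMap.sub_apply, LinearMap.comp_apply]
  rw [lTensor_innerDer, rTensor_innerDer, innerDer_apply, e₄]
  simp only [map_sub]
  rw [leftComul_mul, leftComul_mul, lTensor_leftComul_mul, lTensor_leftComul_mul,
    lTensor_lTensor_comul_mul, lTensor_lTensor_comul_mul, assoc₃_mul, assoc₃_mul, e₁, e₂, e₃, e₅]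
  simp only [add_mul, sub_mul, mul_add, mul_sub]
  abel

/-- Derivations `A → A ⊗ A` along `Δ` that are cobar cocycles are coboundaries of inner
derivations of `A`. -/
theorem IsIntegralPair.exists_eq_cobar₁ (h : IsIntegralPair Λ l) [Module.Finite k A]
    {e : A ⊗[k] A} (he : IsSepIdempotent e) (θ : A →ₗ[k] A ⊗[k] A)
    (hθ : ∀ a b, θ (a * b) = comul a * θ b + θ a * comul b) (hc : cobar₂ comul θ = 0) :
    ∃ j : A, θ = cobar₁ comul (innerDer (AlgHom.id k A) j) := by
  have hf : ∀ a : A, comul (R := k) a = extendHom (AlgHom.id k A) a := fun a =>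
    (extendHom_id_apply a).symm
  obtain ⟨φ, rfl⟩ := exists_innerDer_eq he (extendHom (AlgHom.id k A)) θ (by simpa [hf] using hθ)
  let d : A →ₗ[k] A ⊗[k] A :=
    TensorProduct.mk k A A 1 - comul + (TensorProduct.mk k A A).flip 1
  have hlin : (extendHom (AlgHom.id k A)).toLinearMap = comul (R := k) (A := A) :=
    LinearMap.ext extendHom_id_apply
  -- The derivation is inner, given by `φ`, and its being a cobar cocycle means that the cobar
  -- differential of `φ` is invariant.
  obtain ⟨j, hj⟩ := h.exists_innerDer_eq_innerDer (AlgHom.id k A) d φ fun a => by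
    have := LinearMap.congr_fun hc a
    simp only [cobar₂, LinearMap.add_apply, LinearMap.sub_apply, LinearMap.comp_apply,
      LinearEquiv.coe_coe, lTensor_innerDer, rTensor_innerDer, innerDer_apply,
      LinearMap.zero_apply, map_sub, assoc_mul, leftComul_mul, hlin] at this
    rw [lTensor_mul (fun a b => Bialgebra.comul_mul a b),
      lTensor_mul (fun a b => Bialgebra.comul_mul a b), extendHom_id_apply, leftComul_comul,
      show TensorProduct.assoc k A A A (comul.rTensor A (comul (R := k) a)) = _ from
        coassoc_apply a, ← lTensor_tmul_one] at this
    have hY : extendHom (extendHom (AlgHom.id k A)) a = comul.lTensor A (comul (R := k) a) := by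
      rw [extendHom_apply, hlin]
    have hd : cobarSucc d φ = 1 ⊗ₜ φ - leftComul comul A φ + comul.lTensor A φ -
        ((TensorProduct.mk k A A).flip 1).lTensor A φ := by
      have : TensorProduct.mk k A A 1 - d = comul - (TensorProduct.mk k A A).flip 1 := by
        simp only [d]; abel
      simp only [cobarSucc, this, LinearMap.lTensor_sub, LinearMap.add_apply,
        LinearMap.sub_apply, TensorProduct.mk_apply]
      abel
    rw [hd, hY, commute_iff_eq, ← sub_eq_zero, ← this]
    simp only [add_mul, sub_mul, mul_add, mul_sub]
    abel
  refine ⟨j, hj.trans (LinearMap.ext fun a => ?_)⟩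
  simp only [cobar₁, LinearMap.add_apply, LinearMap.sub_apply, LinearMap.comp_apply,
    lTensor_innerDer, rTensor_innerDer, innerDer_apply, d, TensorProduct.mk_apply,
    LinearMap.flip_apply, extendHom_id_apply, map_sub, Bialgebra.comul_mul,
    AlgHom.toLinearMap_id, LinearMap.lTensor_id_apply, LinearMap.rTensor_id_apply, AlgHom.id_apply,
    add_mul, sub_mul, mul_add, mul_sub]
  abel

/-- Derivations `A → A ⊗ A ⊗ A` along the iterated comultiplication that are cobar cocycles are
coboundaries of inner derivations `A → A ⊗ A`. -/
theorem IsIntegralPair.exists_eq_cobar₂ (h : IsIntegralPair Λ l) [Module.Finite k A]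
    {e : A ⊗[k] A} (he : IsSepIdempotent e) (θ : A →ₗ[k] A ⊗[k] (A ⊗[k] A))
    (hθ : ∀ a b, θ (a * b) =
      comul.lTensor A (comul (R := k) a) * θ b + θ a * comul.lTensor A (comul (R := k) b))
    (hc : cobar₃ comul θ = 0) :
    ∃ j : A ⊗[k] A, θ = cobar₂ comul (innerDer (Bialgebra.comulAlgHom k A) j) := by
  obtain ⟨φ, rfl⟩ := exists_innerDer_eq he (comulHom₂ k A) θ hθ
  obtain ⟨j, hj⟩ := h.exists_innerDer_eq_innerDer (Bialgebra.comulAlgHom k A) (cobarDiff₂ k A) φ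
    fun a => sub_eq_zero.1 ((cobar₃_innerDer φ a).symm.trans (LinearMap.congr_fun hc a))
  exact ⟨j, hj.trans (innerDer_cobarDiff₂ j)⟩

end Vanishing

/-! ### Lifting algebra homomorphisms -/

section MultDefect

variable {O B C : Type*} [CommRing O] [Ring B] [Algebra O B] [Ring C] [Algebra O C]

/-- The failure of multiplicativity of a linear map. -/
noncomputable def multDefect (g : B →ₗ[O] C) : B ⊗[O] B →ₗ[O] C :=
  g ∘ₗ LinearMap.mul' O B - LinearMap.mul' O C ∘ₗ TensorProduct.map g g

@[simp] lemma multDefect_tmul (g : B →ₗ[O] C) (x y : B) :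
    multDefect g (x ⊗ₜ y) = g (x * y) - g x * g y := rfl

lemma multDefect_add_smul (g E : B →ₗ[O] C) (c : O) :
    multDefect (g + c • E) = multDefect g + c • (E ∘ₗ LinearMap.mul' O B -
      LinearMap.mul' O C ∘ₗ TensorProduct.map g E - LinearMap.mul' O C ∘ₗ TensorProduct.map E g -
      c • LinearMap.mul' O C ∘ₗ TensorProduct.map E E) :=
  TensorProduct.ext' fun x y => by
    simp only [multDefect_tmul, LinearMap.add_apply, LinearMap.smul_apply, LinearMap.sub_apply,
      LinearMap.comp_apply, LinearMap.mul'_apply, TensorProduct.map_tmul, add_mul, mul_add,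
      smul_mul_assoc, mul_smul_comm, smul_sub, smul_add, smul_smul]
    abel

end MultDefect

section Lift

variable {O k : Type*} [CommRing O] [IsDomain O] [Field k] [Algebra O k] {ϖ : O}
  {B C A D : Type*}
  [Ring B] [Algebra O B] [Module.Free O B] [Module.Finite O B]
  [Ring C] [Algebra O C] [Module.Free O C] [Module.Finite O C]
  [Ring A] [Algebra k A] [Algebra O A] [IsScalarTower O k A]
  [Ring D] [Algebra k D] [Algebra O D] [IsScalarTower O k D]

namespace IsResidueMap

/-- A linear map that is a limit of algebra homomorphisms is an algebra homomorphism. -/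
lemma exists_algHom_of_limit (h : IsResidueMap k ϖ) (L : B →ₗ[O] C)
    (hL : ∀ m : ℕ, ∃ (f : B →ₐ[O] C) (y : B →ₗ[O] C), L + ϖ ^ (m + 1) • y = f.toLinearMap) :
    ∃ f : B →ₐ[O] C, f.toLinearMap = L := by
  have hpow : ∀ {x : C}, (∀ m : ℕ, ∃ y, x = ϖ ^ (m + 1) • y) → x = 0 := fun {x} hx =>
    h.eq_zero_of_forall_pow fun m => by
      obtain ⟨y, hy⟩ := hx m
      exact ⟨ϖ • y, by rw [smul_smul, ← pow_succ, hy]⟩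
  refine ⟨AlgHom.ofLinearMap L ?_ fun a b => ?_, rfl⟩
  · refine sub_eq_zero.1 (hpow fun m => ?_)
    obtain ⟨f, y, hy⟩ := hL m
    refine ⟨-y 1, ?_⟩
    rw [← (LinearMap.congr_fun hy 1).trans (map_one f)]
    simp
  · refine sub_eq_zero.1 (hpow fun m => ?_)
    obtain ⟨f, y, hy⟩ := hL m
    have h1 := LinearMap.congr_fun (multDefect_add_smul L y (ϖ ^ (m + 1))) (a ⊗ₜ b)
    rw [hy, multDefect_tmul, LinearMap.add_apply, multDefect_tmul] at h1
    simp only [AlgHom.toLinearMap_apply, map_mul, sub_self] at h1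
    exact ⟨_, (eq_neg_of_add_eq_zero_left h1.symm).trans (smul_neg _ _).symm⟩

/-- Algebra homomorphisms out of a separable algebra lift along reductions: the obstruction in
each step is a Hochschild `2`-cocycle. -/
theorem exists_algHom_lift (h : IsResidueMap k ϖ) {q : B →ₐ[O] A} {r : C →ₐ[O] D}
    (hq : IsBaseChange k q.toLinearMap) (hr : IsBaseChange k r.toLinearMap) {e : A ⊗[k] A}
    (he : IsSepIdempotent e) (f : A →ₐ[k] D) : ∃ g : B →ₐ[O] C, ∀ b, r (g b) = f (q b) := by
  have hqs := h.base_surjective hq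
  have hqq := isBaseChange_tmap hq hq
  have hrc : ∀ (m : ℕ) (x : C), r (ϖ ^ (m + 1) • x) = 0 := fun m x =>
    (h.base_eq_zero_iff hr).2 ⟨ϖ ^ m • x, by rw [smul_smul, pow_succ']⟩
  -- The approximate solutions of order `m` are the linear lifts of `f` that are multiplicative
  -- modulo `ϖ ^ (m + 1)`.
  let P : ℕ → (B →ₗ[O] C) → Prop := fun m g =>
    (∀ b, r (g b) = f (q b)) ∧ ∃ θ, multDefect g = ϖ ^ (m + 1) • θ
  have hdiv : ∀ (m : ℕ) (τ : B ⊗[O] B →ₗ[O] C), (∀ t, r (τ t) = 0) →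
      ∃ θ, ϖ ^ m • τ = ϖ ^ (m + 1) • θ := fun m τ hτ =>
    h.exists_eq_pow_smul (m + 1) _ fun t => h.exists_pow_succ hr m rfl (hτ t)
  obtain ⟨g₀, hg₀⟩ := h.exists_lift hr ((f.restrictScalars O).comp q).toLinearMap
  have h₀ : P 0 g₀ := by
    refine ⟨hg₀, ?_⟩
    obtain ⟨θ, hθ⟩ := hdiv 0 (multDefect g₀) fun t => by
      have hg₀' : ∀ b, r (g₀ b) = f (q b) := hg₀
      induction t with
      | zero => simp
      | add x y hx hy => simp only [map_add, hx, hy, add_zero]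
      | tmul x y => simp [hg₀']
    exact ⟨θ, by rw [← hθ, pow_zero, one_smul]⟩
  have step : ∀ m g, P m g → ∃ E, P (m + 1) (g + ϖ ^ (m + 1) • E) := by
    rintro m g ⟨hg, θ, hθ⟩
    have hθ' : ∀ x y, g (x * y) - g x * g y = ϖ ^ (m + 1) • θ (x ⊗ₜ y) := fun x y =>
      LinearMap.congr_fun hθ (x ⊗ₜ y)
    let θ' : A ⊗[k] A →ₗ[k] D := hqq.lift (r.toLinearMap ∘ₗ θ)
    have hθr : ∀ x y, θ' (q x ⊗ₜ q y) = r (θ (x ⊗ₜ y)) := fun x y =>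
      hqq.lift_eq (r.toLinearMap ∘ₗ θ) (x ⊗ₜ y)
    -- The quotient `θ` of the defect by `ϖ ^ (m + 1)` reduces to a Hochschild cocycle, because the
    -- product of `C` is associative. A lift of a cochain bounding it is the correction.
    obtain ⟨E', hE'⟩ := exists_eq_coboundary he f θ' fun x y z => by
      obtain ⟨x, rfl⟩ := hqs x
      obtain ⟨y, rfl⟩ := hqs y
      obtain ⟨z, rfl⟩ := hqs z
      simp only [AlgHom.toLinearMap_apply, ← map_mul q, hθr, ← hg, ← map_mul r, ← map_sub r,
        ← map_add r]
      rw [show g x * θ (y ⊗ₜ z) - θ ((x * y) ⊗ₜ z) + θ (x ⊗ₜ (y * z)) - θ (x ⊗ₜ y) * g z = 0 from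
        h.pow_smul_injective (m + 1) (by
          rw [smul_sub, smul_add, smul_sub, smul_zero, ← mul_smul_comm, ← smul_mul_assoc,
            ← hθ', ← hθ', ← hθ', ← hθ', mul_assoc x y z]
          noncomm_ring), map_zero]
    obtain ⟨E, hE⟩ := h.exists_lift hr (E'.restrictScalars O ∘ₗ q.toLinearMap)
    have hE₁ : ∀ b, r (E b) = E' (q b) := hE
    refine ⟨E, fun b => ?_, ?_⟩
    · rw [LinearMap.add_apply, map_add, LinearMap.smul_apply, hrc, add_zero, hg]
    · rw [multDefect_add_smul, hθ, ← smul_add]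
      refine hdiv (m + 1) _ fun t => ?_
      induction t with
      | zero => simp
      | add x y hx hy => rw [map_add, map_add, hx, hy, add_zero]
      | tmul x y =>
        simp only [LinearMap.add_apply, LinearMap.sub_apply, LinearMap.comp_apply,
          LinearMap.mul'_apply, TensorProduct.map_tmul, LinearMap.smul_apply, map_add, map_sub,
          hrc, ← hθr, map_mul, hE', hE₁, hg]
        abel
  obtain ⟨L, hL⟩ := h.exists_limit P h₀ step
  have hL₁ : ∀ b, r (L b) = f (q b) := fun b => by
    obtain ⟨y, hy, -⟩ := hL 0
    have := hy b
    rwa [LinearMap.add_apply, map_add, LinearMap.smul_apply, hrc, add_zero] at this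
  have hL₂ : ∀ a b, L (a * b) = L a * L b := fun a b => by
    refine sub_eq_zero.1 (h.eq_zero_of_forall_pow fun m => ?_)
    obtain ⟨y, -, θ, hθ⟩ := hL m
    rw [multDefect_add_smul] at hθ
    have h1 := LinearMap.congr_fun hθ (a ⊗ₜ b)
    rw [LinearMap.add_apply, multDefect_tmul, LinearMap.smul_apply, LinearMap.smul_apply,
      ← eq_sub_iff_add_eq, ← smul_sub, pow_succ, mul_smul] at h1
    exact ⟨_, h1⟩
  -- The limit preserves `1`, as its value at `1` is an idempotent that reduces to `1`.
  refine ⟨AlgHom.ofLinearMap L ?_ hL₂, hL₁⟩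
  exact h.eq_one_of_idempotent hr (by rw [hL₁, map_one, map_one]) (by rw [← hL₂, one_mul])

/-- An algebra homomorphism between lifts that reduces to an isomorphism is an isomorphism. -/
theorem exists_algEquiv_lift (h : IsResidueMap k ϖ) {q : B →ₐ[O] A} {r : C →ₐ[O] D}
    (hq : IsBaseChange k q.toLinearMap) (hr : IsBaseChange k r.toLinearMap) {e : A ⊗[k] A}
    (he : IsSepIdempotent e) (f : A ≃ₐ[k] D) : ∃ g : B ≃ₐ[O] C, ∀ b, r (g b) = f (q b) := by
  obtain ⟨g, hg⟩ := h.exists_algHom_lift hq hr he f.toAlgHom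
  exact ⟨AlgEquiv.ofBijective g (h.bijective_of_base hq hr g.toLinearMap f f.bijective hg), hg⟩

end IsResidueMap

end Lift

/-! ### Compatibility of the cobar differentials with reduction -/

section Naturality

variable {O F B A M M' N N' : Type*} [CommRing O] [CommRing F] [Algebra O F]
  [AddCommGroup B] [Module O B]
  [AddCommGroup A] [Module F A] [Module O A] [IsScalarTower O F A]
  [AddCommGroup M] [Module O M]
  [AddCommGroup M'] [Module F M'] [Module O M'] [IsScalarTower O F M']
  [AddCommGroup N] [Module O N]
  [AddCommGroup N'] [Module F N'] [Module O N'] [IsScalarTower O F N']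

lemma tmap_lTensor (q : B →ₗ[O] A) {r : M →ₗ[O] M'} {s : N →ₗ[O] N'} {g : M →ₗ[O] N}
    {g' : M' →ₗ[F] N'} (hg : ∀ m, s (g m) = g' (r m)) (x : B ⊗[O] M) :
    tmap F q s (g.lTensor B x) = g'.lTensor A (tmap F q r x) := by
  induction x with
  | zero => simp
  | add x y hx hy => simp only [map_add, hx, hy]
  | tmul a b => simp [hg]

lemma tmap_rTensor (q : B →ₗ[O] A) {r : M →ₗ[O] M'} {s : N →ₗ[O] N'} {g : M →ₗ[O] N}
    {g' : M' →ₗ[F] N'} (hg : ∀ m, s (g m) = g' (r m)) (x : M ⊗[O] B) :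
    tmap F s q (g.rTensor B x) = g'.rTensor A (tmap F r q x) := by
  induction x with
  | zero => simp
  | add x y hx hy => simp only [map_add, hx, hy]
  | tmul a b => simp [hg]

lemma tmap_assoc (q : B →ₗ[O] A) (r : M →ₗ[O] M') (s : N →ₗ[O] N') (x : (B ⊗[O] M) ⊗[O] N) :
    tmap F q (tmap F r s) (TensorProduct.assoc O B M N x) =
      TensorProduct.assoc F A M' N' (tmap F (tmap F q r) s x) := by
  induction x with
  | zero => simp
  | add x y hx hy => simp only [map_add, hx, hy]
  | tmul z c =>
    induction z with
    | zero => simp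
    | add x y hx hy => simp only [TensorProduct.add_tmul, map_add, hx, hy]
    | tmul a b => simp

variable {q : B →ₗ[O] A} {Δ : B →ₗ[O] B ⊗[O] B} {Δ' : A →ₗ[F] A ⊗[F] A}

lemma tmap_leftComul (hΔ : ∀ b, tmap F q q (Δ b) = Δ' (q b)) (r : M →ₗ[O] M') (x : B ⊗[O] M) :
    tmap F q (tmap F q r) (leftComul Δ M x) = leftComul Δ' M' (tmap F q r x) := by
  simp only [leftComul, LinearMap.comp_apply, LinearEquiv.coe_coe, tmap_assoc,
    tmap_rTensor r hΔ]

lemma tmap_cobar₂ (hΔ : ∀ b, tmap F q q (Δ b) = Δ' (q b)) {η : B →ₗ[O] B ⊗[O] B}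
    {η' : A →ₗ[F] A ⊗[F] A} (hη : ∀ b, tmap F q q (η b) = η' (q b)) (b : B) :
    tmap F q (tmap F q q) (cobar₂ Δ η b) = cobar₂ Δ' η' (q b) := by
  simp only [cobar₂, LinearMap.add_apply, LinearMap.sub_apply, LinearMap.comp_apply, map_add,
    map_sub, tmap_lTensor q hη, tmap_rTensor q hη, tmap_lTensor q hΔ, tmap_leftComul hΔ, hΔ, hη,
    tmap_assoc, LinearEquiv.coe_coe]

lemma tmap_assoc₃ (x : (B ⊗[O] (B ⊗[O] B)) ⊗[O] B) :
    tmap F q (tmap F q (tmap F q q)) (assoc₃ O B x) =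
      assoc₃ F A (tmap F (tmap F q (tmap F q q)) q x) := by
  simp only [assoc₃, LinearMap.comp_apply, LinearEquiv.coe_coe]
  rw [tmap_lTensor (r := tmap F (tmap F q q) q) (g' := (TensorProduct.assoc F A A A).toLinearMap) q
    (fun m => tmap_assoc q q q m), tmap_assoc]

lemma tmap_cobar₃ (hΔ : ∀ b, tmap F q q (Δ b) = Δ' (q b)) {θ : B →ₗ[O] B ⊗[O] (B ⊗[O] B)}
    {θ' : A →ₗ[F] A ⊗[F] (A ⊗[F] A)} (hθ : ∀ b, tmap F q (tmap F q q) (θ b) = θ' (q b)) (b : B) :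
    tmap F q (tmap F q (tmap F q q)) (cobar₃ Δ θ b) = cobar₃ Δ' θ' (q b) := by
  simp only [cobar₃, LinearMap.add_apply, LinearMap.sub_apply, LinearMap.comp_apply, map_add,
    map_sub, tmap_lTensor q hθ, tmap_rTensor q hθ, tmap_leftComul hΔ, hΔ, hθ,
    tmap_assoc₃, tmap_lTensor q (tmap_leftComul hΔ q),
    tmap_lTensor q (fun m => tmap_lTensor q hΔ m)]

end Naturality

section TensorAlgebra

variable {O F : Type*} [CommRing O] [CommRing F] [Algebra O F]
  {X Y X' Y' : Type*} [Ring X] [Algebra O X] [Ring Y] [Algebra O Y]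
  [Ring X'] [Algebra O X'] [Algebra F X'] [IsScalarTower O F X']
  [Ring Y'] [Algebra O Y'] [Algebra F Y'] [IsScalarTower O F Y']

variable (F) in
/-- The algebra homomorphism `X ⊗ Y → X' ⊗ Y'`, `x ⊗ y ↦ f x ⊗ g y`. -/
noncomputable def tmapAlg (f : X →ₐ[O] X') (g : Y →ₐ[O] Y') : X ⊗[O] Y →ₐ[O] X' ⊗[F] Y' :=
  (Algebra.TensorProduct.mapOfCompatibleSMul F O O X' Y').comp (Algebra.TensorProduct.map f g)

lemma tmapAlg_apply (f : X →ₐ[O] X') (g : Y →ₐ[O] Y') (x : X ⊗[O] Y) :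
    tmapAlg F f g x = tmap F f.toLinearMap g.toLinearMap x := rfl

lemma tmapAlg_toLinearMap (f : X →ₐ[O] X') (g : Y →ₐ[O] Y') :
    (tmapAlg F f g).toLinearMap = tmap F f.toLinearMap g.toLinearMap := rfl

end TensorAlgebra

/-! ### Perturbations of algebra homomorphisms -/

section Perturbation

variable {O B M : Type*} [CommRing O] [Ring B] [Algebra O B] [Ring M] [Algebra O M]

/-- If two algebra homomorphisms differ by `c • θ` then `θ` is a derivation along them. -/
lemma derivation_of_sub_eq_smul [IsDomain O] [Module.Free O M] {c : O} (hc : c ≠ 0)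
    (f g : B →ₐ[O] M) (θ : B → M) (h : ∀ b, f b - g b = c • θ b) (a b : B) :
    θ (a * b) = f a * θ b + θ a * g b := by
  refine smul_right_injective M hc ?_
  change c • θ (a * b) = c • (f a * θ b + θ a * g b)
  rw [smul_add, ← mul_smul_comm, ← smul_mul_assoc, ← h, ← h, ← h, map_mul, map_mul]
  noncomm_ring

/-- Conjugation by a unit of the form `1 + c j` changes an algebra homomorphism by `c` times an
inner derivation, up to terms of order `c ^ 2`. -/
lemma exists_conj_eq_add (f : B →ₐ[O] M) (j : M) (c : O) (hu : IsUnit (1 + c • j)) :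
    ∃ (f' : B →ₐ[O] M) (ζ : B →ₗ[O] M),
      f'.toLinearMap = f.toLinearMap + c • innerDer f j + (c * c) • ζ := by
  obtain ⟨u, hu⟩ := hu
  let conj : M →ₐ[O] M := AlgHom.ofLinearMap
    (LinearMap.mulLeft O (u : M) ∘ₗ LinearMap.mulRight O ((u⁻¹ : Mˣ) : M)) (by simp)
    (fun x y => by simp [mul_assoc])
  refine ⟨conj.comp f, -(LinearMap.mulRight O (j * ((u⁻¹ : Mˣ) : M)) ∘ₗ innerDer f j),
    LinearMap.ext fun b => ?_⟩
  have h₁ : (u : M) * f b = f b * u + c • innerDer f j b := by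
    rw [hu, innerDer_apply, add_mul, mul_add, smul_mul_assoc, mul_smul_comm, smul_sub]
    simp
  have h₂ : ((u⁻¹ : Mˣ) : M) = 1 - c • (j * ((u⁻¹ : Mˣ) : M)) := by
    have : (u : M) * ((u⁻¹ : Mˣ) : M) = 1 := Units.mul_inv u
    rw [hu, add_mul, one_mul, smul_mul_assoc] at this
    exact eq_sub_of_add_eq this
  have h₃ : c • innerDer f j b * ((u⁻¹ : Mˣ) : M) =
      c • innerDer f j b - (c * c) • (innerDer f j b * (j * ((u⁻¹ : Mˣ) : M))) := by
    conv_lhs => rw [h₂]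
    rw [mul_sub, mul_one, mul_smul_comm, smul_mul_assoc, smul_smul]
  have h₄ : conj.comp f b = (u : M) * f b * ((u⁻¹ : Mˣ) : M) := by simp [conj, mul_assoc]
  rw [AlgHom.toLinearMap_apply, h₄, h₁, add_mul, h₃, mul_assoc, Units.mul_inv, mul_one]
  simp only [LinearMap.add_apply, LinearMap.smul_apply, LinearMap.neg_apply,
    LinearMap.comp_apply, LinearMap.mulRight_apply, AlgHom.toLinearMap_apply, smul_neg]
  abel

/-- The homomorphism `(id ⊗ Δ) Δ`. -/
noncomputable def comulRight (Δ : B →ₐ[O] B ⊗[O] B) : B →ₐ[O] B ⊗[O] (B ⊗[O] B) :=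
  (Algebra.TensorProduct.map (AlgHom.id O B) Δ).comp Δ

/-- The homomorphism `(Δ ⊗ id) Δ`. -/
noncomputable def comulLeft (Δ : B →ₐ[O] B ⊗[O] B) : B →ₐ[O] B ⊗[O] (B ⊗[O] B) :=
  (Algebra.TensorProduct.assoc O O O B B B).toAlgHom.comp
    ((Algebra.TensorProduct.map Δ (AlgHom.id O B)).comp Δ)

lemma comulRight_apply (Δ : B →ₐ[O] B ⊗[O] B) (b : B) :
    comulRight Δ b = Δ.toLinearMap.lTensor B (Δ b) := rfl

lemma comulLeft_apply (Δ : B →ₐ[O] B ⊗[O] B) (b : B) :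
    comulLeft Δ b = leftComul Δ.toLinearMap B (Δ b) := rfl

end Perturbation

/-! ### Existence of a coassociative lift of the comultiplication -/

section Existence

open Coalgebra

variable {O k : Type*} [CommRing O] [IsDomain O] [Field k] [Algebra O k] {ϖ : O}
  {B A : Type*} [Ring B] [Algebra O B] [Module.Free O B] [Module.Finite O B]
  [Ring A] [HopfAlgebra k A] [Algebra O A] [IsScalarTower O k A] [Module.Finite k A]

namespace IsResidueMap

lemma exists_smul_eq_pow_smul (h : IsResidueMap k ϖ) (m : ℕ)
    {X X' : Type*} [AddCommGroup X] [Module O X] [Module.Free O X] [AddCommGroup X'] [Module O X']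
    [Module k X'] [IsScalarTower O k X'] {r : X →ₗ[O] X'} (hr : IsBaseChange k r)
    (τ : B →ₗ[O] X) (hτ : ∀ b, r (τ b) = 0) :
    ∃ θ : B →ₗ[O] X, ϖ ^ m • τ = ϖ ^ (m + 1) • θ :=
  h.exists_eq_pow_smul (m + 1) _ fun b => h.exists_pow_succ hr m rfl (hτ b)

lemma base_pow_succ_smul (h : IsResidueMap k ϖ) (m : ℕ) {X X' : Type*} [AddCommGroup X]
    [Module O X] [AddCommGroup X'] [Module O X'] [Module k X'] [IsScalarTower O k X']
    {r : X →ₗ[O] X'} (x : X) : r (ϖ ^ (m + 1) • x) = 0 := by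
  rw [pow_succ', mul_smul, map_smul, h.smul_eq_zero]

/-- A comultiplication lifts to a coassociative one. The obstruction in each step is a derivation
`A → A ⊗ A ⊗ A` along the iterated comultiplication that is a cobar cocycle, hence the coboundary
of an inner derivation, and it is removed by a conjugation in `B ⊗ B`. -/
theorem exists_coassoc_lift (h : IsResidueMap k ϖ) {q : B →ₐ[O] A}
    (hq : IsBaseChange k q.toLinearMap) {e : A ⊗[k] A} (he : IsSepIdempotent e) {Λ : A}
    {l : A →ₗ[k] k} (hi : IsIntegralPair Λ l) :
    ∃ Δ : B →ₐ[O] B ⊗[O] B, (∀ b, tmapAlg k q q (Δ b) = comul (q b)) ∧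
      coassocDefect Δ.toLinearMap = 0 := by
  have hqs : Function.Surjective q.toLinearMap := h.base_surjective hq
  have hq₂ : IsBaseChange k (tmapAlg k q q).toLinearMap := isBaseChange_tmap hq hq
  have hq₃ : IsBaseChange k (tmap k q.toLinearMap (tmap k q.toLinearMap q.toLinearMap)) :=
    isBaseChange_tmap hq hq₂
  set q₁ : B →ₗ[O] A := q.toLinearMap with hq₁
  have hmul₁ : ∀ a b, q₁ (a * b) = q₁ a * q₁ b := map_mul q
  -- The approximate solutions of order `m` are the homomorphisms lifting the comultiplication that
  -- are coassociative modulo `ϖ ^ (m + 1)`.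
  let P : ℕ → (B →ₗ[O] B ⊗[O] B) → Prop := fun m D =>
    (∃ Δ : B →ₐ[O] B ⊗[O] B, D = Δ.toLinearMap) ∧ (∀ b, tmap k q₁ q₁ (D b) = comul (q₁ b)) ∧
      ∃ θ, coassocDefect D = ϖ ^ (m + 1) • θ
  have hdefect : ∀ D : B →ₗ[O] B ⊗[O] B, (∀ b, tmap k q₁ q₁ (D b) = comul (q₁ b)) → ∀ b,
      tmap k q₁ (tmap k q₁ q₁) (coassocDefect D b) = 0 := fun D hD b => by
    simp only [coassocDefect, LinearMap.sub_apply, LinearMap.comp_apply, map_sub]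
    rw [tmap_lTensor q₁ hD, tmap_leftComul hD, hD]
    exact sub_eq_zero.2 (leftComul_comul _).symm
  obtain ⟨Δ₀, hΔ₀⟩ := h.exists_algHom_lift hq hq₂ he (Bialgebra.comulAlgHom k A)
  have h₀ : P 0 Δ₀.toLinearMap := by
    refine ⟨⟨Δ₀, rfl⟩, hΔ₀, ?_⟩
    obtain ⟨θ, hθ⟩ := h.exists_smul_eq_pow_smul 0 hq₃ _ (hdefect Δ₀.toLinearMap hΔ₀)
    exact ⟨θ, by rw [← hθ, pow_zero, one_smul]⟩
  have step : ∀ m D, P m D → ∃ y, P (m + 1) (D + ϖ ^ (m + 1) • y) := by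
    rintro m - ⟨⟨Δ, rfl⟩, hΔ, θ, hθ⟩
    have hc : ϖ ^ (m + 1) ≠ 0 := pow_ne_zero _ h.ne_zero
    let θ' : A →ₗ[k] A ⊗[k] (A ⊗[k] A) := hq.lift (tmap k q₁ (tmap k q₁ q₁) ∘ₗ θ)
    have hθ' : ∀ b, tmap k q₁ (tmap k q₁ q₁) (θ b) = θ' (q₁ b) := fun b =>
      (hq.lift_eq (tmap k q₁ (tmap k q₁ q₁) ∘ₗ θ) b).symm
    have hmul : ∀ x y, tmap k q₁ (tmap k q₁ q₁) (x * y) =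
        tmap k q₁ (tmap k q₁ q₁) x * tmap k q₁ (tmap k q₁ q₁) y :=
      map_mul (tmapAlg k q (tmapAlg k q q))
    -- As a difference of the homomorphisms `(id ⊗ Δ) Δ` and `(Δ ⊗ id) Δ`, the defect reduces to a
    -- derivation, and by the pentagon it is a cobar cocycle.
    obtain ⟨j, hj⟩ := hi.exists_eq_cobar₂ he θ' (fun a b => by
      obtain ⟨a, rfl⟩ := hqs a
      obtain ⟨b, rfl⟩ := hqs b
      rw [← hmul₁, ← hθ', ← hθ', ← hθ', derivation_of_sub_eq_smul hc (comulRight Δ) (comulLeft Δ)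
        θ (fun b => LinearMap.congr_fun hθ b), map_add, hmul, hmul, comulRight_apply,
        comulLeft_apply, tmap_lTensor q₁ hΔ, tmap_leftComul hΔ, ← AlgHom.toLinearMap_apply Δ,
        ← AlgHom.toLinearMap_apply Δ, hΔ, hΔ, leftComul_comul]) (by
      refine LinearMap.ext fun a => ?_
      obtain ⟨a, rfl⟩ := hqs a
      have h0 : cobar₃ Δ.toLinearMap θ = 0 := by
        have h1 := cobar₃_coassocDefect Δ.toLinearMap
        rw [hθ] at h1
        refine LinearMap.ext fun b => h.pow_smul_injective (m + 1) ?_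
        have h2 := LinearMap.congr_fun h1 b
        simp only [cobar₃, LinearMap.lTensor_smul, LinearMap.rTensor_smul, LinearMap.add_apply,
          LinearMap.sub_apply, LinearMap.comp_apply, LinearMap.smul_apply, map_smul,
          ← smul_sub, ← smul_add] at h2 ⊢
        rw [h2]
        simp
      rw [LinearMap.zero_apply, ← tmap_cobar₃ (q := q₁) hΔ hθ', h0, LinearMap.zero_apply,
        map_zero])
    -- Conjugation by `1 + ϖ ^ (m + 1) j'`, where `j'` lifts `-j`, changes the defect by
    -- `-ϖ ^ (m + 1) θ` up to terms divisible by `ϖ ^ (m + 2)`.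
    obtain ⟨j', hj'⟩ := h.base_surjective hq₂ (-j)
    obtain ⟨Δ', ζ, hΔ'⟩ := exists_conj_eq_add Δ j' (ϖ ^ (m + 1)) (by
      rw [pow_succ', mul_smul]
      exact h.isUnit_one_add _)
    have hη : ∀ b, tmap k q₁ q₁ (innerDer Δ j' b) =
        innerDer (Bialgebra.comulAlgHom k A) (-j) (q₁ b) := fun b => by
      have : _ = comul (q b) := hΔ b
      rw [innerDer_apply, innerDer_apply, ← hj', ← tmapAlg_toLinearMap]
      simp only [AlgHom.toLinearMap_apply, map_sub, map_mul]
      rw [← tmapAlg_toLinearMap, AlgHom.toLinearMap_apply, AlgHom.toLinearMap_apply] at this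
      rw [this]
      rfl
    refine ⟨innerDer Δ j' + ϖ ^ (m + 1) • ζ, ⟨Δ', ?_⟩, fun b => ?_, ?_⟩
    · rw [hΔ', smul_add, smul_smul, add_assoc]
    · rw [LinearMap.add_apply, map_add, hΔ, LinearMap.smul_apply,
        h.base_pow_succ_smul, add_zero]
    · obtain ⟨ρ, hρ⟩ := exists_coassocDefect_add Δ.toLinearMap (innerDer Δ j') ζ (ϖ ^ (m + 1))
      rw [smul_add, smul_smul, ← add_assoc, hρ, hθ, mul_smul, ← smul_add, ← smul_add]
      refine h.exists_smul_eq_pow_smul (m + 1) hq₃ _ fun b => ?_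
      simp only [LinearMap.add_apply, map_add, hθ']
      rw [tmap_cobar₂ hΔ hη, LinearMap.smul_apply, h.base_pow_succ_smul, add_zero, hj]
      have : innerDer (Bialgebra.comulAlgHom k A) (-j) =
          -innerDer (Bialgebra.comulAlgHom k A) j := by
        ext; simp; abel
      rw [this]
      simp only [cobar₂, LinearMap.lTensor_neg, LinearMap.rTensor_neg, LinearMap.add_apply,
        LinearMap.sub_apply, LinearMap.comp_apply, LinearMap.neg_apply, map_neg]
      abel
  obtain ⟨L, hL⟩ := h.exists_limit P h₀ step
  obtain ⟨Δ, hΔ⟩ := h.exists_algHom_of_limit L fun m => by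
    obtain ⟨y, ⟨f, hf⟩, -⟩ := hL m
    exact ⟨f, y, hf⟩
  refine ⟨Δ, fun b => ?_, ?_⟩
  · obtain ⟨y, -, hy, -⟩ := hL 0
    have := hy b
    rw [LinearMap.add_apply, map_add, LinearMap.smul_apply, h.base_pow_succ_smul, add_zero,
      ← hΔ] at this
    exact this
  · rw [hΔ]
    refine LinearMap.ext fun b => h.eq_zero_of_forall_pow fun m => ?_
    obtain ⟨y, -, -, θ, hθ⟩ := hL m
    obtain ⟨ρ, hρ⟩ := exists_coassocDefect_add L y 0 (ϖ ^ (m + 1))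
    rw [smul_zero, add_zero, hθ] at hρ
    have h₁ := LinearMap.congr_fun hρ b
    simp only [LinearMap.add_apply, LinearMap.smul_apply] at h₁
    refine ⟨ϖ • (θ b - cobar₂ L y b - ϖ ^ (m + 1) • ρ b), ?_⟩
    rw [smul_smul, ← pow_succ, smul_sub, smul_sub, h₁, smul_smul]
    abel

end IsResidueMap

end Existence

/-! ### Counit and antipode of the lift -/

section Translate

variable {R B : Type*} [CommRing R] [AddCommGroup B] [Module R B]

/-- The contraction `C ⊗ V → V`, `c ⊗ v ↦ f(c) v`, with a linear form `f`. -/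
noncomputable def contractLeft {C : Type*} [AddCommGroup C] [Module R C] (V : Type*)
    [AddCommGroup V] [Module R V] (f : C →ₗ[R] R) : C ⊗[R] V →ₗ[R] V :=
  (TensorProduct.lid R V).toLinearMap ∘ₗ f.rTensor V

@[simp] lemma contractLeft_tmul {C V : Type*} [AddCommGroup C] [Module R C]
    [AddCommGroup V] [Module R V] (f : C →ₗ[R] R) (c : C) (v : V) :
    contractLeft V f (c ⊗ₜ v) = f c • v := by simp [contractLeft]

lemma apply_contractLeft (f g : B →ₗ[R] R) (t : B ⊗[R] B) :
    g (contractLeft B f t) = f (contract B g t) := by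
  induction t with
  | zero => simp
  | add x y hx hy => simp only [map_add, hx, hy]
  | tmul a b => simp [mul_comm]

variable {Δ : B →ₗ[R] B ⊗[R] B}

/-- For coassociative `Δ`, the translations `b ↦ ∑ f(b₂) b₁` compose like the convolution product of
linear forms. -/
lemma contract_comul_contract (hΔ : coassocDefect Δ = 0) (f g : B →ₗ[R] R) (b : B) :
    contract B f (Δ (contract B g (Δ b))) = contract B (f ∘ₗ contract B g ∘ₗ Δ) (Δ b) := by
  let Ψ : B ⊗[R] (B ⊗[R] B) →ₗ[R] B :=
    contract B (LinearMap.mul' R R ∘ₗ TensorProduct.map f g)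
  have h₁ : ∀ t : B ⊗[R] B, contract B f (Δ (contract B g t)) = Ψ (leftComul Δ B t) := fun t => by
    induction t with
    | zero => simp
    | add x y hx hy => simp only [map_add, hx, hy]
    | tmul a b =>
      simp only [leftComul, contract_tmul, map_smul, LinearMap.comp_apply, LinearMap.rTensor_tmul,
        LinearEquiv.coe_coe]
      induction Δ a with
      | zero => simp
      | add x y hx hy => simp only [map_add, TensorProduct.add_tmul, smul_add, hx, hy]
      | tmul c d => simp [Ψ, smul_smul, mul_comm]
  have h₂ : ∀ t : B ⊗[R] B, contract B (f ∘ₗ contract B g ∘ₗ Δ) t = Ψ (Δ.lTensor B t) := fun t => by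
    induction t with
    | zero => simp
    | add x y hx hy => simp only [map_add, hx, hy]
    | tmul a b =>
      simp only [contract_tmul, LinearMap.comp_apply, LinearMap.lTensor_tmul]
      induction Δ b with
      | zero => simp
      | add x y hx hy => simp only [map_add, TensorProduct.tmul_add, add_smul, hx, hy]
      | tmul c d => simp [Ψ, mul_comm]
  rw [h₁, h₂]
  exact congrArg Ψ (sub_eq_zero.1 (LinearMap.congr_fun hΔ b)).symm

lemma contractLeft_comul_contractLeft (hΔ : coassocDefect Δ = 0) (f g : B →ₗ[R] R) (b : B) :
    contractLeft B f (Δ (contractLeft B g (Δ b))) =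
      contractLeft B (f ∘ₗ contractLeft B g ∘ₗ Δ) (Δ b) := by
  let Ψ : B ⊗[R] (B ⊗[R] B) →ₗ[R] B := contractLeft B f ∘ₗ contractLeft (B ⊗[R] B) g
  have h₁ : ∀ t : B ⊗[R] B, contractLeft B f (Δ (contractLeft B g t)) = Ψ (Δ.lTensor B t) :=
    fun t => by
    induction t with
    | zero => simp
    | add x y hx hy => simp only [map_add, hx, hy]
    | tmul a b => simp [Ψ]
  have h₂ : ∀ t : B ⊗[R] B, contractLeft B (f ∘ₗ contractLeft B g ∘ₗ Δ) t =
      Ψ (leftComul Δ B t) := fun t => by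
    induction t with
    | zero => simp
    | add x y hx hy => simp only [map_add, hx, hy]
    | tmul a b =>
      simp only [leftComul, contractLeft_tmul, LinearMap.comp_apply, LinearMap.rTensor_tmul,
        LinearEquiv.coe_coe]
      induction Δ a with
      | zero => simp
      | add x y hx hy => simp only [map_add, TensorProduct.add_tmul, add_smul, hx, hy]
      | tmul c d => simp [Ψ, mul_smul]
  rw [h₁, h₂]
  exact congrArg Ψ (sub_eq_zero.1 (LinearMap.congr_fun hΔ b))

end Translate

section Counit

open Coalgebra HopfAlgebra

variable {O k : Type*} [CommRing O] [IsDomain O] [Field k] [Algebra O k] {ϖ : O}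
  {B A : Type*} [Ring B] [Algebra O B] [Module.Free O B] [Module.Finite O B]
  [Ring A] [HopfAlgebra k A] [Algebra O A] [IsScalarTower O k A]

namespace IsResidueMap

/-- A coassociative lift of the comultiplication has a counit. For a homomorphism `u` lifting the
counit, the translation `b ↦ ∑ u(b₂) b₁` reduces to the identity, so it is bijective, and composing
`u` with its inverse gives the counit. -/
theorem exists_counit (h : IsResidueMap k ϖ) {q : B →ₐ[O] A}
    (hq : IsBaseChange k q.toLinearMap) {e : A ⊗[k] A} (he : IsSepIdempotent e)
    (Δ : B →ₐ[O] B ⊗[O] B) (hΔq : ∀ b, tmapAlg k q q (Δ b) = comul (q b))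
    (hΔ : coassocDefect Δ.toLinearMap = 0) :
    ∃ ε : B →ₐ[O] O, (∀ b, algebraMap O k (ε b) = counit (R := k) (q b)) ∧
      (∀ b, contract B ε.toLinearMap (Δ b) = b) ∧ ∀ b, contractLeft B ε.toLinearMap (Δ b) = b := by
  obtain ⟨u, hu⟩ := h.exists_algHom_lift (C := O) (D := k) (r := Algebra.ofId O k) hq
    (IsBaseChange.linearMap O k) he (Bialgebra.counitAlgHom k A)
  have hu' : ∀ b, algebraMap O k (u b) = counit (R := k) (q b) := hu
  let R : B →ₐ[O] B := (Algebra.TensorProduct.rid O O B).toAlgHom.comp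
    ((Algebra.TensorProduct.map (AlgHom.id O B) u).comp Δ)
  let L : B →ₐ[O] B := (Algebra.TensorProduct.lid O B).toAlgHom.comp
    ((Algebra.TensorProduct.map u (AlgHom.id O B)).comp Δ)
  have hR : ∀ b, R b = contract B u.toLinearMap (Δ b) := fun b => rfl
  have hL : ∀ b, L b = contractLeft B u.toLinearMap (Δ b) := fun b => rfl
  have hqR : ∀ b, q (R b) = q b := fun b => by
    have : ∀ t : B ⊗[O] B, q (contract B u.toLinearMap t) =
        contract A (counit (R := k)) (tmap k q.toLinearMap q.toLinearMap t) := fun t => by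
      induction t with
      | zero => simp
      | add x y hx hy => simp only [map_add, hx, hy]
      | tmul a b => simp [← hu']
    rw [hR, this, ← tmapAlg_apply, hΔq]
    simp [contract]
  have hqL : ∀ b, q (L b) = q b := fun b => by
    have : ∀ t : B ⊗[O] B, q (contractLeft B u.toLinearMap t) =
        contractLeft A (counit (R := k)) (tmap k q.toLinearMap q.toLinearMap t) := fun t => by
      induction t with
      | zero => simp
      | add x y hx hy => simp only [map_add, hx, hy]
      | tmul a b => simp [← hu']
    rw [hL, this, ← tmapAlg_apply, hΔq]
    simp [contractLeft]
  let R' := AlgEquiv.ofBijective R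
    (h.bijective_of_base hq hq R.toLinearMap id Function.bijective_id hqR)
  let L' := AlgEquiv.ofBijective L
    (h.bijective_of_base hq hq L.toLinearMap id Function.bijective_id hqL)
  -- The form `ε` is a right counit and `ε'` is a left counit. Both agree with `(ε' ⊗ ε) Δ`.
  let ε : B →ₐ[O] O := u.comp R'.symm.toAlgHom
  let ε' : B →ₐ[O] O := u.comp L'.symm.toAlgHom
  have hεR : ∀ b, ε (R b) = u b := fun b => congrArg u (R'.symm_apply_apply b)
  have hεL : ∀ b, ε' (L b) = u b := fun b => congrArg u (L'.symm_apply_apply b)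
  have h₁ : ∀ b, contract B ε.toLinearMap (Δ b) = b := fun b => by
    obtain ⟨b, rfl⟩ := R'.surjective b
    change contract B ε.toLinearMap (Δ (R b)) = R b
    rw [hR]
    refine (contract_comul_contract hΔ _ _ b).trans ?_
    rw [show ε.toLinearMap ∘ₗ contract B u.toLinearMap ∘ₗ Δ.toLinearMap = u.toLinearMap from
      LinearMap.ext hεR]
    rfl
  have h₂ : ∀ b, contractLeft B ε'.toLinearMap (Δ b) = b := fun b => by
    obtain ⟨b, rfl⟩ := L'.surjective b
    change contractLeft B ε'.toLinearMap (Δ (L b)) = L b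
    rw [hL]
    refine (contractLeft_comul_contractLeft hΔ _ _ b).trans ?_
    rw [show ε'.toLinearMap ∘ₗ contractLeft B u.toLinearMap ∘ₗ Δ.toLinearMap = u.toLinearMap from
      LinearMap.ext hεL]
    rfl
  have h₃ : ε'.toLinearMap = ε.toLinearMap := LinearMap.ext fun b => by
    have := apply_contractLeft ε'.toLinearMap ε.toLinearMap (Δ b)
    rw [h₁, h₂] at this
    exact this.symm
  refine ⟨ε, fun b => ?_, h₁, fun b => by rw [← h₃, h₂]⟩
  obtain ⟨b, rfl⟩ := R'.surjective b
  change algebraMap O k (ε (R b)) = counit (R := k) (q (R b))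
  rw [hεR, hqR, hu']

/-- A lift of a Hopf algebra as a bialgebra has an antipode: the identity is invertible for the
convolution product because it is so after reduction. A linear lift `S` of the antipode is an
inverse modulo `ϖ`, and convolution units can be tested modulo `ϖ`. -/
theorem exists_antipode {B : Type*} [Ring B] [Bialgebra O B] [Module.Free O B] [Module.Finite O B]
    (h : IsResidueMap k ϖ) {q : B →ₐ[O] A} (hq : IsBaseChange k q.toLinearMap)
    (hΔ : ∀ b, tmapAlg k q q (comul b) = comul (q b))
    (hε : ∀ b, algebraMap O k (counit b) = counit (R := k) (q b)) :
    ∃ S : B →ₗ[O] B, LinearMap.mul' O B ∘ₗ S.rTensor B ∘ₗ comul = Algebra.linearMap O B ∘ₗ counit ∧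
      LinearMap.mul' O B ∘ₗ S.lTensor B ∘ₗ comul = Algebra.linearMap O B ∘ₗ counit := by
  obtain ⟨S, hS⟩ := h.exists_lift hq ((antipode k (A := A)).restrictScalars O ∘ₗ q.toLinearMap)
  have hS' : ∀ b, q (S b) = antipode k (q b) := hS
  have hc : ∀ b, q (algebraMap O B (counit b)) = algebraMap k A (counit (R := k) (q b)) :=
    fun b => by rw [AlgHom.commutes, ← hε, ← IsScalarTower.algebraMap_apply]
  -- A linear map that reduces to the unit `η ε` of the convolution algebra is a convolution unit.
  have key : ∀ g : B →ₗ[O] B, (∀ b, q (g b) = algebraMap k A (counit (R := k) (q b))) →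
      IsUnit (WithConv.toConv g) := fun g hg => by
    obtain ⟨y, hy⟩ := h.exists_eq_pow_smul 1 (g - Algebra.linearMap O B ∘ₗ counit) fun b =>
      h.exists_pow_succ (x := (g - Algebra.linearMap O B ∘ₗ counit : B →ₗ[O] B) b) hq 0
        (by rw [pow_zero, one_smul]) (by
          have : q (g b - algebraMap O B (counit b)) = 0 := by rw [map_sub, hg, hc, sub_self]
          exact this)
    have : WithConv.toConv g = 1 + ϖ • WithConv.toConv y := by
      rw [LinearMap.convOne_def, ← WithConv.toConv_smul, ← WithConv.toConv_add, ← pow_one ϖ, ← hy]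
      congr 1
      abel
    have : Module.Finite O (WithConv (B →ₗ[O] B)) :=
      Module.Finite.equiv (WithConv.linearEquiv O (B →ₗ[O] B)).symm
    rw [‹WithConv.toConv g = _›]
    exact h.isUnit_one_add _
  have h₁ : IsUnit (WithConv.toConv S * WithConv.toConv LinearMap.id) := by
    rw [LinearMap.convMul_def]
    refine key _ fun b => ?_
    have : ∀ t : B ⊗[O] B, q (LinearMap.mul' O B (TensorProduct.map S LinearMap.id t)) =
        LinearMap.mul' k A ((antipode k).rTensor A (tmapAlg k q q t)) := fun t => by
      induction t with
      | zero => simp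
      | add x y hx hy => simp only [map_add, hx, hy]
      | tmul a b => simp [hS', tmapAlg_apply]
    refine (this (comul b)).trans ?_
    rw [hΔ, mul_antipode_rTensor_comul_apply]
  have h₂ : IsUnit (WithConv.toConv LinearMap.id * WithConv.toConv S) := by
    rw [LinearMap.convMul_def]
    refine key _ fun b => ?_
    have : ∀ t : B ⊗[O] B, q (LinearMap.mul' O B (TensorProduct.map LinearMap.id S t)) =
        LinearMap.mul' k A ((antipode k).lTensor A (tmapAlg k q q t)) := fun t => by
      induction t with
      | zero => simp
      | add x y hx hy => simp only [map_add, hx, hy]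
      | tmul a b => simp [hS', tmapAlg_apply]
    refine (this (comul b)).trans ?_
    rw [hΔ, mul_antipode_lTensor_comul_apply]
  obtain ⟨v, hv⟩ := h₁
  obtain ⟨w, hw⟩ := h₂
  have hl : ((v⁻¹ : (WithConv (B →ₗ[O] B))ˣ) : WithConv (B →ₗ[O] B)) * WithConv.toConv S *
      WithConv.toConv LinearMap.id = 1 := by
    rw [mul_assoc, ← hv, Units.inv_mul]
  have hr : WithConv.toConv LinearMap.id *
      (WithConv.toConv S * ((w⁻¹ : (WithConv (B →ₗ[O] B))ˣ) : WithConv (B →ₗ[O] B))) = 1 := by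
    rw [← mul_assoc, ← hw, Units.mul_inv]
  have hlr := left_inv_eq_right_inv hl hr
  rw [← hlr] at hr
  generalize ((v⁻¹ : (WithConv (B →ₗ[O] B))ˣ) : WithConv (B →ₗ[O] B)) * WithConv.toConv S = T
    at hl hr
  exact ⟨T.ofConv, congrArg WithConv.ofConv hl, congrArg WithConv.ofConv hr⟩

end IsResidueMap

end Counit

/-! ### Fibres of a bialgebra -/

section Fiber

open Coalgebra

/-- The map `q : B → H` from a bialgebra over `O` to a bialgebra over the `O`-algebra `F` exhibits
`H` as the base change of `B` to `F`. -/
structure IsFiber {O : Type*} (F : Type*) {B H : Type*} [CommRing O] [CommRing F] [Algebra O F]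
    [Ring B] [Bialgebra O B] [Ring H] [Bialgebra F H] [Algebra O H] [IsScalarTower O F H]
    (q : B →ₐ[O] H) : Prop where
  baseChange : IsBaseChange F q.toLinearMap
  comul_eq : ∀ b, tmapAlg F q q (comul b) = comul (q b)
  counit_eq : ∀ b, algebraMap O F (counit b) = counit (R := F) (q b)

variable {O F B H H' : Type*} [CommRing O] [CommRing F] [Algebra O F]
    [Ring B] [Bialgebra O B] [Ring H] [Bialgebra F H] [Algebra O H] [IsScalarTower O F H]
    [Ring H'] [Bialgebra F H']

/-- The base change `F ⊗ B` is a fibre of `B`. -/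
lemma isFiber_includeRight :
    IsFiber F (Algebra.TensorProduct.includeRight : B →ₐ[O] F ⊗[O] B) where
  baseChange := TensorProduct.isBaseChange O B F
  comul_eq b := by
    rw [tmapAlg_apply, Algebra.TensorProduct.includeRight_apply, TensorProduct.comul_tmul,
      CommSemiring.comul_apply]
    induction comul (R := O) b with
    | zero => simp
    | add x y hx hy => simp only [map_add, TensorProduct.tmul_add, hx, hy]
    | tmul a b => simp
  counit_eq b := by
    simp [Algebra.algebraMap_eq_smul_one]

lemma IsFiber.comp_equiv {q : B →ₐ[O] H} (hq : IsFiber F q) [Algebra O H'] [IsScalarTower O F H']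
    (e : H ≃ₐc[F] H') : IsFiber F (((e : H →ₐ[F] H').restrictScalars O).comp q) where
  baseChange := IsBaseChange.of_equiv (hq.baseChange.equiv.trans (e : H ≃ₗ[F] H')) fun b =>
    congrArg e (by simp [IsBaseChange.equiv_tmul])
  comul_eq b := by
    have : ∀ t : B ⊗[O] B, tmapAlg F (((e : H →ₐ[F] H').restrictScalars O).comp q)
        (((e : H →ₐ[F] H').restrictScalars O).comp q) t =
        TensorProduct.map (e : H →ₗ[F] H') (e : H →ₗ[F] H') (tmapAlg F q q t) := fun t => by
      induction t with
      | zero => simp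
      | add x y hx hy => simp only [map_add, hx, hy]
      | tmul a b => rfl
    rw [this, hq.comul_eq]
    exact CoalgHomClass.map_comp_comul_apply e (q b)
  counit_eq b := by
    rw [hq.counit_eq]
    exact (CoalgHomClass.counit_comp_apply e (q b)).symm

/-- The bialgebra isomorphism `F ⊗ B ≃ H` defined by a fibre `B → H`. -/
lemma IsFiber.nonempty_equiv {q : B →ₐ[O] H} (hq : IsFiber F q) :
    Nonempty ((F ⊗[O] B) ≃ₐc[F] H) := by
  let f : F ⊗[O] B →ₐ[F] H := Algebra.TensorProduct.lift (Algebra.ofId F H) q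
    (fun c b => Algebra.commutes c _)
  have hf : ∀ c b, f (c ⊗ₜ b) = c • q b := fun c b => by
    rw [Algebra.smul_def]
    exact Algebra.TensorProduct.lift_tmul _ _ _ c b
  have hbij : Function.Bijective f := by
    have : f.toLinearMap = hq.baseChange.equiv.toLinearMap := by
      ext b
      simp [hf, IsBaseChange.equiv_tmul]
    have h := hq.baseChange.equiv.bijective
    rwa [← LinearEquiv.coe_toLinearMap, ← this] at h
  refine ⟨BialgEquiv.ofAlgEquiv (AlgEquiv.ofBijective f hbij) ?_ ?_⟩
  · ext b
    simp [hf, ← hq.counit_eq, Algebra.algebraMap_eq_smul_one]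
  · ext b
    have h : ∀ t : B ⊗[O] B, Algebra.TensorProduct.map f f
        (tmapAlg F (Algebra.TensorProduct.includeRight : B →ₐ[O] F ⊗[O] B)
          Algebra.TensorProduct.includeRight t) = tmapAlg F q q t := fun t => by
      induction t with
      | zero => simp
      | add x y hx hy => simp only [map_add, hx, hy]
      | tmul a b => simp [tmapAlg_apply, hf]
    have h' := h (comul b)
    rw [isFiber_includeRight.comul_eq, hq.comul_eq, ← one_smul F (q b), ← hf] at h'
    exact h'

end Fiber

/-! ### Uniqueness of the lift -/

section HomDefect

variable {R B B' : Type*} [CommRing R] [AddCommGroup B] [Module R B] [AddCommGroup B'] [Module R B']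

/-- The failure of a linear map to be compatible with comultiplications. -/
noncomputable def homDefect (Δ : B →ₗ[R] B ⊗[R] B) (Δ' : B' →ₗ[R] B' ⊗[R] B') (f : B →ₗ[R] B') :
    B →ₗ[R] B' ⊗[R] B' :=
  Δ' ∘ₗ f - TensorProduct.map f f ∘ₗ Δ

/-- The cobar differential of a map `θ : B → B' ⊗ B'`, relative to a map `f : B → B'` that need
not respect the comultiplications. -/
noncomputable def cobarAlong (Δ : B →ₗ[R] B ⊗[R] B) (Δ' : B' →ₗ[R] B' ⊗[R] B') (f : B →ₗ[R] B')
    (θ : B →ₗ[R] B' ⊗[R] B') : B →ₗ[R] B' ⊗[R] (B' ⊗[R] B') :=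
  TensorProduct.map f θ ∘ₗ Δ - leftComul Δ' B' ∘ₗ θ + Δ'.lTensor B' ∘ₗ θ -
    (TensorProduct.assoc R B' B' B').toLinearMap ∘ₗ TensorProduct.map θ f ∘ₗ Δ

/-- The failure of a map between coalgebras to be compatible with comultiplications is a cocycle. -/
lemma cobarAlong_homDefect {Δ : B →ₗ[R] B ⊗[R] B} {Δ' : B' →ₗ[R] B' ⊗[R] B'}
    (hΔ : coassocDefect Δ = 0) (hΔ' : coassocDefect Δ' = 0) (f : B →ₗ[R] B') :
    cobarAlong Δ Δ' f (homDefect Δ Δ' f) = 0 := by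
  have e₁ : ∀ t : B ⊗[R] B, TensorProduct.map f (homDefect Δ Δ' f) t =
      Δ'.lTensor B' (TensorProduct.map f f t) -
        TensorProduct.map f (TensorProduct.map f f) (Δ.lTensor B t) := fun t => by
    induction t with
    | zero => simp
    | add x y hx hy => simp only [map_add, hx, hy]; abel
    | tmul a b => simp [homDefect, TensorProduct.tmul_sub]
  have e₂ : ∀ t : B ⊗[R] B, TensorProduct.assoc R B' B' B'
      (TensorProduct.map (homDefect Δ Δ' f) f t) =
      leftComul Δ' B' (TensorProduct.map f f t) -
        TensorProduct.map f (TensorProduct.map f f) (leftComul Δ B t) := fun t => by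
    induction t with
    | zero => simp
    | add x y hx hy => simp only [map_add, hx, hy]; abel
    | tmul a b =>
      have : ∀ y : B ⊗[R] B, TensorProduct.assoc R B' B' B' (TensorProduct.map f f y ⊗ₜ f b) =
          TensorProduct.map f (TensorProduct.map f f) (TensorProduct.assoc R B B B (y ⊗ₜ b)) :=
        fun y => by
        induction y with
        | zero => simp
        | add x y hx hy => simp only [map_add, TensorProduct.add_tmul, hx, hy]
        | tmul c d => simp
      simp [homDefect, TensorProduct.sub_tmul, leftComul, this]
  ext b
  have h := sub_eq_zero.1 (LinearMap.congr_fun hΔ b)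
  have h' := sub_eq_zero.1 (LinearMap.congr_fun hΔ' (f b))
  simp only [LinearMap.comp_apply] at h h'
  simp only [cobarAlong, LinearMap.add_apply, LinearMap.sub_apply, LinearMap.comp_apply,
    LinearEquiv.coe_coe, e₁, e₂, h]
  simp only [homDefect, LinearMap.sub_apply, LinearMap.comp_apply, map_sub, h', LinearMap.zero_apply]
  abel

lemma homDefect_add_smul (Δ : B →ₗ[R] B ⊗[R] B) (Δ' : B' →ₗ[R] B' ⊗[R] B') (f y : B →ₗ[R] B')
    (c : R) (b : B) : homDefect Δ Δ' (f + c • y) b = homDefect Δ Δ' f b +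
      c • (Δ' (y b) - TensorProduct.map f y (Δ b) - TensorProduct.map y f (Δ b) -
        c • TensorProduct.map y y (Δ b)) := by
  simp only [homDefect, LinearMap.sub_apply, LinearMap.comp_apply, LinearMap.add_apply,
    LinearMap.smul_apply, map_add, map_smul, TensorProduct.map_add_left,
    TensorProduct.map_add_right, TensorProduct.map_smul_left, TensorProduct.map_smul_right,
    smul_sub, smul_add]
  abel

end HomDefect

section MapNaturality

variable {O F B B' A A' M M' : Type*} [CommRing O] [CommRing F] [Algebra O F]
  [AddCommGroup B] [Module O B] [AddCommGroup B'] [Module O B']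
  [AddCommGroup A] [Module F A] [Module O A] [IsScalarTower O F A]
  [AddCommGroup M] [Module O M] [AddCommGroup M'] [Module F M'] [Module O M'] [IsScalarTower O F M']
  {f : B →ₗ[O] B'} {q : B →ₗ[O] A} {r : B' →ₗ[O] A} {g : B →ₗ[O] M} {s : M →ₗ[O] M'}
  {g' : A →ₗ[F] M'}

lemma tmap_map_left (hf : ∀ b, r (f b) = q b) (hg : ∀ b, s (g b) = g' (q b)) (t : B ⊗[O] B) :
    tmap F r s (TensorProduct.map f g t) = g'.lTensor A (tmap F q q t) := by
  induction t with
  | zero => simp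
  | add x y hx hy => simp only [map_add, hx, hy]
  | tmul a b => simp [hf, hg]

lemma tmap_map_right (hf : ∀ b, r (f b) = q b) (hg : ∀ b, s (g b) = g' (q b)) (t : B ⊗[O] B) :
    tmap F s r (TensorProduct.map g f t) = g'.rTensor A (tmap F q q t) := by
  induction t with
  | zero => simp
  | add x y hx hy => simp only [map_add, hx, hy]
  | tmul a b => simp [hf, hg]

end MapNaturality

section Uniqueness

open Coalgebra

variable {O k : Type*} [CommRing O] [IsDomain O] [Field k] [Algebra O k] {ϖ : O}
  {B B' A : Type*} [Ring B] [Bialgebra O B] [Module.Free O B] [Module.Finite O B]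
  [Ring B'] [Bialgebra O B'] [Module.Free O B'] [Module.Finite O B']
  [Ring A] [HopfAlgebra k A] [Algebra O A] [IsScalarTower O k A] [Module.Finite k A]

lemma coassocDefect_comul : coassocDefect (comul (R := O) (A := B)) = 0 :=
  LinearMap.ext fun b => sub_eq_zero.2 (coassoc_apply b).symm

namespace IsResidueMap

/-- Two lifts of a semisimple cosemisimple Hopf algebra are isomorphic. They are isomorphic as
algebras, and the obstruction in each step to compatibility with the comultiplications is a
derivation `A → A ⊗ A` along `Δ` that is a cobar cocycle. It is the coboundary of an inner
derivation of `A`, and is removed by a conjugation in `B'`. -/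
theorem nonempty_bialgEquiv (h : IsResidueMap k ϖ) {q : B →ₐ[O] A} (hq : IsFiber k q)
    {q' : B' →ₐ[O] A} (hq' : IsFiber k q') {e : A ⊗[k] A} (he : IsSepIdempotent e) {Λ : A}
    {l : A →ₗ[k] k} (hi : IsIntegralPair Λ l) : Nonempty (B ≃ₐc[O] B') := by
  have hqb := hq.baseChange
  have hqb' := hq'.baseChange
  have hqs : Function.Surjective q.toLinearMap := h.base_surjective hqb
  have hq₂ : IsBaseChange k (tmapAlg k q' q').toLinearMap := isBaseChange_tmap hqb' hqb'
  set q₁ : B →ₗ[O] A := q.toLinearMap with hq₁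
  have hmul₁ : ∀ a b, q₁ (a * b) = q₁ a * q₁ b := map_mul q
  set r₁ : B' →ₗ[O] A := q'.toLinearMap with hr₁
  have hΔ : ∀ b, tmap k q₁ q₁ (comul b) = comul (q₁ b) := hq.comul_eq
  have hΔ' : ∀ b, tmap k r₁ r₁ (comul b) = comul (r₁ b) := hq'.comul_eq
  let D : (B →ₗ[O] B') → (B →ₗ[O] B' ⊗[O] B') := homDefect comul comul
  -- The approximate solutions of order `m` are the homomorphisms reducing to the identity of `A`
  -- that are compatible with the comultiplications modulo `ϖ ^ (m + 1)`.
  let P : ℕ → (B →ₗ[O] B') → Prop := fun m f =>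
    (∃ g : B →ₐ[O] B', f = g.toLinearMap) ∧ (∀ b, r₁ (f b) = q₁ b) ∧
      ∃ θ, D f = ϖ ^ (m + 1) • θ
  have hff : ∀ f : B →ₗ[O] B', (∀ b, r₁ (f b) = q₁ b) → ∀ b,
      tmap k r₁ r₁ (TensorProduct.map f f (comul b)) = comul (q₁ b) := fun f hf b => by
    rw [tmap_map_left (s := r₁) (g := f) (g' := LinearMap.id) hf hf, hΔ, LinearMap.lTensor_id,
      LinearMap.id_apply]
  obtain ⟨f₀, hf₀⟩ := h.exists_algHom_lift hqb hqb' he (AlgHom.id k A)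
  have h₀ : P 0 f₀.toLinearMap := by
    refine ⟨⟨f₀, rfl⟩, hf₀, ?_⟩
    obtain ⟨θ, hθ⟩ := h.exists_smul_eq_pow_smul 0 hq₂ (D f₀.toLinearMap) fun b => by
      have h1 : r₁ (f₀.toLinearMap b) = q₁ b := hf₀ b
      refine (map_sub (tmap k r₁ r₁) _ _).trans (sub_eq_zero.2 ?_)
      refine Eq.trans ?_ (hff f₀.toLinearMap hf₀ b).symm
      rw [← h1]
      exact hΔ' _
    exact ⟨θ, by rw [← hθ, pow_zero, one_smul]⟩
  have step : ∀ m f, P m f → ∃ y, P (m + 1) (f + ϖ ^ (m + 1) • y) := by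
    rintro m - ⟨⟨f, rfl⟩, hf, θ, hθ⟩
    have hc : ϖ ^ (m + 1) ≠ 0 := pow_ne_zero _ h.ne_zero
    let θ' : A →ₗ[k] A ⊗[k] A := hqb.lift (tmap k r₁ r₁ ∘ₗ θ)
    have hθ' : ∀ b, tmap k r₁ r₁ (θ b) = θ' (q₁ b) := fun b =>
      (hqb.lift_eq (tmap k r₁ r₁ ∘ₗ θ) b).symm
    have hmul : ∀ x y, tmap k r₁ r₁ (x * y) = tmap k r₁ r₁ x * tmap k r₁ r₁ y :=
      map_mul (tmapAlg k q' q')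
    -- As a difference of the homomorphisms `Δ f` and `(f ⊗ f) Δ`, the defect reduces to a
    -- derivation, and it is a cobar cocycle because both comultiplications are coassociative.
    obtain ⟨j, hj⟩ := hi.exists_eq_cobar₁ he θ' (fun a b => by
      obtain ⟨a, rfl⟩ := hqs a
      obtain ⟨b, rfl⟩ := hqs b
      rw [← hmul₁, ← hθ', ← hθ', ← hθ', derivation_of_sub_eq_smul hc
        ((Bialgebra.comulAlgHom O B').comp f)
        ((Algebra.TensorProduct.map f f).comp (Bialgebra.comulAlgHom O B))
        θ (fun b => LinearMap.congr_fun hθ b), map_add, hmul, hmul]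
      have h₁ : tmap k r₁ r₁ (((Bialgebra.comulAlgHom O B').comp f) a) = comul (q₁ a) :=
        (hΔ' _).trans (congrArg _ (hf a))
      have h₂ : tmap k r₁ r₁ (((Algebra.TensorProduct.map f f).comp
          (Bialgebra.comulAlgHom O B)) b) = comul (q₁ b) := hff _ hf b
      rw [h₁, h₂]) (by
      refine LinearMap.ext fun a => ?_
      obtain ⟨a, rfl⟩ := hqs a
      have h0 : cobarAlong comul comul f.toLinearMap θ a = 0 := by
        have h1 := cobarAlong_homDefect (coassocDefect_comul (O := O) (B := B))
          (coassocDefect_comul (O := O) (B := B')) f.toLinearMap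
        change cobarAlong comul comul f.toLinearMap (D f.toLinearMap) = 0 at h1
        rw [hθ] at h1
        refine h.pow_smul_injective (m + 1) ?_
        have h2 := LinearMap.congr_fun h1 a
        simp only [cobarAlong, TensorProduct.map_smul_left, TensorProduct.map_smul_right,
          LinearMap.add_apply, LinearMap.sub_apply, LinearMap.comp_apply, LinearMap.smul_apply,
          map_smul, ← smul_sub, ← smul_add] at h2 ⊢
        rw [h2]
        simp
      have h3 : tmap k r₁ (tmap k r₁ r₁) (cobarAlong comul comul f.toLinearMap θ a) =
          cobar₂ comul θ' (q₁ a) := by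
        simp only [cobarAlong, cobar₂, LinearMap.add_apply, LinearMap.sub_apply,
          LinearMap.comp_apply, map_add, map_sub, LinearEquiv.coe_coe, tmap_assoc,
          tmap_lTensor r₁ hΔ', tmap_leftComul hΔ', hθ', tmap_map_left hf hθ', tmap_map_right hf hθ',
          hΔ]
      rw [LinearMap.zero_apply, ← h3, h0, map_zero])
    -- Conjugation by `1 + ϖ ^ (m + 1) j'`, where `j'` lifts `j`, changes the defect by
    -- `-ϖ ^ (m + 1) θ` up to terms divisible by `ϖ ^ (m + 2)`.
    obtain ⟨j', hj'⟩ := h.base_surjective hqb' j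
    obtain ⟨f', ζ, hf'⟩ := exists_conj_eq_add f j' (ϖ ^ (m + 1)) (by
      rw [pow_succ', mul_smul]
      exact h.isUnit_one_add _)
    let y : B →ₗ[O] B' := innerDer f j' + ϖ ^ (m + 1) • ζ
    have hη : ∀ b, r₁ (y b) = innerDer (AlgHom.id k A) j (q₁ b) := fun b => by
      have h1 : q' (f b) = q b := hf b
      have h2 : q' j' = j := hj'
      have h3 : r₁ (innerDer f j' b) = innerDer (AlgHom.id k A) j (q₁ b) := by
        rw [innerDer_apply, innerDer_apply, hr₁, hq₁]
        simp only [AlgHom.toLinearMap_apply, map_sub, map_mul, h1, h2, AlgHom.id_apply]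
      rw [LinearMap.add_apply, map_add, LinearMap.smul_apply, h.base_pow_succ_smul, add_zero, h3]
    refine ⟨y, ⟨f', ?_⟩, fun b => ?_, ?_⟩
    · rw [hf', smul_add, smul_smul, add_assoc]
    · rw [LinearMap.add_apply, map_add, hf, LinearMap.smul_apply, h.base_pow_succ_smul, add_zero]
    · let τ : B →ₗ[O] B' ⊗[O] B' := θ + (comul ∘ₗ y - TensorProduct.map f.toLinearMap y ∘ₗ comul -
        TensorProduct.map y f.toLinearMap ∘ₗ comul -
          ϖ ^ (m + 1) • TensorProduct.map y y ∘ₗ comul)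
      obtain ⟨σ, hσ⟩ := h.exists_smul_eq_pow_smul (m + 1) hq₂ τ fun b => by
        change tmap k r₁ r₁ (θ b + (comul (y b) - TensorProduct.map f.toLinearMap y (comul b) -
          TensorProduct.map y f.toLinearMap (comul b) -
          ϖ ^ (m + 1) • TensorProduct.map y y (comul b))) = 0
        simp only [map_add, map_sub, h.base_pow_succ_smul, hθ', hΔ', tmap_map_left hf hη,
          tmap_map_right hf hη, hΔ, hη, sub_zero]
        rw [hj]
        simp only [cobar₁, LinearMap.add_apply, LinearMap.sub_apply, LinearMap.comp_apply]
        abel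
      refine ⟨σ, hσ ▸ LinearMap.ext fun b => ?_⟩
      refine (homDefect_add_smul _ _ _ _ _ b).trans ?_
      rw [show homDefect comul comul f.toLinearMap b = ϖ ^ (m + 1) • θ b from
        LinearMap.congr_fun hθ b, ← smul_add]
      rfl
  obtain ⟨L, hL⟩ := h.exists_limit P h₀ step
  obtain ⟨f, rfl⟩ := h.exists_algHom_of_limit L fun m => by
    obtain ⟨y, ⟨f, hf⟩, -⟩ := hL m
    exact ⟨f, y, hf⟩
  have hf : ∀ b, q' (f b) = q b := fun b => by
    obtain ⟨y, -, hy, -⟩ := hL 0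
    have := hy b
    rwa [LinearMap.add_apply, map_add, LinearMap.smul_apply, h.base_pow_succ_smul, add_zero] at this
  have hcomul : ∀ b, comul (f b) = TensorProduct.map f.toLinearMap f.toLinearMap (comul b) :=
    fun b => sub_eq_zero.1 (h.eq_zero_of_forall_pow fun m => by
      obtain ⟨y, -, -, θ, hθ⟩ := hL m
      have h1 := (homDefect_add_smul comul comul f.toLinearMap y (ϖ ^ (m + 1)) b).symm.trans
        (LinearMap.congr_fun hθ b)
      rw [LinearMap.smul_apply, ← eq_sub_iff_add_eq, ← smul_sub, pow_succ, mul_smul] at h1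
      exact ⟨_, h1⟩)
  have hbij : Function.Bijective f :=
    h.bijective_of_base hqb hqb' f.toLinearMap id Function.bijective_id hf
  have hcounit : ∀ b, counit (R := O) (f b) = counit b := fun b => by
    -- Transported along `f`, the counit of `B'` is a left counit of `B`, and a left counit equals
    -- the counit.
    let ε' : B →ₗ[O] O := counit ∘ₗ f.toLinearMap
    have h1 : contractLeft B ε' (comul b) = b := hbij.1 (by
      have : ∀ t : B ⊗[O] B, f (contractLeft B ε' t) = contractLeft B' (counit (R := O))
          (TensorProduct.map f.toLinearMap f.toLinearMap t) := fun t => by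
        induction t with
        | zero => simp
        | add x y hx hy => simp only [map_add, hx, hy]
        | tmul a b => simp [ε']
      rw [this, ← hcomul]
      simp [contractLeft])
    have h2 := apply_contractLeft ε' (counit (R := O)) (comul b)
    rw [h1] at h2
    have h3 : contract B (counit (R := O)) (comul b) = b := by simp [contract]
    rw [h3] at h2
    exact h2.symm
  exact ⟨BialgEquiv.ofAlgEquiv (AlgEquiv.ofBijective f hbij) (AlgHom.ext hcounit)
    (AlgHom.ext fun b => (hcomul b).symm)⟩

end IsResidueMap

end Uniqueness

/-! ### Ranks of idempotents under base change -/

section Rank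

variable {O F X X' : Type*} [CommRing O] [Field F] [Algebra O F]
  [AddCommGroup X] [Module O X] [AddCommGroup X'] [Module O X'] [Module F X'] [IsScalarTower O F X']

/-- Over a local ring the rank of an idempotent endomorphism of a finite free module does not
change under base change to a field: image and kernel are projective, hence free, and the union of
their bases stays a basis after base change. -/
theorem finrank_range_of_isBaseChange [IsLocalRing O] [Module.Free O X] [Module.Finite O X]
    {q : X →ₗ[O] X'} (hq : IsBaseChange F q) (P : X →ₗ[O] X) (hP : IsIdempotentElem P)
    (P' : X' →ₗ[F] X') (h : ∀ x, q (P x) = P' (q x)) :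
    Module.finrank F (LinearMap.range P') = Module.finrank O (LinearMap.range P) := by
  have hPP : ∀ x, P (P x) = P x := fun x => LinearMap.congr_fun hP x
  have hc : IsCompl (LinearMap.range P) (LinearMap.ker P) :=
    LinearMap.IsIdempotentElem.isCompl hP
  have hpr : Module.Projective O (LinearMap.range P) :=
    Module.Projective.of_split (LinearMap.range P).subtype P.rangeRestrict
      (LinearMap.ext fun ⟨x, y, hy⟩ => Subtype.ext (by subst hy; exact hPP y))
  have hker : Module.Projective O (LinearMap.ker P) :=
    Module.Projective.of_split (LinearMap.ker P).subtype
      ((LinearMap.id - P).codRestrict _ fun x => by simp [hPP])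
      (LinearMap.ext fun ⟨x, hx⟩ => Subtype.ext (by
        have : P x = 0 := hx
        simp [this]))
  have hfin : Module.Finite O (LinearMap.ker P) := Module.Finite.of_surjective
    ((LinearMap.id - P).codRestrict (LinearMap.ker P) fun x => by simp [hPP]) fun ⟨x, hx⟩ =>
      ⟨x, Subtype.ext (by
        have : P x = 0 := hx
        simp [this])⟩
  have : Module.Free O (LinearMap.range P) := Module.free_of_flat_of_isLocalRing
  have : Module.Free O (LinearMap.ker P) := Module.free_of_flat_of_isLocalRing
  let b := Module.Free.chooseBasis O (LinearMap.range P)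
  let c := Module.Free.chooseBasis O (LinearMap.ker P)
  let d := (b.prod c).map (Submodule.prodEquivOfIsCompl _ _ hc)
  let d' := hq.basis d
  have hl : ∀ i, P' (d' (Sum.inl i)) = d' (Sum.inl i) := fun i => by
    obtain ⟨y, hy⟩ := (b i).2
    simp only [d', IsBaseChange.basis_apply, ← h]
    simp only [d, Module.Basis.map_apply, Module.Basis.prod_apply_inl_fst,
      Submodule.coe_prodEquivOfIsCompl', Module.Basis.prod_apply_inl_snd]
    simp [← hy, hPP]
  have hr : ∀ i, P' (d' (Sum.inr i)) = 0 := fun i => by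
    have : P (c i) = 0 := (c i).2
    simp only [d', IsBaseChange.basis_apply, ← h]
    simp only [d, Module.Basis.map_apply, Submodule.coe_prodEquivOfIsCompl',
      Module.Basis.prod_apply_inr_fst, Module.Basis.prod_apply_inr_snd]
    simp [this]
  have hrange : LinearMap.range P' = Submodule.span F (Set.range fun i => d' (Sum.inl i)) := by
    rw [LinearMap.range_eq_map, ← d'.span_eq, Submodule.map_span]
    apply le_antisymm
    · rw [Submodule.span_le]
      rintro _ ⟨_, ⟨i | i, rfl⟩, rfl⟩
      · rw [hl]
        exact Submodule.subset_span ⟨i, rfl⟩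
      · rw [hr]
        exact Submodule.zero_mem _
    · rw [Submodule.span_le]
      rintro _ ⟨i, rfl⟩
      exact Submodule.subset_span ⟨_, ⟨Sum.inl i, rfl⟩, hl i⟩
  rw [hrange, finrank_span_eq_card (b := fun i => d' (Sum.inl i))
    (d'.linearIndependent.comp _ Sum.inl_injective), Module.finrank_eq_card_basis b]

end Rank

/-! ### Products of matrix algebras and their standard modules -/

section MatrixProduct

variable {ι : Type} [Fintype ι] [DecidableEq ι]

/-- The product of the matrix algebras of sizes `n i` over `R`. -/
abbrev MatProd (R : Type*) (n : ι → ℕ) : Type _ := (i : ι) → Matrix (Fin (n i)) (Fin (n i)) R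

/-- The direct sum of `m i` copies of the `i`-th standard module of `MatProd R n`: the columns of the
`i`-th component are the copies. -/
abbrev StdMod (R : Type*) (n m : ι → ℕ) : Type _ := (i : ι) → Matrix (Fin (n i)) (Fin (m i)) R

variable {O F : Type*} [CommRing O] [CommRing F] [Algebra O F]

variable (O F) in
/-- The entrywise base change map of standard modules. -/
noncomputable def StdMod.map (n m : ι → ℕ) : StdMod O n m →ₗ[O] StdMod F n m :=
  LinearMap.pi fun i => (Algebra.linearMap O F).mapMatrix ∘ₗ LinearMap.proj i

@[simp] lemma StdMod.map_apply (n m : ι → ℕ) (v : StdMod O n m) (i : ι) :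
    StdMod.map O F n m v i = (v i).map (algebraMap O F) := rfl

lemma StdMod.isBaseChange_map (n m : ι → ℕ) : IsBaseChange F (StdMod.map O F n m) := by
  refine isBaseChange_of_basis (Pi.basis fun i => Matrix.stdBasis O (Fin (n i)) (Fin (m i)))
    (Pi.basis fun i => Matrix.stdBasis F (Fin (n i)) (Fin (m i))) fun ⟨i, a, b⟩ => ?_
  rw [Pi.basis_apply, Pi.basis_apply, Matrix.stdBasis_eq_single, Matrix.stdBasis_eq_single]
  ext j : 1
  rw [StdMod.map_apply]
  obtain rfl | hj := eq_or_ne j i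
  · simp
  · simp [Pi.single_eq_of_ne hj]

variable (O F) in
/-- The entrywise base change map of products of matrix algebras. -/
noncomputable def MatProd.map (n : ι → ℕ) : MatProd O n →ₐ[O] MatProd F n :=
  AlgHom.ofLinearMap (StdMod.map O F n n) (by ext i : 1; simp)
    (fun x y => by ext i : 1; simp [Matrix.map_mul])

lemma MatProd.map_apply (n : ι → ℕ) (v : MatProd O n) (i : ι) :
    MatProd.map O F n v i = (v i).map (algebraMap O F) := rfl

/-- Two base changes of an algebra are isomorphic. -/
lemma exists_algEquiv_of_isBaseChange {B H H' : Type*} [Ring B] [Algebra O B] [Ring H] [Algebra F H]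
    [Algebra O H] [IsScalarTower O F H] [Ring H'] [Algebra F H'] [Algebra O H']
    [IsScalarTower O F H'] {q : B →ₐ[O] H} {q' : B →ₐ[O] H'} (hq : IsBaseChange F q.toLinearMap)
    (hq' : IsBaseChange F q'.toLinearMap) : ∃ e : H ≃ₐ[F] H', ∀ b, e (q b) = q' b := by
  let e : H ≃ₗ[F] H' := hq.equiv.symm.trans hq'.equiv
  have he : ∀ b, e (q b) = q' b := fun b => by
    have h1 : hq.equiv.symm (q b) = 1 ⊗ₜ b := hq.equiv_symm_apply b
    have h2 : hq'.equiv (1 ⊗ₜ b) = (1 : F) • q' b := hq'.equiv_tmul 1 b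
    rw [LinearEquiv.trans_apply, h1, h2, one_smul]
  have hmul : ∀ x y, e (x * y) = e x * e y := fun x y => by
    induction x using hq.inductionOn with
    | zero => simp
    | smul s x hx => rw [smul_mul_assoc, map_smul, hx, map_smul, smul_mul_assoc]
    | add x x' hx hx' => rw [add_mul, map_add, hx, hx', map_add, add_mul]
    | tmul a =>
      induction y using hq.inductionOn with
      | zero => simp
      | smul s x hx => rw [mul_smul_comm, map_smul, hx, map_smul, mul_smul_comm]
      | add x x' hx hx' => rw [mul_add, map_add, hx, hx', map_add, mul_add]
      | tmul b =>
        simp only [AlgHom.toLinearMap_apply]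
        rw [← map_mul, he, he, he, map_mul]
  have h1 : e 1 = 1 := by rw [← map_one q, he, map_one]
  exact ⟨AlgEquiv.ofLinearEquiv e h1 hmul, he⟩

/-- The base change of an algebra isomorphic to a product of matrix algebras is again one. -/
lemma exists_matProd_of_isBaseChange {B H : Type*} [Ring B] [Algebra O B] [Ring H] [Algebra F H]
    [Algebra O H] [IsScalarTower O F H] {q : B →ₐ[O] H} (hq : IsBaseChange F q.toLinearMap)
    {n : ι → ℕ} (φ : B ≃ₐ[O] MatProd O n) :
    ∃ φ' : H ≃ₐ[F] MatProd F n, ∀ b, φ' (q b) = MatProd.map O F n (φ b) :=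
  exists_algEquiv_of_isBaseChange hq (q' := (MatProd.map O F n).comp φ.toAlgHom)
    ((StdMod.isBaseChange_map n n).comp_equiv φ.toLinearEquiv _)

variable {R E : Type*} [CommRing R] [Ring E] [Algebra R E] {n : ι → ℕ}

/-- The matrix units in an algebra identified with a product of matrix algebras. -/
noncomputable def matUnit (φ : E ≃ₐ[R] MatProd R n) (i : ι) (a b : Fin (n i)) : E :=
  φ.symm (Pi.single i (Matrix.single a b 1))

lemma matUnit_mul_matUnit (φ : E ≃ₐ[R] MatProd R n) (i : ι) (a b c d : Fin (n i)) :
    matUnit φ i a b * matUnit φ i c d = if b = c then matUnit φ i a d else 0 := by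
  rw [matUnit, matUnit, ← map_mul, ← Pi.single_mul]
  split_ifs with h
  · subst h; simp [matUnit]
  · simp [h]

/-- The (nonunital) embedding of the `i`-th factor. -/
noncomputable def ofFactor (φ : E ≃ₐ[R] MatProd R n) (i : ι) :
    Matrix (Fin (n i)) (Fin (n i)) R →ₗ[R] E :=
  φ.symm.toLinearMap ∘ₗ LinearMap.single R (fun i => Matrix (Fin (n i)) (Fin (n i)) R) i

lemma ofFactor_single (φ : E ≃ₐ[R] MatProd R n) (i : ι) (a b : Fin (n i)) :
    ofFactor φ i (Matrix.single a b 1) = matUnit φ i a b := rfl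

lemma ofFactor_mul (φ : E ≃ₐ[R] MatProd R n) (i : ι) (M : Matrix (Fin (n i)) (Fin (n i)) R)
    (x : E) : ofFactor φ i M * x = ofFactor φ i (M * φ x i) := by
  apply φ.injective
  simp [ofFactor, Pi.single_mul_left]

lemma mul_ofFactor (φ : E ≃ₐ[R] MatProd R n) (i : ι) (M : Matrix (Fin (n i)) (Fin (n i)) R)
    (x : E) : x * ofFactor φ i M = ofFactor φ i (φ x i * M) := by
  apply φ.injective
  simp [ofFactor, Pi.single_mul_right]

lemma matUnit_mul (φ : E ≃ₐ[R] MatProd R n) (i : ι) (a b : Fin (n i)) (x : E) :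
    matUnit φ i a b * x = ∑ c, φ x i b c • matUnit φ i a c := by
  simp only [← ofFactor_single, ofFactor_mul, ← map_smul, ← map_sum]
  congr 1
  ext c d
  simp [Matrix.mul_apply, Matrix.sum_apply, Matrix.single_apply, ite_and]

lemma mul_matUnit (φ : E ≃ₐ[R] MatProd R n) (i : ι) (a b : Fin (n i)) (x : E) :
    x * matUnit φ i a b = ∑ c, φ x i c a • matUnit φ i c b := by
  simp only [← ofFactor_single, mul_ofFactor, ← map_smul, ← map_sum]
  congr 1
  ext c d
  simp [Matrix.mul_apply, Matrix.sum_apply, Matrix.single_apply, ite_and]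

lemma matUnit_mul_matUnit_of_ne (φ : E ≃ₐ[R] MatProd R n) {i j : ι} (h : i ≠ j) (a b : Fin (n i))
    (c d : Fin (n j)) : matUnit φ i a b * matUnit φ j c d = 0 := by
  rw [matUnit_mul]
  refine Finset.sum_eq_zero fun e _ => ?_
  rw [matUnit, AlgEquiv.apply_symm_apply, Pi.single_eq_of_ne h]
  simp

lemma sum_matUnit (φ : E ≃ₐ[R] MatProd R n) : ∑ i, ∑ a, matUnit φ i a a = 1 := by
  have h : ∀ i, ∑ a, matUnit φ i a a = ofFactor φ i 1 := fun i => by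
    simp only [← ofFactor_single, ← map_sum]
    congr 1
    ext c d
    rw [Matrix.sum_apply, Finset.sum_eq_single c (fun b _ hb => by simp [hb]) (by simp)]
    simp [Matrix.single_apply, Matrix.one_apply]
  simp only [h]
  apply φ.injective
  rw [map_sum, map_one, ← Finset.univ_sum_single (1 : MatProd R n)]
  refine Finset.sum_congr rfl fun i _ => ?_
  simp [ofFactor]

/-- A product of matrix algebras is separable, with idempotent `∑ eₐ₀ ⊗ e₀ₐ` over all factors. -/
lemma exists_isSepIdempotent_matProd {k A : Type*} [Field k] [Ring A] [Algebra k A] {n : ι → ℕ}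
    [∀ i, NeZero (n i)] (φ : A ≃ₐ[k] MatProd k n) : ∃ e : A ⊗[k] A, IsSepIdempotent e := by
  refine ⟨∑ i, ∑ a, matUnit φ i a 0 ⊗ₜ matUnit φ i 0 a, ?_, fun x => ?_⟩
  · simp [matUnit_mul_matUnit, sum_matUnit]
  · simp only [Finset.mul_sum, Finset.sum_mul, Algebra.TensorProduct.tmul_mul_tmul, one_mul,
      mul_one]
    simp only [matUnit_mul, mul_matUnit, TensorProduct.sum_tmul, TensorProduct.tmul_sum]
    refine Finset.sum_congr rfl fun i _ => ?_
    rw [Finset.sum_comm]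
    simp only [TensorProduct.smul_tmul]

/-- The standard action of an algebra isomorphic to a product of matrix algebras. -/
noncomputable def stdAction (φ : E ≃ₐ[R] MatProd R n) (m : ι → ℕ) :
    E →ₐ[R] Module.End R (StdMod R n m) :=
  AlgHom.ofLinearMap
    (LinearMap.mk₂ R (fun (x : E) (v : StdMod R n m) (i : ι) => φ x i * v i)
      (fun x y v => funext fun i => by simp [Matrix.add_mul]) (fun c x v => funext fun i => by simp)
      (fun x v w => funext fun i => by simp [Matrix.mul_add])
      (fun c x v => funext fun i => by simp))
    (LinearMap.ext fun v => funext fun i => by simp)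
    (fun x y => LinearMap.ext fun v => funext fun i => by simp [Matrix.mul_assoc])

lemma stdAction_apply (φ : E ≃ₐ[R] MatProd R n) (m : ι → ℕ) (x : E) (v : StdMod R n m) (i : ι) :
    stdAction φ m x v i = φ x i * v i := rfl

end MatrixProduct

/-! ### Classification of modules by multiplicities -/

section Classification

variable {ι : Type} [Fintype ι] [DecidableEq ι] {n : ι → ℕ} [∀ i, NeZero (n i)]
  {F E : Type u} [Field F] [Ring E] [Algebra F E]

/-- The primitive idempotent belonging to the `i`-th factor. -/
noncomputable def primIdem {R E : Type*} [CommRing R] [Ring E] [Algebra R E]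
    (φ : E ≃ₐ[R] MatProd R n) (i : ι) : E := matUnit φ i 0 0

lemma primIdem_mul_primIdem {R E : Type*} [CommRing R] [Ring E] [Algebra R E]
    (φ : E ≃ₐ[R] MatProd R n) (i : ι) : primIdem φ i * primIdem φ i = primIdem φ i := by
  simp [primIdem, matUnit_mul_matUnit]

namespace FDModule

/-- The standard module with multiplicities `m`. -/
noncomputable def std (φ : E ≃ₐ[F] MatProd F n) (m : ι → ℕ) : FDModule F E :=
  ofAction (StdMod F n m) (stdAction φ m)

/-- The multiplicity of the `i`-th irreducible module in `V`: the dimension of `e V` for a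
primitive idempotent `e` of the `i`-th factor. -/
noncomputable def mult (φ : E ≃ₐ[F] MatProd F n) (V : FDModule F E) (i : ι) : ℕ :=
  Module.finrank F (LinearMap.range (V.action (primIdem φ i)))

variable (φ : E ≃ₐ[F] MatProd F n)

lemma Iso.symm {V W : FDModule F E} (h : Iso V W) : Iso W V := h.map LinearEquiv.symm

lemma Iso.trans {U V W : FDModule F E} (h : Iso U V) (h' : Iso V W) : Iso U W :=
  h.elim fun e => h'.map e.trans

lemma mult_eq_of_iso {V W : FDModule F E} (h : Iso V W) : mult φ V = mult φ W := by
  obtain ⟨e⟩ := h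
  funext i
  have : LinearMap.range (W.action (primIdem φ i)) =
      (LinearMap.range (V.action (primIdem φ i))).map (e.restrictScalars F).toLinearMap := by
    ext x
    simp only [LinearMap.mem_range, Submodule.mem_map, action_apply]
    constructor
    · rintro ⟨y, rfl⟩
      exact ⟨_, ⟨e.symm y, rfl⟩, by simp⟩
    · rintro ⟨_, ⟨y, rfl⟩, rfl⟩
      exact ⟨e y, by simp⟩
  rw [mult, mult, this]
  exact (LinearEquiv.finrank_map_eq (e.restrictScalars F) _).symm

/-- Every module is isomorphic to the standard module with the same multiplicities. -/
theorem iso_std_mult (V : FDModule F E) : Iso V (std φ (mult φ V)) := by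
  let W : ι → Submodule F V.carrier := fun i => LinearMap.range (V.action (primIdem φ i))
  let b : ∀ i, Module.Basis (Fin (mult φ V i)) F (W i) := fun i => Module.finBasis F (W i)
  have hW : ∀ i (w : W i), primIdem φ i • (w : V.carrier) = w := fun i ⟨_, x, hx⟩ => by
    subst hx
    simp only [action_apply]
    rw [← mul_smul, primIdem_mul_primIdem]
  -- The `a`-th row of the coordinate matrix of `x` is given by `e₀ₐ x` in the space `e V`, where
  -- `e = e₀₀` is the primitive idempotent of the `i`-th factor.
  let row : ∀ i, Fin (n i) → V.carrier →ₗ[F] W i := fun i a =>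
    (V.action (matUnit φ i 0 a)).codRestrict (W i) fun x => ⟨matUnit φ i 0 a • x, by
      rw [action_apply, action_apply, ← mul_smul, primIdem, matUnit_mul_matUnit, if_pos rfl]⟩
  have hrow : ∀ i a x, (row i a x : V.carrier) = matUnit φ i 0 a • x := fun i a x => rfl
  let Φ : V.carrier →ₗ[F] StdMod F n (mult φ V) :=
    { toFun := fun x i => Matrix.of fun a s => (b i).repr (row i a x) s
      map_add' := fun x y => by
        funext i
        ext a s
        simp
      map_smul' := fun c x => by
        funext i
        ext a s
        simp }
  have hΦ : ∀ x i a s, Φ x i a s = (b i).repr (row i a x) s := fun _ _ _ _ => rfl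
  have hmul : ∀ (y : E) (x : V.carrier), Φ (y • x) = stdAction φ (mult φ V) y (Φ x) := fun y x => by
    funext i
    ext a s
    have : row i a (y • x) = ∑ c, φ y i a c • row i c x := by
      ext
      rw [hrow, ← mul_smul, matUnit_mul, Finset.sum_smul, AddSubmonoidClass.coe_finsetSum]
      simp [hrow]
    rw [hΦ, this, stdAction_apply, Matrix.mul_apply]
    simp [hΦ]
  have hinj : Function.Injective Φ := by
    rw [← LinearMap.ker_eq_bot, LinearMap.ker_eq_bot']
    intro x hx
    have h0 : ∀ i a, row i a x = 0 := fun i a => by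
      apply (b i).repr.injective
      ext s
      rw [← hΦ, hx]
      simp
    rw [← one_smul E x, ← sum_matUnit φ, Finset.sum_smul]
    refine Finset.sum_eq_zero fun i _ => ?_
    rw [Finset.sum_smul]
    refine Finset.sum_eq_zero fun a _ => ?_
    have : matUnit φ i a a = matUnit φ i a 0 * matUnit φ i 0 a := by simp [matUnit_mul_matUnit]
    rw [this, mul_smul, ← hrow, h0]
    simp
  have hsurj : Function.Surjective Φ := fun v => by
    refine ⟨∑ i, ∑ a, ∑ s, v i a s • matUnit φ i a 0 • (b i s : V.carrier), ?_⟩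
    funext j
    ext c s
    have : row j c (∑ i, ∑ a, ∑ s, v i a s • matUnit φ i a 0 • (b i s : V.carrier)) =
        ∑ s, v j c s • b j s := by
      ext
      rw [hrow]
      simp only [Finset.smul_sum, AddSubmonoidClass.coe_finsetSum, Submodule.coe_smul]
      rw [Finset.sum_eq_single j, Finset.sum_eq_single c]
      · refine Finset.sum_congr rfl fun s _ => ?_
        rw [smul_comm, ← mul_smul, matUnit_mul_matUnit, if_pos rfl]
        exact congrArg _ (hW j _)
      · intro a _ ha
        refine Finset.sum_eq_zero fun s _ => ?_
        rw [smul_comm, ← mul_smul, matUnit_mul_matUnit, if_neg ha.symm, zero_smul, smul_zero]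
      · simp
      · intro i _ hi
        refine Finset.sum_eq_zero fun a _ => Finset.sum_eq_zero fun s _ => ?_
        rw [smul_comm, ← mul_smul, matUnit_mul_matUnit_of_ne φ hi.symm, zero_smul, smul_zero]
      · simp
    rw [hΦ, this, Module.Basis.repr_sum_self]
  exact iso_of_equiv (W := std φ (mult φ V)) (LinearEquiv.ofBijective Φ ⟨hinj, hsurj⟩) hmul

lemma mult_std (m : ι → ℕ) : mult φ (std φ m) = m := by
  funext i
  -- The primitive idempotent projects onto the first row of the `i`-th component.
  let ψ : (Fin (m i) → F) →ₗ[F] StdMod F n m :=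
    LinearMap.single F (fun i => Matrix (Fin (n i)) (Fin (m i)) F) i ∘ₗ
      (Matrix.ofLinearEquiv F).toLinearMap ∘ₗ
        (LinearMap.single F (fun _ : Fin (n i) => Fin (m i) → F) 0)
  have hψ' : ∀ w, ψ w = Pi.single i (Matrix.of (Pi.single 0 w)) := fun w => rfl
  have hψ : Function.Injective ψ := (Pi.single_injective i).comp
    ((Matrix.ofLinearEquiv F).injective.comp
      (Pi.single_injective (M := fun _ : Fin (n i) => Fin (m i) → F) 0))
  have hr : LinearMap.range (stdAction φ m (primIdem φ i)) = LinearMap.range ψ := by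
    have h : ∀ v, stdAction φ m (primIdem φ i) v = ψ (v i 0) := fun v => by
      funext j
      rw [stdAction_apply, primIdem, matUnit, AlgEquiv.apply_symm_apply]
      obtain rfl | hj := eq_or_ne j i
      · ext a s
        rw [hψ', Pi.single_eq_same, Pi.single_eq_same, Matrix.of_apply]
        obtain rfl | ha := eq_or_ne a 0
        · simp [Matrix.mul_apply, Matrix.single_apply]
        · rw [Matrix.single_mul_apply_of_ne _ _ _ _ _ ha]
          simp [ha]
      · rw [hψ', Pi.single_eq_of_ne hj, Pi.single_eq_of_ne hj, Matrix.zero_mul]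
    ext x
    constructor
    · rintro ⟨v, rfl⟩
      exact ⟨_, (h v).symm⟩
    · rintro ⟨w, rfl⟩
      refine ⟨ψ w, (h _).trans ?_⟩
      rw [hψ' w, Pi.single_eq_same]
      exact congrArg ψ (Pi.single_eq_same (M := fun _ : Fin (n i) => Fin (m i) → F) 0 w)
  change Module.finrank F (LinearMap.range (stdAction φ m (primIdem φ i))) = m i
  rw [hr, LinearMap.finrank_range_of_inj hψ, Module.finrank_fin_fun]

lemma iso_iff_mult_eq {V W : FDModule F E} : Iso V W ↔ mult φ V = mult φ W :=
  ⟨mult_eq_of_iso φ, fun h => (iso_std_mult φ V).trans (h ▸ (iso_std_mult φ W).symm)⟩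

lemma finrank_eq_sum_mult (V : FDModule F E) :
    Module.finrank F V.carrier = ∑ i, n i * mult φ V i := by
  obtain ⟨e⟩ := iso_std_mult φ V
  rw [(e.restrictScalars F).finrank_eq]
  change Module.finrank F (StdMod F n (mult φ V)) = _
  simp [Module.finrank_pi_fintype, Module.finrank_matrix]

lemma subsingleton_of_mult_eq_zero {V : FDModule F E} (h : mult φ V = 0) :
    Subsingleton V.carrier := by
  refine (Module.finrank_zero_iff (R := F)).1 ?_
  rw [finrank_eq_sum_mult φ, h]
  simp

lemma mult_eq_zero_of_subsingleton (V : FDModule F E) [Subsingleton V.carrier] :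
    mult φ V = 0 := by
  funext i
  exact Module.finrank_zero_of_subsingleton

lemma mult_add_of_shortExact {U V W : FDModule F E} (h : ShortExact U V W) :
    mult φ V = mult φ U + mult φ W := by
  obtain ⟨f, g, hf, hfg, hg⟩ := h
  funext i
  set x := primIdem φ i with hx
  have hxx : x * x = x := primIdem_mul_primIdem φ i
  let P : Submodule F V.carrier := LinearMap.range (V.action x)
  have h₁ := LinearMap.finrank_range_add_finrank_ker ((g.restrictScalars F).domRestrict P)
  have h₂ : LinearMap.range ((g.restrictScalars F).domRestrict P) =
      LinearMap.range (W.action x) := by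
    ext w
    constructor
    · rintro ⟨⟨_, v, rfl⟩, rfl⟩
      exact ⟨g v, by simp⟩
    · rintro ⟨w, rfl⟩
      obtain ⟨v, rfl⟩ := hg w
      exact ⟨⟨_, v, rfl⟩, by simp⟩
  have h₃ : Module.finrank F (LinearMap.ker ((g.restrictScalars F).domRestrict P)) =
      Module.finrank F (LinearMap.range (U.action x)) := by
    let j : LinearMap.range (U.action x) →ₗ[F] LinearMap.ker ((g.restrictScalars F).domRestrict P) :=
      (((f.restrictScalars F).domRestrict (LinearMap.range (U.action x))).codRestrict P (by
        rintro ⟨_, u, rfl⟩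
        exact ⟨f u, by simp⟩)).codRestrict _ (by
        rintro ⟨_, u, rfl⟩
        exact (hfg _).2 ⟨x • u, rfl⟩)
    refine (LinearEquiv.ofBijective j ⟨?_, ?_⟩).finrank_eq.symm
    · rintro ⟨a, ha⟩ ⟨b, hb⟩ hab
      exact Subtype.ext (hf (congrArg (fun y => (y.1.1 : V.carrier)) hab))
    · rintro ⟨⟨_, v, rfl⟩, hv⟩
      obtain ⟨u, hu⟩ := (hfg _).1 hv
      refine ⟨⟨x • u, u, rfl⟩, Subtype.ext (Subtype.ext ?_)⟩
      change f (x • u) = x • v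
      rw [map_smul, hu]
      change x • x • v = x • v
      rw [← mul_smul, hxx]
  rw [h₂, h₃] at h₁
  change Module.finrank F P = _
  rw [← h₁, add_comm]
  rfl

/-- The direct sum of two modules. -/
def prod (U W : FDModule F E) : FDModule F E where
  carrier := U.carrier × W.carrier

lemma shortExact_prod (U W : FDModule F E) : ShortExact U (prod U W) W :=
  ⟨LinearMap.inl E U.carrier W.carrier, LinearMap.snd E U.carrier W.carrier,
    LinearMap.inl_injective, Function.Exact.inl_snd, LinearMap.snd_surjective⟩

lemma ShortExact.of_iso {U V V' W : FDModule F E} (h : ShortExact U V W) (e : Iso V V') :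
    ShortExact U V' W := by
  obtain ⟨f, g, hf, hfg, hg⟩ := h
  obtain ⟨e⟩ := e
  refine ⟨e.toLinearMap ∘ₗ f, g ∘ₗ e.symm.toLinearMap, e.injective.comp hf, fun v => ?_,
    hg.comp e.symm.surjective⟩
  refine (hfg (e.symm v)).trans ⟨fun ⟨u, hu⟩ => ⟨u, by simp [hu]⟩, fun ⟨u, hu⟩ => ⟨u, ?_⟩⟩
  simp [← hu]

/-- Short exact sequences are detected by multiplicities, since every sequence splits. -/
lemma shortExact_iff_mult {U V W : FDModule F E} :
    ShortExact U V W ↔ mult φ V = mult φ U + mult φ W := by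
  refine ⟨mult_add_of_shortExact φ, fun h => (shortExact_prod U W).of_iso ?_⟩
  rw [iso_iff_mult_eq φ, h, mult_add_of_shortExact φ (shortExact_prod U W)]

/-- A module is irreducible if and only if its multiplicity vector is indecomposable. -/
lemma isSimple_iff_mult (V : FDModule F E) : V.IsSimple ↔
    mult φ V ≠ 0 ∧ ∀ a b : ι → ℕ, mult φ V = a + b → a = 0 ∨ b = 0 := by
  constructor
  · intro h
    have h' : IsSimpleModule E V.carrier := h
    have := IsSimpleModule.nontrivial E V.carrier
    refine ⟨fun h0 => ?_, fun a b hab => ?_⟩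
    · have := subsingleton_of_mult_eq_zero φ h0
      exact not_subsingleton V.carrier this
    · obtain ⟨f, g, hf, hfg, hg⟩ := (shortExact_iff_mult φ (U := std φ a) (V := V)
        (W := std φ b)).2 (by rw [mult_std, mult_std, hab])
      rw [← mult_std φ a, ← mult_std φ b]
      rcases eq_bot_or_eq_top (LinearMap.range f) with h1 | h1
      · left
        have : Subsingleton (std φ a).carrier := ⟨fun x y => hf (by
          rw [LinearMap.range_eq_bot.1 h1]; rfl)⟩
        exact mult_eq_zero_of_subsingleton φ _
      · right
        have : Subsingleton (std φ b).carrier := ⟨fun x y => by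
          have h0 : ∀ w : (std φ b).carrier, w = 0 := fun w => by
            obtain ⟨v, rfl⟩ := hg w
            exact (hfg v).2 (LinearMap.range_eq_top.1 h1 v)
          rw [h0 x, h0 y]⟩
        exact mult_eq_zero_of_subsingleton φ _
  · rintro ⟨h0, h⟩
    have hnt : Nontrivial V.carrier := by
      by_contra hn
      rw [not_nontrivial_iff_subsingleton] at hn
      exact h0 (mult_eq_zero_of_subsingleton φ V)
    change IsSimpleModule E V.carrier
    rw [isSimpleModule_iff]
    refine { exists_pair_ne := ⟨⊥, ⊤, bot_ne_top⟩, eq_bot_or_eq_top := fun N => ?_ }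
    let U : FDModule F E :=
      { carrier := N
        finite := inferInstanceAs (Module.Finite F (N.restrictScalars F)) }
    let W : FDModule F E :=
      { carrier := V.carrier ⧸ N
        finite := Module.Finite.of_surjective (N.mkQ.restrictScalars F) N.mkQ_surjective }
    have hs : ShortExact U V W := ⟨N.subtype, N.mkQ, N.injective_subtype,
      LinearMap.exact_subtype_mkQ N, N.mkQ_surjective⟩
    rcases h _ _ (mult_add_of_shortExact φ hs) with h1 | h1
    · left
      have : Subsingleton N := subsingleton_of_mult_eq_zero φ h1
      exact Submodule.subsingleton_iff_eq_bot.1 this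
    · right
      have : Subsingleton (V.carrier ⧸ N) := subsingleton_of_mult_eq_zero φ h1
      exact Submodule.Quotient.subsingleton_iff.1 this

end FDModule

end Classification

/-! ### Multiplicities in tensor products -/

section Action

variable {R E X Y : Type*} [CommRing R] [Ring E] [Algebra R E] [AddCommGroup X] [Module R X]
  [AddCommGroup Y] [Module R Y]

/-- The action of `E ⊗ E` on the tensor product of two `E`-modules. -/
noncomputable def action₂ (α : E →ₐ[R] Module.End R X) (β : E →ₐ[R] Module.End R Y) :
    E ⊗[R] E →ₐ[R] Module.End R (X ⊗[R] Y) :=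
  (Module.endTensorEndAlgHom (R := R) (S := R) (A := R)).comp (Algebra.TensorProduct.map α β)

lemma action₂_tmul (α : E →ₐ[R] Module.End R X) (β : E →ₐ[R] Module.End R Y) (a b : E) :
    action₂ α β (a ⊗ₜ b) = TensorProduct.map (α a) (β b) := rfl

variable {F E' X' Y' : Type*} [CommRing F] [Algebra R F] [Ring E'] [Algebra F E'] [Algebra R E']
  [IsScalarTower R F E'] [AddCommGroup X'] [Module R X'] [Module F X'] [IsScalarTower R F X']
  [AddCommGroup Y'] [Module R Y'] [Module F Y'] [IsScalarTower R F Y']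

lemma tmap_action₂ {q : E →ₐ[R] E'} {x : X →ₗ[R] X'} {y : Y →ₗ[R] Y'}
    {α : E →ₐ[R] Module.End R X} {β : E →ₐ[R] Module.End R Y} {α' : E' →ₐ[F] Module.End F X'}
    {β' : E' →ₐ[F] Module.End F Y'} (hα : ∀ a v, x (α a v) = α' (q a) (x v))
    (hβ : ∀ a v, y (β a v) = β' (q a) (y v)) (t : E ⊗[R] E) (z : X ⊗[R] Y) :
    tmap F x y (action₂ α β t z) = action₂ α' β' (tmapAlg F q q t) (tmap F x y z) := by
  induction t with
  | zero => simp
  | add s t hs ht => simp only [map_add, LinearMap.add_apply, hs, ht]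
  | tmul a b =>
    induction z with
    | zero => simp
    | add s t hs ht => simp only [map_add, hs, ht]
    | tmul v w => simp [action₂_tmul, tmapAlg_apply, hα, hβ]

lemma finrank_range_action₂_congr {α : E →ₐ[R] Module.End R X} {β : E →ₐ[R] Module.End R Y}
    {X' Y' : Type*} [AddCommGroup X'] [Module R X'] [AddCommGroup Y'] [Module R Y']
    {α' : E →ₐ[R] Module.End R X'} {β' : E →ₐ[R] Module.End R Y'} (x : X ≃ₗ[R] X') (y : Y ≃ₗ[R] Y')
    (hα : ∀ a v, x (α a v) = α' a (x v)) (hβ : ∀ a v, y (β a v) = β' a (y v)) (t : E ⊗[R] E) :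
    Module.finrank R (LinearMap.range (action₂ α β t)) =
      Module.finrank R (LinearMap.range (action₂ α' β' t)) := by
  have h : ∀ z, TensorProduct.congr x y (action₂ α β t z) =
      action₂ α' β' t (TensorProduct.congr x y z) := fun z => by
    induction t with
    | zero => simp
    | add s t hs ht => simp only [map_add, LinearMap.add_apply, hs, ht]
    | tmul a b =>
      induction z with
      | zero => simp
      | add s t hs ht => simp only [map_add, hs, ht]
      | tmul v w => simp [action₂_tmul, hα, hβ]
  have hr : LinearMap.range (action₂ α' β' t) = (LinearMap.range (action₂ α β t)).map
      (TensorProduct.congr x y).toLinearMap := by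
    ext z
    constructor
    · rintro ⟨z, rfl⟩
      obtain ⟨z, rfl⟩ := (TensorProduct.congr x y).surjective z
      exact ⟨_, ⟨z, rfl⟩, h z⟩
    · rintro ⟨_, ⟨z, rfl⟩, rfl⟩
      exact ⟨_, (h z).symm⟩
  rw [hr]
  exact (LinearEquiv.finrank_map_eq (TensorProduct.congr x y) _).symm

end Action

section Fibers

variable {ι : Type} [Fintype ι] [DecidableEq ι] {n : ι → ℕ}
  {O : Type u} [CommRing O] [IsLocalRing O] {F E' : Type u} [Field F] [Algebra O F]
  {E : Type u} [Ring E] [Algebra O E] [Ring E'] [Algebra F E'] [Algebra O E'] [IsScalarTower O F E']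
  {φ : E ≃ₐ[O] MatProd O n} {φ' : E' ≃ₐ[F] MatProd F n} {q : E →ₐ[O] E'}

lemma map_stdAction (h : ∀ b, φ' (q b) = MatProd.map O F n (φ b)) (m : ι → ℕ) (a : E)
    (v : StdMod O n m) : StdMod.map O F n m (stdAction φ m a v) =
      stdAction φ' m (q a) (StdMod.map O F n m v) := by
  funext i
  rw [StdMod.map_apply, stdAction_apply, stdAction_apply, h, MatProd.map_apply, StdMod.map_apply,
    Matrix.map_mul]

lemma map_primIdem [∀ i, NeZero (n i)] (h : ∀ b, φ' (q b) = MatProd.map O F n (φ b)) (i : ι) :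
    q (primIdem φ i) = primIdem φ' i := by
  apply φ'.injective
  rw [h, primIdem, matUnit, primIdem, matUnit, AlgEquiv.apply_symm_apply,
    AlgEquiv.apply_symm_apply]
  funext j
  rw [MatProd.map_apply]
  obtain rfl | hj := eq_or_ne j i
  · simp
  · simp [Pi.single_eq_of_ne hj]

/-- The operator defined by an element of `E ⊗ E` on a tensor product of lattices has the same
rank in a fibre as over `O`. -/
lemma finrank_range_action₂ {X Y X' Y' : Type*} [AddCommGroup X] [Module O X] [Module.Free O X]
    [Module.Finite O X] [AddCommGroup Y] [Module O Y] [Module.Free O Y] [Module.Finite O Y]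
    [AddCommGroup X'] [Module O X'] [Module F X'] [IsScalarTower O F X']
    [AddCommGroup Y'] [Module O Y'] [Module F Y'] [IsScalarTower O F Y']
    {x : X →ₗ[O] X'} {y : Y →ₗ[O] Y'} (hx : IsBaseChange F x) (hy : IsBaseChange F y)
    {α : E →ₐ[O] Module.End O X} {β : E →ₐ[O] Module.End O Y} {α' : E' →ₐ[F] Module.End F X'}
    {β' : E' →ₐ[F] Module.End F Y'} (hα : ∀ a v, x (α a v) = α' (q a) (x v))
    (hβ : ∀ a v, y (β a v) = β' (q a) (y v)) {t : E ⊗[O] E}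
    (ht : IsIdempotentElem (action₂ α β t)) :
    Module.finrank F (LinearMap.range (action₂ α' β' (tmapAlg F q q t))) =
      Module.finrank O (LinearMap.range (action₂ α β t)) :=
  finrank_range_of_isBaseChange (isBaseChange_tmap hx hy) _ ht _ (tmap_action₂ hα hβ t)

lemma FDModule.finrank_range_action₂_std (φ' : E' ≃ₐ[F] MatProd F n) [∀ i, NeZero (n i)]
    (V W : FDModule F E') (t : E' ⊗[F] E') :
    Module.finrank F (LinearMap.range (action₂ V.action W.action t)) =
      Module.finrank F (LinearMap.range
        (action₂ (stdAction φ' (V.mult φ')) (stdAction φ' (W.mult φ')) t)) := by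
  obtain ⟨e⟩ := V.iso_std_mult φ'
  obtain ⟨f⟩ := W.iso_std_mult φ'
  let x : V.carrier ≃ₗ[F] StdMod F n (V.mult φ') := e.restrictScalars F
  let y : W.carrier ≃ₗ[F] StdMod F n (W.mult φ') := f.restrictScalars F
  have hx : ∀ a v, x (V.action a v) = stdAction φ' (V.mult φ') a (x v) := fun a v => e.map_smul a v
  have hy : ∀ a v, y (W.action a v) = stdAction φ' (W.mult φ') a (y v) := fun a v => f.map_smul a v
  exact finrank_range_action₂_congr x y hx hy t

lemma finrank_range_action₂_stdAction (φ : E ≃ₐ[O] MatProd O n) (φ' : E' ≃ₐ[F] MatProd F n)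
    (q : E →ₐ[O] E') (h : ∀ b, φ' (q b) = MatProd.map O F n (φ b)) {t : E ⊗[O] E} (m m' : ι → ℕ)
    (ht : IsIdempotentElem (action₂ (stdAction φ m) (stdAction φ m') t)) :
    Module.finrank F (LinearMap.range
        (action₂ (stdAction φ' m) (stdAction φ' m') (tmapAlg F q q t))) =
      Module.finrank O (LinearMap.range (action₂ (stdAction φ m) (stdAction φ m') t)) := by
  have h1 := map_stdAction h m
  have h2 := map_stdAction h m'
  have h3 := StdMod.isBaseChange_map (O := O) (F := F) n m
  have h4 := StdMod.isBaseChange_map (O := O) (F := F) n m'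
  exact finrank_range_action₂ h3 h4 h1 h2 ht

/-- In a fibre, an element of `E ⊗ E` acts on the tensor product of two modules with the rank of
its action on the tensor product of the corresponding standard lattices. -/
lemma FDModule.finrank_range_action₂_eq (φ : E ≃ₐ[O] MatProd O n) (φ' : E' ≃ₐ[F] MatProd F n)
    (q : E →ₐ[O] E') (h : ∀ b, φ' (q b) = MatProd.map O F n (φ b))
    [∀ i, NeZero (n i)] {t : E ⊗[O] E} (V W : FDModule F E')
    {m m' : ι → ℕ} (hm : V.mult φ' = m) (hm' : W.mult φ' = m')
    (ht : IsIdempotentElem (action₂ (stdAction φ m) (stdAction φ m') t)) :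
    Module.finrank F (LinearMap.range (action₂ V.action W.action (tmapAlg F q q t))) =
      Module.finrank O (LinearMap.range
        (action₂ (stdAction φ m) (stdAction φ m') t)) := by
  have key := finrank_range_action₂_stdAction φ φ' q h m m' ht
  rw [← key, finrank_range_action₂_std φ' V W, hm, hm']

end Fibers

/-! ### Grothendieck rings described by multiplicities -/

section Grothendieck

open FreeAbelianGroup

variable {M M' I : Type*} [Monoid M] [Monoid M']

lemma freeAbelianGroup_ringHom_ext {S : Type*} [Ring S] {u v : FreeAbelianGroup M →+* S}
    (h : ∀ c, u (of c) = v (of c)) : u = v := by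
  refine RingHom.ext fun x => ?_
  induction x using FreeAbelianGroup.induction_on with
  | zero => simp
  | of c => exact h c
  | neg c hc => rw [map_neg, map_neg, hc]
  | add x y hx hy => rw [map_add, map_add, hx, hy]

/-- An isomorphism of monoids that is compatible with relations induces an isomorphism of the
quotients of the monoid rings. -/
lemma exists_ringQuot_equiv (e : M ≃* M') {r : FreeAbelianGroup M → FreeAbelianGroup M → Prop}
    {r' : FreeAbelianGroup M' → FreeAbelianGroup M' → Prop}
    (h : ∀ x y, r x y → r' (liftMonoid ((ofMulHom).comp e.toMonoidHom) x)
      (liftMonoid ((ofMulHom).comp e.toMonoidHom) y))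
    (h' : ∀ x y, r' x y → r (liftMonoid ((ofMulHom).comp e.symm.toMonoidHom) x)
      (liftMonoid ((ofMulHom).comp e.symm.toMonoidHom) y)) :
    ∃ Φ : RingQuot r ≃+* RingQuot r', ∀ c,
      Φ (RingQuot.mkRingHom r (of c)) = RingQuot.mkRingHom r' (of (e c)) := by
  let f : RingQuot r →+* RingQuot r' := RingQuot.lift
    ⟨(RingQuot.mkRingHom r').comp (liftMonoid ((ofMulHom).comp e.toMonoidHom)),
      fun x y hxy => RingQuot.mkRingHom_rel (h x y hxy)⟩
  let g : RingQuot r' →+* RingQuot r := RingQuot.lift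
    ⟨(RingQuot.mkRingHom r).comp (liftMonoid ((ofMulHom).comp e.symm.toMonoidHom)),
      fun x y hxy => RingQuot.mkRingHom_rel (h' x y hxy)⟩
  have hf : ∀ c, f (RingQuot.mkRingHom r (of c)) = RingQuot.mkRingHom r' (of (e c)) := fun c => by
    simp [f]
  have hg : ∀ c, g (RingQuot.mkRingHom r' (of c)) = RingQuot.mkRingHom r (of (e.symm c)) :=
    fun c => by simp [g]
  refine ⟨RingEquiv.ofRingHom f g (RingQuot.ringQuot_ext _ _ ?_) (RingQuot.ringQuot_ext _ _ ?_), hf⟩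
  · refine freeAbelianGroup_ringHom_ext fun c => ?_
    change f (g (RingQuot.mkRingHom r' (of c))) = RingQuot.mkRingHom r' (of c)
    rw [hg, hf, e.apply_symm_apply]
  · refine freeAbelianGroup_ringHom_ext fun c => ?_
    change g (f (RingQuot.mkRingHom r (of c))) = RingQuot.mkRingHom r (of c)
    rw [hf, hg, e.symm_apply_apply]

/-- If the elements of two monoids are classified by multiplicities in such a way that the
multiplicities of a product depend only on those of the factors, by the same rule for both
monoids, then the quotients of the monoid rings by additivity of multiplicities agree. -/
theorem exists_equiv_of_mult {μ : M → I → ℕ} {μ' : M' → I → ℕ} (hμ : Function.Bijective μ)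
    (hμ' : Function.Bijective μ')
    (hmul : ∀ a b a' b', μ a = μ' a' → μ b = μ' b' → μ (a * b) = μ' (a' * b'))
    {r : FreeAbelianGroup M → FreeAbelianGroup M → Prop}
    {r' : FreeAbelianGroup M' → FreeAbelianGroup M' → Prop}
    (hr : ∀ x y, r x y ↔ ∃ a b c, μ c = μ a + μ b ∧ x = of c ∧ y = of a + of b)
    (hr' : ∀ x y, r' x y ↔ ∃ a b c, μ' c = μ' a + μ' b ∧ x = of c ∧ y = of a + of b) :
    ∃ (e : M ≃ M') (Φ : RingQuot r ≃+* RingQuot r'), (∀ c, μ' (e c) = μ c) ∧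
      ∀ c, Φ (RingQuot.mkRingHom r (of c)) = RingQuot.mkRingHom r' (of (e c)) := by
  let e₀ : M ≃ M' := (Equiv.ofBijective μ hμ).trans (Equiv.ofBijective μ' hμ').symm
  have he₀ : ∀ c, μ' (e₀ c) = μ c := fun c =>
    (Equiv.ofBijective μ' hμ').apply_symm_apply (μ c)
  let e : M ≃* M' :=
    { e₀ with
      map_mul' := fun a b => hμ'.1 ((he₀ _).trans (hmul a b _ _ (he₀ a).symm (he₀ b).symm)) }
  have he : ∀ c, μ' (e c) = μ c := he₀
  have he' : ∀ c, μ (e.symm c) = μ' c := fun c => by rw [← he, e.apply_symm_apply]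
  obtain ⟨Φ, hΦ⟩ := exists_ringQuot_equiv e (r := r) (r' := r')
    (fun x y hxy => by
      obtain ⟨a, b, c, h, rfl, rfl⟩ := (hr x y).1 hxy
      exact (hr' _ _).2 ⟨e a, e b, e c, by rw [he, he, he, h], by simp, by simp⟩)
    (fun x y hxy => by
      obtain ⟨a, b, c, h, rfl, rfl⟩ := (hr' x y).1 hxy
      exact (hr _ _).2 ⟨e.symm a, e.symm b, e.symm c, by rw [he', he', he', h], by simp, by simp⟩)
  exact ⟨e.toEquiv, Φ, he, hΦ⟩

end Grothendieck

section Classified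

variable {ι : Type} [Fintype ι] (n : ι → ℕ)

/-- The elements of the monoid `M`, thought of as isomorphism classes of a semisimple tensor
category, are classified by multiplicities `μ`, in such a way that dimensions `d`, irreducibility
`P`, and the defining relations `r` of the Grothendieck ring are those prescribed by the
multiplicities, the `i`-th irreducible object having dimension `n i`. -/
structure IsClassified {M : Type*} (μ : M → ι → ℕ) (d : M → ℕ) (P : M → Prop)
    (r : FreeAbelianGroup M → FreeAbelianGroup M → Prop) : Prop where
  bijective : Function.Bijective μ
  dim_eq : ∀ c, d c = ∑ i, n i * μ c i
  irr_iff : ∀ c, P c ↔ μ c ≠ 0 ∧ ∀ a b : ι → ℕ, μ c = a + b → a = 0 ∨ b = 0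
  rel_iff : ∀ x y, r x y ↔ ∃ a b c, μ c = μ a + μ b ∧ x = FreeAbelianGroup.of c ∧
    y = FreeAbelianGroup.of a + FreeAbelianGroup.of b

variable {n}

/-- Two classifications by multiplicities, for which the multiplicities of products agree, have the
same irreducible objects and the same Grothendieck ring. -/
theorem IsClassified.exists_equiv {M M' : Type*} [Monoid M] [Monoid M'] {μ : M → ι → ℕ}
    {μ' : M' → ι → ℕ} {d : M → ℕ} {d' : M' → ℕ} {P : M → Prop} {P' : M' → Prop}
    {r : FreeAbelianGroup M → FreeAbelianGroup M → Prop}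
    {r' : FreeAbelianGroup M' → FreeAbelianGroup M' → Prop} (h : IsClassified n μ d P r)
    (h' : IsClassified n μ' d' P' r')
    (hmul : ∀ a b a' b', μ a = μ' a' → μ b = μ' b' → μ (a * b) = μ' (a' * b')) :
    ∃ (b : {c // P c} ≃ {c // P' c}) (Φ : RingQuot r ≃+* RingQuot r'),
      ∀ c, d' (b c).1 = d c.1 ∧ Φ (RingQuot.mkRingHom r (FreeAbelianGroup.of c.1)) =
        RingQuot.mkRingHom r' (FreeAbelianGroup.of (b c).1) := by
  obtain ⟨e, Φ, he, hΦ⟩ := exists_equiv_of_mult h.bijective h'.bijective hmul h.rel_iff h'.rel_iff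
  refine ⟨e.subtypeEquiv fun c => ?_, Φ, fun c => ⟨?_, hΦ _⟩⟩
  · rw [h.irr_iff, h'.irr_iff, he]
  · rw [h'.dim_eq, h.dim_eq]
    exact Finset.sum_congr rfl fun i _ => by rw [← he]; rfl

end Classified

/-! ### The Grothendieck rings of the module categories of two fibres -/

section Modules

variable {ι : Type} [Fintype ι] [DecidableEq ι] {n : ι → ℕ} [∀ i, NeZero (n i)]
  {F H : Type u} [Field F] [Ring H]

/-- The multiplicities of an isomorphism class of modules. -/
noncomputable def ModClass.mult [Algebra F H] (φ : H ≃ₐ[F] MatProd F n) :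
    ModClass F H → ι → ℕ :=
  Quotient.lift (FDModule.mult φ) fun _ _ h => FDModule.mult_eq_of_iso φ h

/-- Modules over a product of matrix algebras are classified by multiplicities. -/
lemma ModClass.isClassified [Bialgebra F H] (φ : H ≃ₐ[F] MatProd F n) :
    IsClassified n (ModClass.mult φ) ModClass.dim
      (fun c : ModClass F H => ∃ V : FDModule F H, V.IsSimple ∧ V.isoClass = c)
      (ModRel F H) where
  bijective := by
    constructor
    · rintro ⟨V⟩ ⟨W⟩ h
      exact Quotient.sound ((FDModule.iso_iff_mult_eq φ).2 h)
    · exact fun m => ⟨(FDModule.std φ m).isoClass, FDModule.mult_std φ m⟩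
  dim_eq := by
    rintro ⟨V⟩
    exact FDModule.finrank_eq_sum_mult φ V
  irr_iff := by
    rintro ⟨V⟩
    change _ ↔ FDModule.mult φ V ≠ 0 ∧ ∀ a b : ι → ℕ, FDModule.mult φ V = a + b → a = 0 ∨ b = 0
    constructor
    · rintro ⟨W, hW, h⟩
      rw [← FDModule.mult_eq_of_iso φ (Quotient.exact h)]
      exact (FDModule.isSimple_iff_mult φ W).1 hW
    · exact fun h => ⟨V, (FDModule.isSimple_iff_mult φ V).2 h, rfl⟩
  rel_iff x y := by
    constructor
    · rintro ⟨U, V, W, h⟩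
      exact ⟨U.isoClass, W.isoClass, V.isoClass, (FDModule.shortExact_iff_mult φ).1 h, rfl, rfl⟩
    · rintro ⟨⟨U⟩, ⟨W⟩, ⟨V⟩, h, rfl, rfl⟩
      exact ModRel.mk U V W ((FDModule.shortExact_iff_mult φ).2 h)

variable {O B : Type u} [CommRing O] [IsLocalRing O] [Algebra O F] [Ring B] [Bialgebra O B]
  [Bialgebra F H] [Algebra O H] [IsScalarTower O F H]

/-- The multiplicities in a tensor product of modules over a fibre are computed over `O`: they are
the ranks of the idempotents `Δ(e)` acting on tensor products of standard lattices, for the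
primitive idempotents `e`. -/
lemma FDModule.mult_tensor {q : B →ₐ[O] H} (hq : IsFiber F q) (φ : B ≃ₐ[O] MatProd O n)
    (φ' : H ≃ₐ[F] MatProd F n) (h : ∀ b, φ' (q b) = MatProd.map O F n (φ b)) (V W : FDModule F H)
    {m m' : ι → ℕ} (hm : V.mult φ' = m) (hm' : W.mult φ' = m') (i : ι) :
    mult φ' (tensor V W) i = Module.finrank O (LinearMap.range
      (action₂ (stdAction φ m) (stdAction φ m') (Coalgebra.comul (primIdem φ i)))) := by
  have hi : IsIdempotentElem (Coalgebra.comul (R := O) (primIdem φ i)) := by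
    change _ * _ = _
    rw [← Bialgebra.comul_mul, primIdem_mul_primIdem]
  refine Eq.trans ?_ (finrank_range_action₂_eq φ φ' q h V W hm hm' (hi.map _))
  rw [hq.comul_eq, map_primIdem h]
  rfl

end Modules

/-! ### The dual algebra of a bialgebra and its fibres -/

section DualPairing

variable {R C : Type*} [CommRing R] [Ring C] [Bialgebra R C]

instance [Module.Free R C] [Module.Finite R C] : Module.Free R (DualAlg R C) :=
  Module.Free.of_equiv (WithConv.linearEquiv R (C →ₗ[R] R)).symm

instance [Module.Free R C] [Module.Finite R C] : Module.Finite R (DualAlg R C) :=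
  Module.Finite.equiv (WithConv.linearEquiv R (C →ₗ[R] R)).symm

variable (R C) in
/-- The map `C* ⊗ C* → (C ⊗ C)*`. -/
noncomputable def dualPairing : DualAlg R C ⊗[R] DualAlg R C →ₗ[R] DualAlg R (C ⊗[R] C) :=
  (WithConv.linearEquiv R (C ⊗[R] C →ₗ[R] R)).symm.toLinearMap ∘ₗ TensorProduct.dualDistrib R C C ∘ₗ
    TensorProduct.map (WithConv.linearEquiv R (C →ₗ[R] R)).toLinearMap
      (WithConv.linearEquiv R (C →ₗ[R] R)).toLinearMap

lemma dualPairing_tmul (f g : DualAlg R C) (c d : C) :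
    (dualPairing R C (f ⊗ₜ g)).ofConv (c ⊗ₜ d) = f.ofConv c * g.ofConv d := rfl

lemma map_mul_of_tmul {E D : Type*} [Ring E] [Algebra R E] [Ring D] [Algebra R D]
    (P : E ⊗[R] E →ₗ[R] D) (h : ∀ a b c d, P ((a * c) ⊗ₜ (b * d)) = P (a ⊗ₜ b) * P (c ⊗ₜ d))
    (s t : E ⊗[R] E) : P (s * t) = P s * P t := by
  induction s with
  | zero => simp
  | add s s' hs hs' => simp only [add_mul, map_add, hs, hs']
  | tmul f g =>
    induction t with
    | zero => simp
    | add t t' ht ht' => simp only [mul_add, map_add, ht, ht']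
    | tmul f' g' => simp [h]

lemma dualPairing_mul (s t : DualAlg R C ⊗[R] DualAlg R C) :
    dualPairing R C (s * t) = dualPairing R C s * dualPairing R C t := by
  refine map_mul_of_tmul (dualPairing R C) (fun f g f' g' => ?_) s t
  have key : ∀ a b : DualAlg R C, dualPairing R C (a ⊗ₜ b) = WithConv.toConv
      ((LinearMap.mul' R R) ∘ₗ TensorProduct.map a.ofConv b.ofConv) := fun a b => by
    ext c d
    rfl
  have hmul : ∀ x y : WithConv (C ⊗[R] C →ₗ[R] R ⊗[R] R),
      WithConv.toConv (LinearMap.mul' R R ∘ₗ (x * y).ofConv) =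
      WithConv.toConv (LinearMap.mul' R R ∘ₗ x.ofConv) *
        WithConv.toConv (LinearMap.mul' R R ∘ₗ y.ofConv) := fun x y =>
    congrArg WithConv.toConv (LinearMap.algHom_comp_convMul_distrib
      (Algebra.TensorProduct.lmul' R (S := R)) x y)
  have h := TensorProduct.map_convMul_map (R := R) (f := f) (g := g) (h := f') (k := g')
  rw [key, key, key]
  refine Eq.trans ?_ (hmul (WithConv.toConv (TensorProduct.map f.ofConv g.ofConv))
    (WithConv.toConv (TensorProduct.map f'.ofConv g'.ofConv)))
  rw [h]

variable [Module.Free R C] [Module.Finite R C]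

lemma dualPairing_bijective : Function.Bijective (dualPairing R C) := by
  have h : Function.Bijective (TensorProduct.dualDistrib R C C) :=
    (TensorProduct.dualDistribEquiv R C C).bijective
  exact (WithConv.linearEquiv R (C ⊗[R] C →ₗ[R] R)).symm.bijective.comp
    (h.comp (TensorProduct.congr (WithConv.linearEquiv R (C →ₗ[R] R))
      (WithConv.linearEquiv R (C →ₗ[R] R))).bijective)

/-- The comultiplication of the dual algebra, `f ↦ f ∘ mul`, where `C* ⊗ C*` is identified with
`(C ⊗ C)*`. -/
noncomputable def dualComul (f : DualAlg R C) : DualAlg R C ⊗[R] DualAlg R C :=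
  (LinearEquiv.ofBijective _ dualPairing_bijective).symm
    (WithConv.toConv (f.ofConv ∘ₗ LinearMap.mul' R C))

lemma dualPairing_dualComul (f : DualAlg R C) :
    dualPairing R C (dualComul f) = WithConv.toConv (f.ofConv ∘ₗ LinearMap.mul' R C) :=
  (LinearEquiv.ofBijective _ dualPairing_bijective).apply_symm_apply _

lemma dualComul_mul (f g : DualAlg R C) : dualComul (f * g) = dualComul f * dualComul g := by
  apply dualPairing_bijective.1
  rw [dualPairing_mul, dualPairing_dualComul, dualPairing_dualComul, dualPairing_dualComul]
  exact congrArg WithConv.toConv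
    (LinearMap.convMul_comp_coalgHom_distrib f g (Bialgebra.mulCoalgHom R C))

end DualPairing

section DualFiber

variable {O F B H : Type*} [CommRing O] [CommRing F] [Algebra O F]
    [Ring B] [Bialgebra O B] [Ring H] [Bialgebra F H] [Algebra O H] [IsScalarTower O F H]

instance : IsScalarTower O F (DualAlg F H) :=
  ⟨fun a b f => by ext c; exact smul_assoc a b (f.ofConv c)⟩

/-- The map of dual algebras defined by a fibre. -/
noncomputable def IsFiber.dualMap {q : B →ₐ[O] H} (hq : IsFiber F q) :
    DualAlg O B →ₐ[O] DualAlg F H :=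
  AlgHom.ofLinearMap
    { toFun := fun f => WithConv.toConv (hq.baseChange.toDual f.ofConv)
      map_add' := fun f g => by simp
      map_smul' := fun c f => by
        ext x
        simp }
    (by
      refine WithConv.ofConv_injective (hq.baseChange.algHom_ext _ _ fun b => ?_)
      refine (hq.baseChange.toDual_comp_apply _ b).trans ?_
      simp [LinearMap.convOne_def, hq.counit_eq])
    (fun f g => by
      refine WithConv.ofConv_injective (hq.baseChange.algHom_ext _ _ fun b => ?_)
      refine (hq.baseChange.toDual_comp_apply _ b).trans ?_
      have h : ∀ t : B ⊗[O] B, algebraMap O F (LinearMap.mul' O O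
          (TensorProduct.map f.ofConv g.ofConv t)) = LinearMap.mul' F F (TensorProduct.map
            (hq.baseChange.toDual f.ofConv) (hq.baseChange.toDual g.ofConv)
            (tmapAlg F q q t)) := fun t => by
        induction t with
        | zero => simp
        | add x y hx hy => simp only [map_add, hx, hy]
        | tmul a b =>
          simp only [tmapAlg_apply, tmap_tmul, TensorProduct.map_tmul, LinearMap.mul'_apply,
            map_mul, IsBaseChange.toDual_comp_apply]
      refine (h _).trans ?_
      rw [hq.comul_eq]
      rfl)

variable {q : B →ₐ[O] H} (hq : IsFiber F q)

lemma IsFiber.dualMap_apply (f : DualAlg O B) (b : B) :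
    (hq.dualMap f).ofConv (q b) = algebraMap O F (f.ofConv b) :=
  hq.baseChange.toDual_comp_apply f.ofConv b

lemma IsFiber.isBaseChange_dualMap [Module.Free O B] [Module.Finite O B] :
    IsBaseChange F hq.dualMap.toLinearMap :=
  (IsBaseChange.iff_of_equiv_comm (WithConv.linearEquiv O (B →ₗ[O] O)).symm
    (WithConv.linearEquiv F (H →ₗ[F] F)).symm (by rfl)).1 hq.baseChange.dual

lemma IsFiber.tmapAlg_dualComul [Module.Free O B] [Module.Finite O B] [Module.Free F H]
    [Module.Finite F H] (f : DualAlg O B) :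
    tmapAlg F hq.dualMap hq.dualMap (dualComul f) = dualComul (hq.dualMap f) := by
  apply dualPairing_bijective.1
  rw [dualPairing_dualComul]
  have h : ∀ (s : DualAlg O B ⊗[O] DualAlg O B) (a b : B),
      (dualPairing F H (tmap F hq.dualMap.toLinearMap hq.dualMap.toLinearMap s)).ofConv
        (q a ⊗ₜ q b) = algebraMap O F ((dualPairing O B s).ofConv (a ⊗ₜ b)) := fun s a b => by
    induction s with
    | zero => rw [map_zero, map_zero, map_zero]; simp
    | add s t hs ht =>
      rw [map_add, map_add, map_add, WithConv.ofConv_add, WithConv.ofConv_add,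
        LinearMap.add_apply, LinearMap.add_apply, hs, ht, map_add]
    | tmul f g =>
      refine Eq.trans ?_ (map_mul (algebraMap O F) (f.ofConv a) (g.ofConv b)).symm
      rw [← hq.dualMap_apply, ← hq.dualMap_apply]
      rfl
  refine WithConv.ofConv_injective (TensorProduct.ext ?_)
  refine hq.baseChange.algHom_ext _ _ fun a => hq.baseChange.algHom_ext _ _ fun b => ?_
  refine (h _ a b).trans ?_
  rw [dualPairing_dualComul]
  refine (hq.dualMap_apply f (a * b)).symm.trans ?_
  rw [map_mul]
  rfl

end DualFiber

/-! ### The Grothendieck rings of the comodule categories of two fibres -/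

section Comodules

variable {ι : Type} [Fintype ι] [DecidableEq ι] {n : ι → ℕ} [∀ i, NeZero (n i)]
  {F H : Type u} [Field F] [Ring H] [Bialgebra F H]

/-- The multiplicities of an isomorphism class of comodules. -/
noncomputable def ComodClass.mult [Module.Finite F H] (φ : DualAlg F H ≃ₐ[F] MatProd F n) :
    ComodClass F H → ι → ℕ :=
  Quotient.lift (fun V : FDComodule F H => V.toModule.mult φ) fun _ _ h =>
    FDModule.mult_eq_of_iso φ (FDComodule.iso_iff.1 h)

/-- Comodules over a bialgebra whose dual algebra is a product of matrix algebras are classified by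
multiplicities. -/
lemma ComodClass.isClassified [Module.Finite F H] (φ : DualAlg F H ≃ₐ[F] MatProd F n) :
    IsClassified n (ComodClass.mult φ) ComodClass.dim
      (fun c : ComodClass F H => ∃ V : FDComodule F H, V.IsSimple ∧ V.isoClass = c)
      (ComodRel F H) where
  bijective := by
    constructor
    · rintro ⟨V⟩ ⟨W⟩ h
      exact Quotient.sound (FDComodule.iso_iff.2 ((FDModule.iso_iff_mult_eq φ).2 h))
    · intro m
      obtain ⟨W, hW⟩ := FDComodule.exists_coact_of_module (FDModule.std φ m)
      exact ⟨W.isoClass, (FDModule.mult_eq_of_iso φ hW).trans (FDModule.mult_std φ m)⟩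
  dim_eq := by
    rintro ⟨V⟩
    exact FDModule.finrank_eq_sum_mult φ V.toModule
  irr_iff := by
    rintro ⟨V⟩
    change _ ↔ V.toModule.mult φ ≠ 0 ∧ ∀ a b : ι → ℕ, V.toModule.mult φ = a + b → a = 0 ∨ b = 0
    constructor
    · rintro ⟨W, hW, h⟩
      rw [← FDModule.mult_eq_of_iso φ (FDComodule.iso_iff.1 (Quotient.exact h))]
      exact (FDModule.isSimple_iff_mult φ W.toModule).1 (W.isSimple_iff.1 hW)
    · exact fun h => ⟨V, V.isSimple_iff.2 ((FDModule.isSimple_iff_mult φ V.toModule).2 h), rfl⟩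
  rel_iff x y := by
    constructor
    · rintro ⟨U, V, W, h⟩
      exact ⟨U.isoClass, W.isoClass, V.isoClass,
        (FDModule.shortExact_iff_mult φ).1 (FDComodule.shortExact_iff.1 h), rfl, rfl⟩
    · rintro ⟨⟨U⟩, ⟨W⟩, ⟨V⟩, h, rfl, rfl⟩
      exact ComodRel.mk U V W (FDComodule.shortExact_iff.2 ((FDModule.shortExact_iff_mult φ).2 h))

open FDComodule in
/-- The dual algebra acts on a tensor product of comodules through its comultiplication. -/
lemma FDComodule.tensor_dualAction [Module.Finite F H] (V W : FDComodule F H) (f : DualAlg F H) :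
    (tensor V W).dualAction f = action₂ V.dualAction W.dualAction (dualComul f) := by
  have h₁ : ∀ (s : DualAlg F H ⊗[F] DualAlg F H) (x : V.carrier ⊗[F] H) (y : W.carrier ⊗[F] H)
      (g : H →ₗ[F] F), (∀ c d, (dualPairing F H s).ofConv (c ⊗ₜ d) = g (c * d)) →
      contract (V.carrier ⊗[F] W.carrier) g (mulMap F H V.carrier W.carrier (x ⊗ₜ y)) =
        contract (V.carrier ⊗[F] W.carrier) (dualPairing F H s).ofConv
          (TensorProduct.tensorTensorTensorComm F V.carrier H W.carrier H (x ⊗ₜ y)) := by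
    intro s x y g hg
    induction x with
    | zero => simp
    | add x x' hx hx' => simp only [TensorProduct.add_tmul, map_add, hx, hx']
    | tmul v c =>
      induction y with
      | zero => simp
      | add y y' hy hy' => simp only [TensorProduct.tmul_add, map_add, hy, hy']
      | tmul w d => simp [hg]
  have h₂ : ∀ (s : DualAlg F H ⊗[F] DualAlg F H) (v : V.carrier) (w : W.carrier),
      contract (V.carrier ⊗[F] W.carrier) (dualPairing F H s).ofConv
          (TensorProduct.tensorTensorTensorComm F V.carrier H W.carrier H
            (V.coact v ⊗ₜ W.coact w)) =
        action₂ V.dualAction W.dualAction s (v ⊗ₜ w) := by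
    intro s v w
    induction s with
    | zero =>
      rw [map_zero, map_zero]
      simp [contract]
    | add s t hs ht =>
      rw [map_add, map_add, WithConv.ofConv_add, contract_add, LinearMap.add_apply,
        LinearMap.add_apply, hs, ht]
    | tmul f g =>
      rw [action₂_tmul, TensorProduct.map_tmul, dualAction_apply, dualAction_apply]
      generalize V.coact v = x
      generalize W.coact w = y
      induction x with
      | zero => simp
      | add x x' hx hx' => simp only [TensorProduct.add_tmul, map_add, hx, hx']
      | tmul v c =>
        induction y with
        | zero => simp
        | add y y' hy hy' => simp only [TensorProduct.tmul_add, map_add, hy, hy']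
        | tmul w d =>
          simp [dualPairing_tmul, ← TensorProduct.smul_tmul' (f.ofConv c), smul_smul]
  refine TensorProduct.ext' fun v w => ?_
  refine (h₁ (dualComul f) (V.coact v) (W.coact w) f.ofConv fun c d => ?_).trans (h₂ _ v w)
  rw [dualPairing_dualComul]
  rfl

variable {O B : Type u} [CommRing O] [IsLocalRing O] [Algebra O F] [Ring B] [Bialgebra O B]
  [Algebra O H] [IsScalarTower O F H]

/-- The multiplicities in a tensor product of comodules over a fibre are computed over `O`, in the
same way as for modules, with the dual algebra in place of the bialgebra. -/
lemma FDComodule.mult_tensor [Module.Free O B] [Module.Finite O B] [Module.Finite F H]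
    {q : B →ₐ[O] H} (hq : IsFiber F q) (φ : DualAlg O B ≃ₐ[O] MatProd O n)
    (φ' : DualAlg F H ≃ₐ[F] MatProd F n)
    (h : ∀ f, φ' (hq.dualMap f) = MatProd.map O F n (φ f)) (V W : FDComodule F H)
    {m m' : ι → ℕ} (hm : V.toModule.mult φ' = m) (hm' : W.toModule.mult φ' = m') (i : ι) :
    (tensor V W).toModule.mult φ' i = Module.finrank O (LinearMap.range
      (action₂ (stdAction φ m) (stdAction φ m') (dualComul (primIdem φ i)))) := by
  have hi : IsIdempotentElem (dualComul (primIdem φ i)) := by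
    change _ * _ = _
    rw [← dualComul_mul, primIdem_mul_primIdem]
  refine Eq.trans ?_ (FDModule.finrank_range_action₂_eq φ φ' hq.dualMap h V.toModule W.toModule
    hm hm' (hi.map _))
  rw [hq.tmapAlg_dualComul, map_primIdem h]
  change Module.finrank F (LinearMap.range ((tensor V W).dualAction _)) = _
  rw [tensor_dualAction]
  rfl

end Comodules

/-! ### Extension of scalars -/

section BaseChange

variable {ι : Type} [Fintype ι] [DecidableEq ι] {n : ι → ℕ} [∀ i, NeZero (n i)]
  {F E : Type u} [Field F] [Ring E] (L : Type u) [Field L] [Algebra F L]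

lemma FDModule.mult_baseChange [Algebra F E] (φ : E ≃ₐ[F] MatProd F n)
    (φ' : (L ⊗[F] E) ≃ₐ[L] MatProd L n)
    (h : ∀ b, φ' (1 ⊗ₜ b) = MatProd.map F L n (φ b)) (V : FDModule F E) :
    (V.baseChange L).mult φ' = V.mult φ := by
  funext i
  have hi : (1 : L) ⊗ₜ[F] primIdem φ i = primIdem φ' i :=
    map_primIdem (φ := φ) (φ' := φ')
      (q := (Algebra.TensorProduct.includeRight : E →ₐ[F] L ⊗[F] E)) h i
  rw [mult, ← hi]
  refine finrank_range_of_isBaseChange (TensorProduct.isBaseChange F V.carrier L)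
    (V.action (primIdem φ i)) ?_ _ fun v => ?_
  · change _ * _ = _
    rw [← map_mul, primIdem_mul_primIdem]
  · refine Eq.trans ?_ (LinearMap.congr_fun (Algebra.TensorProduct.lift_tmul
      (Algebra.ofId L (Module.End L (L ⊗[F] V.carrier)))
      ((Module.End.baseChangeHom F L V.carrier).comp V.action) (fun l _ => Algebra.commutes l _)
      1 (primIdem φ i)) (1 ⊗ₜ v)).symm
    rw [map_one (Algebra.ofId L (Module.End L (L ⊗[F] V.carrier))), one_mul]
    rfl

/-- If `E` is a product of matrix algebras, then every module over `L ⊗ E` is defined over the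
ground field. -/
theorem FDModule.exists_baseChange_iso [Algebra F E] (φ : E ≃ₐ[F] MatProd F n)
    (V : FDModule L (L ⊗[F] E)) : ∃ V₀ : FDModule F E, Iso (V₀.baseChange L) V := by
  obtain ⟨φ', h⟩ := exists_matProd_of_isBaseChange
    (q := (Algebra.TensorProduct.includeRight : E →ₐ[F] L ⊗[F] E))
    (TensorProduct.isBaseChange F E L) φ
  exact ⟨std φ (V.mult φ'), (iso_iff_mult_eq φ').2 (by rw [mult_baseChange L φ φ' h, mult_std])⟩

lemma FDComodule.mult_baseChange [Bialgebra F E] [Module.Finite F E]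
    (φ : DualAlg F E ≃ₐ[F] MatProd F n)
    (φ' : DualAlg L (L ⊗[F] E) ≃ₐ[L] MatProd L n)
    (h : ∀ f, φ' ((isFiber_includeRight (O := F) (F := L) (B := E)).dualMap f) =
      MatProd.map F L n (φ f))
    (V : FDComodule F E) : (V.baseChange L).toModule.mult φ' = V.toModule.mult φ := by
  funext i
  rw [FDModule.mult, ← map_primIdem h]
  refine finrank_range_of_isBaseChange (TensorProduct.isBaseChange F V.carrier L)
    (V.dualAction (primIdem φ i)) ?_ _ fun v => ?_
  · change _ * _ = _
    rw [← map_mul, primIdem_mul_primIdem]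
  · set f := primIdem φ i
    have hf : ∀ x : V.carrier ⊗[F] E, (1 : L) ⊗ₜ[F] contract V.carrier f.ofConv x =
        contract (L ⊗[F] V.carrier)
          ((isFiber_includeRight (O := F) (F := L) (B := E)).dualMap f).ofConv
          (TensorProduct.AlgebraTensorModule.distribBaseChange F L V.carrier E (1 ⊗ₜ x)) := by
      intro x
      induction x with
      | zero => simp
      | add x y hx hy => simp only [map_add, TensorProduct.tmul_add, hx, hy]
      | tmul v c =>
        have hc := (isFiber_includeRight (O := F) (F := L) (B := E)).dualMap_apply f c
        rw [Algebra.TensorProduct.includeRight_apply] at hc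
        rw [TensorProduct.AlgebraTensorModule.distribBaseChange_tmul, contract_tmul, contract_tmul,
          hc, algebraMap_smul, TensorProduct.tmul_smul]
    refine (hf (V.coact v)).trans ?_
    rw [← baseChangeCoact_tmul]
    rfl

/-- If the dual of `E` is a product of matrix algebras, then every comodule over `L ⊗ E` is defined
over the ground field. -/
theorem FDComodule.exists_baseChange_iso [Bialgebra F E] [Module.Finite F E]
    (φ : DualAlg F E ≃ₐ[F] MatProd F n)
    (V : FDComodule L (L ⊗[F] E)) : ∃ V₀ : FDComodule F E, Iso (V₀.baseChange L) V := by
  obtain ⟨φ', h⟩ := exists_matProd_of_isBaseChange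
    (isFiber_includeRight (O := F) (F := L) (B := E)).isBaseChange_dualMap φ
  obtain ⟨V₀, hV₀⟩ := exists_coact_of_module (FDModule.std φ (V.toModule.mult φ'))
  refine ⟨V₀, iso_iff.2 ((FDModule.iso_iff_mult_eq φ').2 ?_)⟩
  rw [mult_baseChange L φ φ' h, FDModule.mult_eq_of_iso φ hV₀, FDModule.mult_std]

end BaseChange

/-! ### Comparison of two fibres -/

section Comparison

variable {ι : Type} [Fintype ι] [DecidableEq ι] {n : ι → ℕ} [∀ i, NeZero (n i)]
  {O B F H F' H' : Type u} [CommRing O] [IsLocalRing O] [Ring B] [Bialgebra O B]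
  [Field F] [Algebra O F] [Ring H] [Bialgebra F H] [Algebra O H] [IsScalarTower O F H]
  [Field F'] [Algebra O F'] [Ring H'] [Bialgebra F' H'] [Algebra O H'] [IsScalarTower O F' H']
  {q : B →ₐ[O] H} {q' : B →ₐ[O] H'}

/-- If a bialgebra over a local ring is a product of matrix algebras, then its fibres have the same
irreducible modules and the same Grothendieck ring. -/
theorem exists_irrMod_equiv (hq : IsFiber F q) (hq' : IsFiber F' q') (φ : B ≃ₐ[O] MatProd O n) :
    ∃ (b : IrrMod F H ≃ IrrMod F' H')
      (Φ : ModGrothendieckRing F H ≃+* ModGrothendieckRing F' H'),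
      ∀ c : IrrMod F H, (b c).1.dim = c.1.dim ∧
        Φ c.1.toGrothendieckRing = (b c).1.toGrothendieckRing := by
  obtain ⟨φ₁, h₁⟩ := exists_matProd_of_isBaseChange hq.baseChange φ
  obtain ⟨φ₂, h₂⟩ := exists_matProd_of_isBaseChange hq'.baseChange φ
  refine (ModClass.isClassified φ₁).exists_equiv (ModClass.isClassified φ₂) ?_
  rintro ⟨V⟩ ⟨W⟩ ⟨V'⟩ ⟨W'⟩ hV hW
  funext i
  exact (FDModule.mult_tensor hq φ φ₁ h₁ V W hV hW i).trans
    (FDModule.mult_tensor hq' φ φ₂ h₂ V' W' rfl rfl i).symm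

/-- If the dual of a bialgebra over a local ring is a product of matrix algebras, then the fibres of
the bialgebra have the same irreducible comodules and the same Grothendieck ring of comodules. -/
theorem exists_irrComod_equiv [Module.Free O B] [Module.Finite O B] [Module.Finite F H]
    [Module.Finite F' H'] (hq : IsFiber F q) (hq' : IsFiber F' q')
    (φ : DualAlg O B ≃ₐ[O] MatProd O n) :
    ∃ (b : IrrComod F H ≃ IrrComod F' H')
      (Φ : ComodGrothendieckRing F H ≃+* ComodGrothendieckRing F' H'),
      ∀ c : IrrComod F H, (b c).1.dim = c.1.dim ∧
        Φ c.1.toGrothendieckRing = (b c).1.toGrothendieckRing := by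
  obtain ⟨φ₁, h₁⟩ := exists_matProd_of_isBaseChange hq.isBaseChange_dualMap φ
  obtain ⟨φ₂, h₂⟩ := exists_matProd_of_isBaseChange hq'.isBaseChange_dualMap φ
  refine (ComodClass.isClassified φ₁).exists_equiv (ComodClass.isClassified φ₂) ?_
  rintro ⟨V⟩ ⟨W⟩ ⟨V'⟩ ⟨W'⟩ hV hW
  funext i
  exact (FDComodule.mult_tensor hq φ φ₁ h₁ V W hV hW i).trans
    (FDComodule.mult_tensor hq' φ φ₂ h₂ V' W' rfl rfl i).symm

lemma isSemisimpleRing_of_matProd {F E : Type*} [Field F] [Ring E] [Algebra F E]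
    (φ : E ≃ₐ[F] MatProd F n) : IsSemisimpleRing E :=
  φ.symm.toRingEquiv.isSemisimpleRing

end Comparison

/-! ### Lifting semisimple and cosemisimple Hopf algebras -/

section Lifting

open Coalgebra

variable {O k A : Type u} [CommRing O] [IsDomain O] [Field k] [Algebra O k] {ϖ : O}
  [Ring A] [HopfAlgebra k A] [Algebra O A] [IsScalarTower O k A] [Module.Finite k A]

namespace IsResidueMap

/-- A finite free algebra lifting the algebra `A` carries a Hopf algebra structure lifting that
of `A`. -/
theorem exists_hopfAlgebra_lift (h : IsResidueMap k ϖ) {B : Type u} [Ring B] [Algebra O B]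
    [Module.Free O B] [Module.Finite O B] {q : B →ₐ[O] A}
    (hq : IsBaseChange k q.toLinearMap) {e : A ⊗[k] A} (he : IsSepIdempotent e) {Λ : A}
    {l : A →ₗ[k] k} (hi : IsIntegralPair Λ l) :
    ∃ (C : Type u) (_ : Ring C) (_ : HopfAlgebra O C) (q : C →ₐ[O] A),
      Module.Free O C ∧ Module.Finite O C ∧ IsFiber k q := by
  obtain ⟨Δ, hΔq, hΔ⟩ := h.exists_coassoc_lift hq he hi
  obtain ⟨ε, hεq, hr, hl⟩ := h.exists_counit hq he Δ hΔq hΔ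
  let _ : Bialgebra O B := Bialgebra.ofAlgHom Δ ε
    (AlgHom.ext fun b => (sub_eq_zero.1 (LinearMap.congr_fun hΔ b)).symm)
    (AlgHom.ext fun b => (TensorProduct.lid O B).injective
      ((hl b).trans (by simp)))
    (AlgHom.ext fun b => (TensorProduct.rid O B).injective
      ((hr b).trans (by simp)))
  obtain ⟨S, hS, hS'⟩ := h.exists_antipode hq hΔq hεq
  let _ : HopfAlgebra O B :=
    { antipode := S
      mul_antipode_rTensor_comul := hS
      mul_antipode_lTensor_comul := hS' }
  exact ⟨B, inferInstance, inferInstance, q, inferInstance, inferInstance, hq, hΔq, hεq⟩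

variable [IsAlgClosed k]

/-- If the reduction of a finite free algebra is semisimple over an algebraically closed field, then
the algebra is a product of matrix algebras. -/
lemma exists_matProd (h : IsResidueMap k ϖ) {E B : Type*} [Ring E] [Algebra k E] [Algebra O E]
    [IsScalarTower O k E] [Module.Finite k E] [IsSemisimpleRing E] [Ring B] [Algebra O B]
    [Module.Free O B] [Module.Finite O B] {q : B →ₐ[O] E} (hq : IsBaseChange k q.toLinearMap) :
    ∃ (m : ℕ) (n : Fin m → ℕ), (∀ i, NeZero (n i)) ∧ Nonempty (B ≃ₐ[O] MatProd O n) := by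
  obtain ⟨m, n, hn, ⟨ψ⟩⟩ := IsSemisimpleRing.exists_algEquiv_pi_matrix_of_isAlgClosed k E
  obtain ⟨e, he⟩ := exists_isSepIdempotent_matProd (n := n) ψ
  obtain ⟨g, -⟩ := h.exists_algEquiv_lift hq (r := MatProd.map O k n)
    (StdMod.isBaseChange_map n n) he ψ
  exact ⟨m, n, hn, ⟨g⟩⟩

/-- A semisimple and cosemisimple Hopf algebra over the residue field lifts. As an algebra the lift
is the product of matrix algebras of the same sizes. -/
theorem exists_fiber (h : IsResidueMap k ϖ) (hss : IsSemisimpleRing A) (hcs : IsCosemisimple k A) :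
    ∃ (B : Type u) (_ : Ring B) (_ : HopfAlgebra O B) (q : B →ₐ[O] A),
      Module.Free O B ∧ Module.Finite O B ∧ IsFiber k q := by
  obtain ⟨m, n, hn, ⟨ψ⟩⟩ := IsSemisimpleRing.exists_algEquiv_pi_matrix_of_isAlgClosed k A
  obtain ⟨e, he⟩ := exists_isSepIdempotent_matProd (n := n) ψ
  obtain ⟨Λ, l, hi⟩ := exists_isIntegralPair hss hcs
  have hq : IsBaseChange k ((ψ.symm.toAlgHom.restrictScalars O).comp
      (MatProd.map O k n)).toLinearMap :=
    (IsBaseChange.iff_of_equiv_comm (LinearEquiv.refl O _) ψ.symm.toLinearEquiv (by rfl)).1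
      (StdMod.isBaseChange_map (O := O) (F := k) n n)
  exact h.exists_hopfAlgebra_lift hq he hi

/-- The lift of a semisimple and cosemisimple Hopf algebra is unique. -/
theorem nonempty_bialgEquiv_of_isFiber (h : IsResidueMap k ϖ) (hss : IsSemisimpleRing A)
    (hcs : IsCosemisimple k A) {B B' : Type u} [Ring B] [Bialgebra O B] [Ring B'] [Bialgebra O B']
    [Module.Free O B] [Module.Finite O B] [Module.Free O B'] [Module.Finite O B']
    {q : B →ₐ[O] A} {q' : B' →ₐ[O] A} (hq : IsFiber k q) (hq' : IsFiber k q') :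
    Nonempty (B ≃ₐc[O] B') := by
  obtain ⟨m, n, hn, ⟨ψ⟩⟩ := IsSemisimpleRing.exists_algEquiv_pi_matrix_of_isAlgClosed k A
  obtain ⟨e, he⟩ := exists_isSepIdempotent_matProd (n := n) ψ
  obtain ⟨Λ, l, hi⟩ := exists_isIntegralPair hss hcs
  exact h.nonempty_bialgEquiv hq hq' he hi

/-- The dual of a lift of a cosemisimple Hopf algebra is a product of matrix algebras. -/
lemma exists_matProd_dual (h : IsResidueMap k ϖ) (hcs : IsCosemisimple k A)
    {B : Type u} [Ring B] [Bialgebra O B] [Module.Free O B] [Module.Finite O B] {q : B →ₐ[O] A}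
    (hq : IsFiber k q) :
    ∃ (m : ℕ) (n : Fin m → ℕ), (∀ i, NeZero (n i)) ∧ Nonempty (DualAlg O B ≃ₐ[O] MatProd O n) :=
  have := hcs.isSemisimpleRing_dual
  h.exists_matProd hq.isBaseChange_dualMap

end IsResidueMap

end Lifting

/-! ### The ring of Witt vectors -/

lemma isResidueMap_wittVector (p : ℕ) [Fact p.Prime] (k : Type u) [Field k] [CharP k p]
    [IsAlgClosed k] : IsResidueMap k (p : WittVector p k) where
  ne_zero := WittVector.p_nonzero p k
  surjective := WittVector.constantCoeff_surjective p
  ker x := by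
    rw [← Ideal.mem_span_singleton, ← WittVector.ker_constantCoeff]
    rfl
  complete := WittVector.isAdicCompleteIdealSpanP

section Lift

variable {p : ℕ} [Fact p.Prime] {k : Type u} [Field k] [CharP k p] {N : ℕ} {A B : Type u} [Ring A]
  [HopfAlgebra k A] [Algebra (WittVector p k) A] [IsScalarTower (WittVector p k) k A] [Ring B]
  [HopfAlgebra (WittVector p k) B]

lemma IsLift.exists_isFiber (h : IsLift p k N A B) :
    ∃ q : B →ₐ[WittVector p k] A, IsFiber k q :=
  h.reduction.elim fun e => ⟨_, isFiber_includeRight.comp_equiv e⟩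

end Lift

end HopfLift

theorem theorem2p1 (p : ℕ) [Fact p.Prime] (k : Type u) [Field k] [CharP k p] [IsAlgClosed k]
    (A : Type u) [Ring A] [HopfAlgebra k A] [Module.Finite k A]
    (N : ℕ) (hN : Module.finrank k A = N)
    (hss : IsSemisimpleRing A) (hcs : HopfLift.IsCosemisimple k A)
    (K : Type u) [Field K] [Algebra (WittVector p k) K] [IsFractionRing (WittVector p k) K] :
    -- (i) existence of a lift
    (∃ (B : Type u) (_ : Ring B) (_ : HopfAlgebra (WittVector p k) B),
      HopfLift.IsLift p k N A B) ∧
    -- (i) uniqueness of the lift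
    (∀ (B B' : Type u) [Ring B] [HopfAlgebra (WittVector p k) B]
      [Ring B'] [HopfAlgebra (WittVector p k) B'],
      HopfLift.IsLift p k N A B → HopfLift.IsLift p k N A B' →
        Nonempty (B ≃ₐc[WittVector p k] B')) ∧
    -- (ii) the generic fibre `K ⊗ B` of a lift
    (∀ (B : Type u) [Ring B] [HopfAlgebra (WittVector p k) B], HopfLift.IsLift p k N A B →
      IsSemisimpleRing (K ⊗[WittVector p k] B) ∧
      HopfLift.IsCosemisimple K (K ⊗[WittVector p k] B) ∧
      -- irreducible modules and comodules over the algebraic closure are defined over `K`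
      (∀ V : HopfLift.FDModule (AlgebraicClosure K)
          (AlgebraicClosure K ⊗[K] (K ⊗[WittVector p k] B)), V.IsSimple →
        ∃ V₀ : HopfLift.FDModule K (K ⊗[WittVector p k] B),
          HopfLift.FDModule.Iso (V₀.baseChange (AlgebraicClosure K)) V) ∧
      (∀ V : HopfLift.FDComodule (AlgebraicClosure K)
          (AlgebraicClosure K ⊗[K] (K ⊗[WittVector p k] B)), V.IsSimple →
        ∃ V₀ : HopfLift.FDComodule K (K ⊗[WittVector p k] B),
          HopfLift.FDComodule.Iso (V₀.baseChange (AlgebraicClosure K)) V) ∧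
      -- irreducible modules: same dimensions and same Grothendieck ring
      (∃ (b : HopfLift.IrrMod k A ≃ HopfLift.IrrMod K (K ⊗[WittVector p k] B))
          (φ : HopfLift.ModGrothendieckRing k A ≃+*
            HopfLift.ModGrothendieckRing K (K ⊗[WittVector p k] B)),
        ∀ c : HopfLift.IrrMod k A, (b c).1.dim = c.1.dim ∧
          φ c.1.toGrothendieckRing = (b c).1.toGrothendieckRing) ∧
      -- irreducible comodules: same dimensions and same Grothendieck ring
      (∃ (b : HopfLift.IrrComod k A ≃ HopfLift.IrrComod K (K ⊗[WittVector p k] B))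
          (φ : HopfLift.ComodGrothendieckRing k A ≃+*
            HopfLift.ComodGrothendieckRing K (K ⊗[WittVector p k] B)),
        ∀ c : HopfLift.IrrComod k A, (b c).1.dim = c.1.dim ∧
          φ c.1.toGrothendieckRing = (b c).1.toGrothendieckRing)) := by
  let _ : Algebra (WittVector p k) A := ((algebraMap k A).comp
    (algebraMap (WittVector p k) k)).toAlgebra' fun c x => Algebra.commutes _ x
  have : IsScalarTower (WittVector p k) k A := IsScalarTower.of_algebraMap_eq' rfl
  have hres := HopfLift.isResidueMap_wittVector p k
  refine ⟨?_, ?_, ?_⟩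
  · obtain ⟨B, _, _, q, hfree, hfin, hq⟩ := hres.exists_fiber hss hcs
    obtain ⟨e⟩ := hq.nonempty_equiv
    refine ⟨B, _, _, hfree, hfin, ?_, ⟨e⟩⟩
    rw [← hN, ← LinearEquiv.finrank_eq (e : (k ⊗[WittVector p k] B) ≃ₗ[k] A),
      Module.finrank_baseChange]
  · intro B B' _ _ _ _ hB hB'
    have := hB.free
    have := hB.finite
    have := hB'.free
    have := hB'.finite
    obtain ⟨q, hq⟩ := hB.exists_isFiber
    obtain ⟨q', hq'⟩ := hB'.exists_isFiber
    exact hres.nonempty_bialgEquiv_of_isFiber hss hcs hq hq'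
  · intro B _ _ hB
    have := hB.free
    have := hB.finite
    obtain ⟨q, hq⟩ := hB.exists_isFiber
    have hqK := HopfLift.isFiber_includeRight (O := WittVector p k) (F := K) (B := B)
    obtain ⟨m, n, hn, ⟨φ⟩⟩ := hres.exists_matProd hq.baseChange
    obtain ⟨m', n', hn', ⟨φ'⟩⟩ := hres.exists_matProd_dual hcs hq
    obtain ⟨φK, -⟩ := HopfLift.exists_matProd_of_isBaseChange hqK.baseChange φ
    obtain ⟨φK', -⟩ := HopfLift.exists_matProd_of_isBaseChange hqK.isBaseChange_dualMap φ'
    exact ⟨HopfLift.isSemisimpleRing_of_matProd φK,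
      HopfLift.isCosemisimple_of_dual (HopfLift.isSemisimpleRing_of_matProd φK'),
      fun V _ => HopfLift.FDModule.exists_baseChange_iso (AlgebraicClosure K) φK V,
      fun V _ => HopfLift.FDComodule.exists_baseChange_iso (AlgebraicClosure K) φK' V,
      HopfLift.exists_irrMod_equiv hq hqK φ, HopfLift.exists_irrComod_equiv hq hqK φ'⟩
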